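/- Fix an integer $p\ge 2$. **Setting.** Let $\widetilde{\mathbb C^\star}=\{(re^{ib},b): r>0,\ b\in\mathbb R\}$ be the universal cover of $\mathbb C^\star$, with $\pi(re^{ib},b)=re^{ib}$, $\widetilde 1=(1,0)$, the global holomorphic coordinate $\widetilde{\log}(re^{ib},b)=\log r+ib$ and the map $(re^{ib},b)\mapsto(r^pe^{ipb},pb)$, along which $\phi_p$ pulls functions back (so $\phi_p(\widetilde{\log})=p\,\widetilde{\log}$). Let $\Sigma_0$ (resp. $\Sigma_\infty$) be the set of points of $\widetilde{\mathbb C^\star}$ with $r<1$ (resp. $r>1$). For an open subset $U$ of a Riemann surface, $\mathcal M(U)$ is the ring of meromorphic functions on $U$; $D(0,1)$ and $\overline D(0,1)$ are the open and closed unit disks. **The category $\mathcal C$.** Its objects of rank $n\ge 0$ are the tuples $(A_0,A_1,A_\infty,\widetilde M_0,\widetilde M_\infty)\in GL_n(\mathbb C)^3\times GL_n(\mathcal M(\Sigma_0))\times GL_n(\mathcal M(\Sigma_\infty))$ with $\phi_p(\widetilde M_0)=A_1\widetilde M_0A_0^{-1}$ and $\phi_p(\widetilde M_\infty)=A_1\widetilde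 M_\infty A_\infty^{-1}$ for which there exist $\widetilde W_1\in GL_n(\mathcal M(\widetilde{\mathbb C^\star}))$, $W_0\in GL_n(\mathcal M(D(0,1)))$ and $W_\infty\in GL_n(\mathcal M(\mathbb P^1(\mathbb C)\setminus\overline D(0,1)))$ with $\widetilde W_1\widetilde M_0=\pi^\star W_0$ on $\Sigma_0$ and $\widetilde W_1\widetilde M_\infty=\pi^\star W_\infty$ on $\Sigma_\infty$. A morphism from $(A_0,A_1,A_\infty,\widetilde M_0,\widetilde M_\infty)$ of rank $n_1$ to $(B_0,B_1,B_\infty,\widetilde N_0,\widetilde N_\infty)$ of rank $n_2$ is a triple $(S_0,\widetilde S_1,S_\infty)$ of $n_2\times n_1$ matrices, $S_0,S_\infty$ over $\mathbb C$ and $\widetilde S_1$ over the Laurent polynomials $\mathbb C[\widetilde{\log},\widetilde{\log}^{-1}]$, such that $S_0A_0=B_0S_0$, $\phi_p(\widetilde S_1)A_1=B_1\widetilde S_1$, $S_\infty A_\infty=B_\infty S_\infty$, $\widetilde S_1\widetilde M_0=\widetilde N_0S_0$ and $\widetilde S_1\widetilde M_\infty=\widetilde N_\infty S_\infty$. Composition,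 addition and scalar multiplication are componentwise; the tensor product of objects and of morphisms is the componentwise Kronecker product, with the evident unit (of rank $1$), associativity and symmetry. **The subcategories.** For finite sets $E_0\subset D(0,1)\setminus\{0\}$ and $E_\infty\subset\mathbb C\setminus\overline D(0,1)$, and for $i=0,\infty$, let $\widetilde E_i\subset\widetilde{\mathbb C^\star}$ be the set of all points over $E_i^{p^{\mathbb Z}}=\{z: z=e^{p^k}\text{ or } z^{p^k}=e\text{ for some } e\in E_i,\ k\in\mathbb Z_{\ge 0}\}$. Let $\mathcal C_{E_0,E_\infty}$ be the full subcategory of $\mathcal C$ of the objects for which, for $i=0,\infty$, all the poles of the entries of $\widetilde M_i$ and of $\widetilde M_i^{-1}$ lie in $\widetilde E_i$. It contains the unit and is stable under tensor products. **The functors.** For $\widetilde a\in\widetilde{\mathbb C^\star}\setminus\{\widetilde 1\}$ let $\omega_0,\omega_\infty,\omega_1^{(\widetilde a)}:\mathcal C\to\mathrm{Vect}^f_{\mathbb C}$ (finite-dimensional complex vector spaces) send an object of rank $n$ to $\mathbb C^n$ and a morphism $(S_0,\widetilde S_1,S_\infty)$ to $S_0$, to $S_\infty$ and to $\widetilde S_1(\widetilde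 a)$ respectively, with the tensor structure given by $\mathbb C^n\otimes\mathbb C^m=\mathbb C^{nm}$. A *neutral Tannakian category over $\mathbb C$* is a $\mathbb C$-linear abelian rigid symmetric monoidal category with $\mathbb C$-bilinear tensor product and $\mathrm{End}(\mathbf 1)=\mathbb C$ that has a *fibre functor*, i.e. a $\mathbb C$-linear, exact, faithful symmetric monoidal functor to $\mathrm{Vect}^f_{\mathbb C}$. **Theorem.** 1. $\mathcal C$ is a neutral Tannakian category over $\mathbb C$, and $\omega_0$, $\omega_\infty$ and all $\omega_1^{(\widetilde a)}$, $\widetilde a\neq\widetilde 1$, are fibre functors on it. 2. For all $E_0$, $E_\infty$ as above, every morphism of $\mathcal C_{E_0,E_\infty}$ has a kernel in $\mathcal C_{E_0,E_\infty}$, $\mathcal C_{E_0,E_\infty}$ is a neutral Tannakian category over $\mathbb C$, and the restrictions of $\omega_0$, $\omega_\infty$ and all $\omega_1^{(\widetilde a)}$, $\widetilde a\neq\widetilde 1$, are fibre functors on it. 3. Every object of $\mathcal C$ is an object of $\mathcal C_{E_0,E_\infty}$ for some finite $E_0\subset D(0,1)\setminus\{0\}$ and $E_\infty\subset\mathbb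 C\setminus\overline D(0,1)$. -/

import Mathlib

open CategoryTheory MonoidalCategory Limits Filter Topology
open scoped LaurentPolynomial

noncomputable section

namespace Mahler

/-! ### The universal cover of `ℂ*` -/

/-- The universal cover `{(r e^{ib}, b) : r > 0, b ∈ ℝ}` of `ℂ*`. -/
def UnivCover : Type :=
  {x : ℂ × ℝ // ∃ r : ℝ, 0 < r ∧ x.1 = r * Complex.exp (x.2 * Complex.I)}

/-- The logarithm `(r e^{ib}, b) ↦ log r + i b`, a bijection of the universal cover with `ℂ`
(by which the universal cover is a Riemann surface). -/
def logT : UnivCover ≃ ℂ where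
  toFun x := (Real.log ‖x.1.1‖ : ℂ) + x.1.2 * Complex.I
  invFun u := ⟨(Complex.exp u, u.im), Real.exp u.re, Real.exp_pos _, by
    rw [Complex.ofReal_exp, ← Complex.exp_add, Complex.re_add_im]⟩
  left_inv := by
    rintro ⟨⟨z, b⟩, r, hr, h⟩
    have h' : z = r * Complex.exp (b * Complex.I) := h
    have hn : ‖z‖ = r := by
      rw [h', norm_mul, Complex.norm_exp_ofReal_mul_I, mul_one, Complex.norm_real,
        Real.norm_of_nonneg hr.le]
    refine Subtype.ext (Prod.ext ?_ ?_)
    · change Complex.exp ((Real.log ‖z‖ : ℂ) + b * Complex.I) = z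
      rw [hn, Complex.exp_add, ← Complex.ofReal_exp, Real.exp_log hr, h']
    · simp
  right_inv u := by
    simp [Complex.norm_exp]

lemma logT_apply (x : UnivCover) : logT x = (Real.log ‖x.1.1‖ : ℂ) + x.1.2 * Complex.I := rfl

/-- The projection `π = exp ∘ logT` to `ℂ*`, that is, the first coordinate. -/
def proj (x : UnivCover) : ℂ := x.1.1

lemma proj_eq_exp_logT (x : UnivCover) : proj x = Complex.exp (logT x) := by
  conv_lhs => rw [← logT.symm_apply_apply x]
  rfl

/-- The point `(1, 0)` of the universal cover. -/
def oneT : UnivCover := ⟨(1, 0), 1, one_pos, by simp⟩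

lemma logT_eq_zero {x : UnivCover} : logT x = 0 ↔ x = oneT := by
  have : logT oneT = 0 := by
    rw [logT_apply, oneT]
    simp
  rw [← this, logT.apply_eq_iff_eq]

/-- The map `(r e^{ib}, b) ↦ (r^p e^{ipb}, pb)`. -/
def powT (p : ℕ) (x : UnivCover) : UnivCover :=
  ⟨(x.1.1 ^ p, p * x.1.2), by
    obtain ⟨r, hr, h⟩ := x.2
    refine ⟨r ^ p, pow_pos hr p, ?_⟩
    rw [h, mul_pow, ← Complex.exp_nat_mul]
    push_cast
    ring_nf⟩

lemma logT_powT (p : ℕ) (x : UnivCover) : logT (powT p x) = p * logT x := by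
  rw [logT_apply, logT_apply, powT, norm_pow, Real.log_pow]
  push_cast
  ring

/-- `Σ₀`, the part of the universal cover over the punctured open unit disk. -/
def Sigma0 : Set UnivCover := {x | ‖proj x‖ < 1}

/-- `Σ_∞`, the part of the universal cover over the complement of the closed unit disk. -/
def SigmaInf : Set UnivCover := {x | 1 < ‖proj x‖}

/-! ### Meromorphic functions -/

/-- The functions that are meromorphic at each point of `U`. -/
def meroFun (U : Set ℂ) : Subring (ℂ → ℂ) where
  carrier := {f | MeromorphicOn f U}
  mul_mem' hf hg := hf.mul hg
  one_mem' := MeromorphicOn.const 1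
  add_mem' hf hg := hf.add hg
  zero_mem' := MeromorphicOn.const 0
  neg_mem' hf := hf.neg

/-- `𝓜(U)` for an open `U ⊆ ℂ`: functions meromorphic on `U`, two of them being identified when
they agree off a subset of `U` without accumulation point in `U`. -/
def meroSubring (U : Set ℂ) : Subring (Germ (codiscreteWithin U) ℂ) :=
  (meroFun U).map (Germ.coeRingHom (codiscreteWithin U))

/-- `𝓜(U)` as a type. -/
def Mero (U : Set ℂ) : Type := meroSubring U

instance (U : Set ℂ) : CommRing (Mero U) := inferInstanceAs (CommRing (meroSubring U))

/-- The open unit disk. -/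
def disk : Set ℂ := {z | ‖z‖ < 1}

/-- The complement in `ℂ` of the closed unit disk. -/
def extDisk : Set ℂ := {z | 1 < ‖z‖}

/-- The functions that are meromorphic on the complement of the closed unit disk in the Riemann
sphere, the point at infinity included. -/
def meroExtFun : Subring (ℂ → ℂ) where
  carrier := {f | MeromorphicOn f extDisk ∧ MeromorphicAt (fun w => f w⁻¹) 0}
  mul_mem' hf hg := ⟨hf.1.mul hg.1, hf.2.mul hg.2⟩
  one_mem' := ⟨MeromorphicOn.const 1, MeromorphicAt.const 1 0⟩
  add_mem' hf hg := ⟨hf.1.add hg.1, hf.2.add hg.2⟩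
  zero_mem' := ⟨MeromorphicOn.const 0, MeromorphicAt.const 0 0⟩
  neg_mem' hf := ⟨hf.1.neg, hf.2.neg⟩

/-- `𝓜(ℙ¹(ℂ) ∖ D̄(0,1))`, with the same identification as in `meroSubring`. -/
def meroExtSubring : Subring (Germ (codiscreteWithin extDisk) ℂ) :=
  meroExtFun.map (Germ.coeRingHom (codiscreteWithin extDisk))

/-- `𝓜(ℙ¹(ℂ) ∖ D̄(0,1))` as a type. -/
def MeroExt : Type := meroExtSubring

instance : CommRing MeroExt := inferInstanceAs (CommRing meroExtSubring)

/-- The inclusion of `𝓜(U)` into germs. -/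
def Mero.toGerm (U : Set ℂ) : Mero U →+* Germ (codiscreteWithin U) ℂ := (meroSubring U).subtype

lemma Mero.toGerm_injective (U : Set ℂ) : Function.Injective (Mero.toGerm U) :=
  Subtype.val_injective

/-- The class in `𝓜(U)` of a function that is meromorphic on `U`. -/
def Mero.mk {U : Set ℂ} (f : ℂ → ℂ) (hf : MeromorphicOn f U) : Mero U := ⟨f, f, hf, rfl⟩

@[simp] lemma Mero.toGerm_mk {U : Set ℂ} (f : ℂ → ℂ) (hf : MeromorphicOn f U) :
    Mero.toGerm U (Mero.mk f hf) = (f : Germ (codiscreteWithin U) ℂ) := rfl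

/-- `𝓜(ℙ¹(ℂ) ∖ D̄(0,1))` as a subring of `𝓜(ℂ ∖ D̄(0,1))`. -/
def MeroExt.toMero : MeroExt →+* Mero extDisk :=
  Subring.inclusion (S := meroExtSubring) (T := meroSubring extDisk)
    (by rintro _ ⟨f, hf, rfl⟩; exact ⟨f, hf.1, rfl⟩)

/-- The set of the values of the coordinate `logT` on `V`. -/
def coord (V : Set UnivCover) : Set ℂ := {u | logT.symm u ∈ V}

/-- `𝓜(V)` for an open subset `V` of the universal cover: a function on `V` is written as a function
of the global holomorphic coordinate `logT`. -/
abbrev MeroT (V : Set UnivCover) : Type := Mero (coord V)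

/-- Constants as meromorphic functions. -/
def constHom (V : Set UnivCover) : ℂ →+* MeroT V :=
  ((Germ.coeRingHom (codiscreteWithin (coord V))).comp (Pi.constRingHom ℂ ℂ)).codRestrict
    (meroSubring (coord V)) fun c => ⟨fun _ => c, MeromorphicOn.const c, rfl⟩

/-- `h` is holomorphic on `U` with non-vanishing derivative and maps `U` to `V`. -/
structure IsPullbackMap (h : ℂ → ℂ) (U V : Set ℂ) : Prop where
  analytic : AnalyticOnNhd ℂ h U
  deriv_ne_zero : ∀ x ∈ U, deriv h x ≠ 0
  mapsTo : Set.MapsTo h U V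

lemma IsPullbackMap.tendsto {h : ℂ → ℂ} {U V : Set ℂ} (H : IsPullbackMap h U V) :
    Tendsto h (codiscreteWithin U) (codiscreteWithin V) := by
  refine (H.analytic.map_codiscreteWithin fun x hx hc => H.deriv_ne_zero x hx ?_).trans
    (codiscreteWithin_mono H.mapsTo.image_subset)
  obtain ⟨c, hc⟩ := eventuallyConst_iff_exists_eventuallyEq.1 hc
  rw [hc.deriv_eq, deriv_const]

/-- Composition `g ↦ g ∘ h` on germs. -/
def germComp {h : ℂ → ℂ} {l l' : Filter ℂ} (ht : Tendsto h l l') : Germ l' ℂ →+* Germ l ℂ where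
  toFun g := g.compTendsto h ht
  map_one' := rfl
  map_mul' f g := Germ.inductionOn₂ f g fun _ _ => rfl
  map_zero' := rfl
  map_add' f g := Germ.inductionOn₂ f g fun _ _ => rfl

/-- The pullback `f ↦ f ∘ h` from `𝓜(V)` to `𝓜(U)`. -/
def pullback {h : ℂ → ℂ} {U V : Set ℂ} (H : IsPullbackMap h U V) : Mero V →+* Mero U :=
  (germComp H.tendsto).restrict (meroSubring V) (meroSubring U) <| by
    rintro _ ⟨f, hf, rfl⟩
    exact ⟨f ∘ h, fun x hx => (hf _ (H.mapsTo hx)).comp_analyticAt (H.analytic x hx), rfl⟩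

/-- Restriction of meromorphic functions from the whole universal cover to `V`. -/
def resHom (V : Set UnivCover) : MeroT Set.univ →+* MeroT V :=
  pullback (h := id) ⟨fun _ _ => analyticAt_id, fun x _ => by simp, fun _ _ => trivial⟩

lemma isPullbackMap_powT (p : ℕ) [p.AtLeastTwo] {V : Set UnivCover}
    (hV : Set.MapsTo (powT p) V V) :
    IsPullbackMap (fun u => (p : ℂ) * u) (coord V) (coord V) where
  analytic _ _ := analyticAt_const.mul analyticAt_id
  deriv_ne_zero x _ := by
    have hp : p ≠ 0 := by have := Nat.AtLeastTwo.prop (n := p); omega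
    simp [hp]
  mapsTo u hu := by
    have := hV hu
    rwa [← logT.symm_apply_apply (powT p (logT.symm u)), logT_powT, logT.apply_symm_apply] at this

lemma mapsTo_powT_Sigma0 (p : ℕ) [p.AtLeastTwo] : Set.MapsTo (powT p) Sigma0 Sigma0 := by
  intro x hx
  have hp : p ≠ 0 := by have := Nat.AtLeastTwo.prop (n := p); omega
  change ‖x.1.1 ^ p‖ < 1
  rw [norm_pow]
  exact pow_lt_one₀ (norm_nonneg _) hx hp

lemma mapsTo_powT_SigmaInf (p : ℕ) [p.AtLeastTwo] : Set.MapsTo (powT p) SigmaInf SigmaInf := by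
  intro x hx
  have hp : p ≠ 0 := by have := Nat.AtLeastTwo.prop (n := p); omega
  change 1 < ‖x.1.1 ^ p‖
  rw [norm_pow]
  exact one_lt_pow₀ hx hp

/-- `φ_p` on `𝓜(Σ₀)`: `f ↦ f ∘ powT p` (in the coordinate `u = logT`, `f(u) ↦ f(pu)`). -/
def phi0 (p : ℕ) [p.AtLeastTwo] : MeroT Sigma0 →+* MeroT Sigma0 :=
  pullback (isPullbackMap_powT p (mapsTo_powT_Sigma0 p))

/-- `φ_p` on `𝓜(Σ_∞)`. -/
def phiInf (p : ℕ) [p.AtLeastTwo] : MeroT SigmaInf →+* MeroT SigmaInf :=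
  pullback (isPullbackMap_powT p (mapsTo_powT_SigmaInf p))

lemma isPullbackMap_exp0 : IsPullbackMap Complex.exp (coord Sigma0) disk :=
  ⟨fun _ _ => analyticAt_cexp, fun x _ => by simp [Complex.exp_ne_zero], fun _ hu => hu⟩

lemma isPullbackMap_expInf : IsPullbackMap Complex.exp (coord SigmaInf) extDisk :=
  ⟨fun _ _ => analyticAt_cexp, fun x _ => by simp [Complex.exp_ne_zero], fun _ hu => hu⟩

/-- `π^* : 𝓜(D(0,1)) → 𝓜(Σ₀)`, `f ↦ f ∘ π`, where `π` is `exp` in the coordinate `logT`. -/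
def projPull0 : Mero disk →+* MeroT Sigma0 := pullback isPullbackMap_exp0

/-- `π^* : 𝓜(ℙ¹(ℂ) ∖ D̄(0,1)) → 𝓜(Σ_∞)`, `f ↦ f ∘ π`. -/
def projPullInf : MeroExt →+* MeroT SigmaInf :=
  (pullback isPullbackMap_expInf).comp MeroExt.toMero

/-! ### Laurent polynomials in `logT` -/

/-- `logT` as an invertible element of `𝓜(V)`. -/
def logUnit (V : Set UnivCover) : (MeroT V)ˣ where
  val := Mero.mk (fun u => u) fun x _ => MeromorphicAt.id x
  inv := Mero.mk (fun u => u⁻¹) fun x _ => (MeromorphicAt.id x).inv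
  val_inv := by
    refine Mero.toGerm_injective _ (Germ.coe_eq.2 ?_)
    filter_upwards [compl_singleton_mem_codiscreteWithin (s := coord V) (0 : ℂ)] with u hu
    exact mul_inv_cancel₀ hu
  inv_val := by
    refine Mero.toGerm_injective _ (Germ.coe_eq.2 ?_)
    filter_upwards [compl_singleton_mem_codiscreteWithin (s := coord V) (0 : ℂ)] with u hu
    exact inv_mul_cancel₀ hu

/-- A Laurent polynomial in `logT` as a meromorphic function on `V`. -/
def laurentHom (V : Set UnivCover) : ℂ[T;T⁻¹] →+* MeroT V :=
  LaurentPolynomial.eval₂ (constHom V) (logUnit V)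

/-- `φ_p` on Laurent polynomials in `logT`: it sends `logT` to `logT ∘ powT p = p * logT`. -/
def laurentPhi (p : ℕ) [p.AtLeastTwo] : ℂ[T;T⁻¹] →+* ℂ[T;T⁻¹] :=
  LaurentPolynomial.eval₂ LaurentPolynomial.C
    { val := LaurentPolynomial.C (p : ℂ) * LaurentPolynomial.T 1
      inv := LaurentPolynomial.C (p : ℂ)⁻¹ * LaurentPolynomial.T (-1)
      val_inv := by
        have hp : (p : ℂ) ≠ 0 := by
          have := Nat.AtLeastTwo.prop (n := p)
          exact_mod_cast (by omega : p ≠ 0)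
        rw [mul_mul_mul_comm, ← map_mul, mul_inv_cancel₀ hp, ← LaurentPolynomial.T_add]
        simp
      inv_val := by
        have hp : (p : ℂ) ≠ 0 := by
          have := Nat.AtLeastTwo.prop (n := p)
          exact_mod_cast (by omega : p ≠ 0)
        rw [mul_mul_mul_comm, ← map_mul, inv_mul_cancel₀ hp, ← LaurentPolynomial.T_add]
        simp }

/-- The value of a Laurent polynomial in `logT` at a point `a ≠ (1, 0)` of the universal cover. -/
def laurentEval (a : UnivCover) (ha : a ≠ oneT) : ℂ[T;T⁻¹] →+* ℂ :=
  LaurentPolynomial.eval₂ (RingHom.id ℂ) (Units.mk0 (logT a) (mt logT_eq_zero.1 ha))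

/-! ### Singular loci -/

/-- The point with coordinate `x` is not a pole of `f`. -/
def RegularAt {U : Set ℂ} (f : Mero U) (x : ℂ) : Prop :=
  ∃ (g : ℂ → ℂ) (hg : MeromorphicOn g U), AnalyticAt ℂ g x ∧ Mero.mk g hg = f

/-- The singular locus of `M ∈ GL_n(𝓜(V))`: the poles of `M` and the poles of `M⁻¹`. -/
def singularLocus {V : Set UnivCover} {n : ℕ} (M : GL (Fin n) (MeroT V)) : Set UnivCover :=
  {x ∈ V | (∃ i j, ¬ RegularAt (M.val i j) (logT x)) ∨
    ∃ i j, ¬ RegularAt ((M⁻¹).val i j) (logT x)}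

/-- `E^{p^ℤ}`, the union of the `E^{p^k}` for `k ∈ ℤ`. -/
def powOrbit (p : ℕ) (E : Set ℂ) : Set ℂ :=
  {z | ∃ k : ℕ, (∃ e ∈ E, z = e ^ p ^ k) ∨ z ^ p ^ k ∈ E}

/-- All points of the universal cover over `E^{p^ℤ}`. -/
def tildeSet (p : ℕ) (E : Set ℂ) : Set UnivCover := {x | proj x ∈ powOrbit p E}

lemma RegularAt.add {U : Set ℂ} {f g : Mero U} {x : ℂ} (hf : RegularAt f x) (hg : RegularAt g x) :
    RegularAt (f + g) x := by
  obtain ⟨a, ha, ha', rfl⟩ := hf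
  obtain ⟨b, hb, hb', rfl⟩ := hg
  exact ⟨a + b, ha.add hb, ha'.add hb', rfl⟩

lemma RegularAt.mul {U : Set ℂ} {f g : Mero U} {x : ℂ} (hf : RegularAt f x) (hg : RegularAt g x) :
    RegularAt (f * g) x := by
  obtain ⟨a, ha, ha', rfl⟩ := hf
  obtain ⟨b, hb, hb', rfl⟩ := hg
  exact ⟨a * b, ha.mul hb, ha'.mul hb', rfl⟩

lemma RegularAt.one {U : Set ℂ} (x : ℂ) : RegularAt (1 : Mero U) x :=
  ⟨1, MeromorphicOn.const 1, analyticAt_const, rfl⟩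

lemma RegularAt.zero {U : Set ℂ} (x : ℂ) : RegularAt (0 : Mero U) x :=
  ⟨0, MeromorphicOn.const 0, analyticAt_const, rfl⟩

section Matrices

variable {R S : Type} [CommRing R] [CommRing S] {a b c d e f : ℕ}

/-- The Kronecker product of matrices, as a block matrix `(A i j • B)`. -/
def kron (A : Matrix (Fin a) (Fin b) R) (B : Matrix (Fin c) (Fin d) R) :
    Matrix (Fin (a * c)) (Fin (b * d)) R :=
  (Matrix.kroneckerMap (· * ·) A B).submatrix finProdFinEquiv.symm finProdFinEquiv.symm

lemma kron_apply (A : Matrix (Fin a) (Fin b) R) (B : Matrix (Fin c) (Fin d) R)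
    (i : Fin (a * c)) (j : Fin (b * d)) :
    kron A B i j = A (finProdFinEquiv.symm i).1 (finProdFinEquiv.symm j).1 *
      B (finProdFinEquiv.symm i).2 (finProdFinEquiv.symm j).2 := rfl

lemma kron_mul (A : Matrix (Fin a) (Fin b) R) (A' : Matrix (Fin b) (Fin c) R)
    (B : Matrix (Fin d) (Fin e) R) (B' : Matrix (Fin e) (Fin f) R) :
    kron (A * A') (B * B') = kron A B * kron A' B' := by
  unfold kron
  rw [Matrix.submatrix_mul_equiv]
  congr 1
  exact Matrix.mul_kronecker_mul A A' B B'

@[simp] lemma kron_one : kron (1 : Matrix (Fin a) (Fin a) R) (1 : Matrix (Fin b) (Fin b) R) = 1 := by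
  have : Matrix.kroneckerMap (· * ·) (1 : Matrix (Fin a) (Fin a) R) (1 : Matrix (Fin b) (Fin b) R)
    = 1 := Matrix.one_kronecker_one
  rw [kron, this, Matrix.submatrix_one_equiv]

lemma kron_map (φ : R →+* S) (A : Matrix (Fin a) (Fin b) R) (B : Matrix (Fin c) (Fin d) R) :
    (kron A B).map φ = kron (A.map φ) (B.map φ) := by
  ext i j
  simp [kron_apply]

lemma kron_comm {A : Matrix (Fin a) (Fin a) R} {B : Matrix (Fin b) (Fin b) R}
    {A' : Matrix (Fin c) (Fin c) R} {B' : Matrix (Fin d) (Fin d) R}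
    {s s' : Matrix (Fin b) (Fin a) R} {t t' : Matrix (Fin d) (Fin c) R}
    (h : s * A = B * s') (h' : t * A' = B' * t') :
    kron s t * kron A A' = kron B B' * kron s' t' := by
  rw [← kron_mul, ← kron_mul, h, h']

/-- The matrix of the permutation of coordinates given by a bijection. -/
def permMat (R : Type) [CommRing R] (σ : Fin a ≃ Fin b) : Matrix (Fin b) (Fin a) R :=
  (1 : Matrix (Fin b) (Fin b) R).submatrix id σ

lemma permMat_mul_apply (σ : Fin a ≃ Fin b) (A : Matrix (Fin a) (Fin c) R) (i : Fin b) (j : Fin c) :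
    (permMat R σ * A) i j = A (σ.symm i) j := by
  simp [permMat, Matrix.mul_apply, Matrix.one_apply, ← Equiv.symm_apply_eq]

lemma mul_permMat_apply (σ : Fin a ≃ Fin b) (A : Matrix (Fin c) (Fin b) R) (i : Fin c) (j : Fin a) :
    (A * permMat R σ) i j = A i (σ j) := by
  simp [permMat, Matrix.mul_apply, Matrix.one_apply]

@[simp] lemma permMat_map (φ : R →+* S) (σ : Fin a ≃ Fin b) :
    (permMat R σ).map φ = permMat S σ := by
  ext i j
  simp [permMat, Matrix.one_apply, apply_ite φ]

@[simp] lemma permMat_refl : permMat R (Equiv.refl (Fin a)) = 1 := by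
  simp [permMat]

lemma permMat_mul (σ : Fin a ≃ Fin b) (τ : Fin b ≃ Fin c) :
    permMat R τ * permMat R σ = permMat R (σ.trans τ) := by
  ext i j
  rw [mul_permMat_apply]
  rfl

/-- The bijection of index sets underlying the Kronecker product of permutation matrices. -/
def prodPerm (σ : Fin a ≃ Fin b) (τ : Fin c ≃ Fin d) : Fin (a * c) ≃ Fin (b * d) :=
  finProdFinEquiv.symm.trans ((Equiv.prodCongr σ τ).trans finProdFinEquiv)

lemma kron_permMat (σ : Fin a ≃ Fin b) (τ : Fin c ≃ Fin d) :
    kron (permMat R σ) (permMat R τ) = permMat R (prodPerm σ τ) := by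
  ext i j
  obtain ⟨⟨i, i'⟩, rfl⟩ := finProdFinEquiv.surjective i
  obtain ⟨⟨j, j'⟩, rfl⟩ := finProdFinEquiv.surjective j
  simp only [kron_apply, permMat, prodPerm, Matrix.submatrix_apply, Matrix.one_apply, id,
    Equiv.symm_apply_apply, Equiv.trans_apply, Equiv.apply_eq_iff_eq, Equiv.prodCongr_apply,
    Prod.map, Prod.mk.injEq]
  split_ifs <;> simp_all

/-- Reassociation of index sets. -/
def assocPerm (a b c : ℕ) : Fin (a * b * c) ≃ Fin (a * (b * c)) :=
  finProdFinEquiv.symm.trans <| (Equiv.prodCongr finProdFinEquiv.symm (Equiv.refl _)).trans <|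
    (Equiv.prodAssoc _ _ _).trans <|
      (Equiv.prodCongr (Equiv.refl _) finProdFinEquiv).trans finProdFinEquiv

def leftPerm (a : ℕ) : Fin (1 * a) ≃ Fin a :=
  finProdFinEquiv.symm.trans (Equiv.uniqueProd _ _)

def rightPerm (a : ℕ) : Fin (a * 1) ≃ Fin a :=
  finProdFinEquiv.symm.trans (Equiv.prodUnique _ _)

def swapPerm (a b : ℕ) : Fin (a * b) ≃ Fin (b * a) :=
  finProdFinEquiv.symm.trans ((Equiv.prodComm _ _).trans finProdFinEquiv)

lemma assocPerm_kron (A : Matrix (Fin a) (Fin b) R) (B : Matrix (Fin c) (Fin d) R)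
    (C : Matrix (Fin e) (Fin f) R) :
    permMat R (assocPerm a c e) * kron (kron A B) C =
      kron A (kron B C) * permMat R (assocPerm b d f) := by
  ext i j
  rw [permMat_mul_apply, mul_permMat_apply]
  simp [kron_apply, assocPerm, mul_assoc]

lemma leftPerm_kron (A : Matrix (Fin a) (Fin b) R) :
    permMat R (leftPerm a) * kron (1 : Matrix (Fin 1) (Fin 1) R) A =
      A * permMat R (leftPerm b) := by
  ext i j
  rw [permMat_mul_apply, mul_permMat_apply]
  simp only [kron_apply, leftPerm, Matrix.one_apply, Subsingleton.elim _ (0 : Fin 1), if_true, one_mul]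
  simp

lemma rightPerm_kron (A : Matrix (Fin a) (Fin b) R) :
    permMat R (rightPerm a) * kron A (1 : Matrix (Fin 1) (Fin 1) R) =
      A * permMat R (rightPerm b) := by
  ext i j
  rw [permMat_mul_apply, mul_permMat_apply]
  simp only [kron_apply, rightPerm, Matrix.one_apply, Subsingleton.elim _ (0 : Fin 1), if_true, mul_one]
  simp

lemma swapPerm_kron (A : Matrix (Fin a) (Fin b) R) (B : Matrix (Fin c) (Fin d) R) :
    permMat R (swapPerm a c) * kron A B = kron B A * permMat R (swapPerm b d) := by
  ext i j
  rw [permMat_mul_apply, mul_permMat_apply]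
  simp [kron_apply, swapPerm, mul_comm]

/-- The Kronecker product of invertible matrices. -/
def kronGL (A : GL (Fin a) R) (B : GL (Fin b) R) : GL (Fin (a * b)) R where
  val := kron A.val B.val
  inv := kron A⁻¹.val B⁻¹.val
  val_inv := by rw [← kron_mul, ← Units.val_mul, ← Units.val_mul]; simp
  inv_val := by rw [← kron_mul, ← Units.val_mul, ← Units.val_mul]; simp

lemma kronGL_mul (A A' : GL (Fin a) R) (B B' : GL (Fin b) R) :
    kronGL (A * A') (B * B') = kronGL A B * kronGL A' B' :=
  Units.ext (kron_mul _ _ _ _)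

lemma kronGL_inv (A : GL (Fin a) R) (B : GL (Fin b) R) :
    (kronGL A B)⁻¹ = kronGL A⁻¹ B⁻¹ := rfl

lemma kronGL_map (φ : R →+* S) (A : GL (Fin a) R) (B : GL (Fin b) R) :
    Matrix.GeneralLinearGroup.map φ (kronGL A B) =
      kronGL (Matrix.GeneralLinearGroup.map φ A) (Matrix.GeneralLinearGroup.map φ B) :=
  Units.ext (kron_map φ _ _)

lemma pentagonPerm (a b c d : ℕ) :
    ((prodPerm (assocPerm a b c) (Equiv.refl (Fin d))).trans (assocPerm a (b * c) d)).trans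
      (prodPerm (Equiv.refl (Fin a)) (assocPerm b c d)) =
    (assocPerm (a * b) c d).trans (assocPerm a b (c * d)) := by
  ext x
  simp [prodPerm, assocPerm]

lemma trianglePerm (a b : ℕ) :
    (assocPerm a 1 b).trans (prodPerm (Equiv.refl (Fin a)) (leftPerm b)) =
      prodPerm (rightPerm a) (Equiv.refl (Fin b)) := by
  ext x
  simp [prodPerm, assocPerm, leftPerm, rightPerm]

lemma hexagonPerm (a b c : ℕ) :
    ((assocPerm a b c).trans (swapPerm a (b * c))).trans (assocPerm b c a) =
    ((prodPerm (swapPerm a b) (Equiv.refl (Fin c))).trans (assocPerm b a c)).trans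
      (prodPerm (Equiv.refl (Fin b)) (swapPerm a c)) := by
  ext x
  simp [prodPerm, assocPerm, swapPerm]

lemma hexagonPerm' (a b c : ℕ) :
    ((assocPerm a b c).symm.trans (swapPerm (a * b) c)).trans (assocPerm c a b).symm =
    ((prodPerm (Equiv.refl (Fin a)) (swapPerm b c)).trans (assocPerm a c b).symm).trans
      (prodPerm (swapPerm a c) (Equiv.refl (Fin b))) := by
  ext x
  simp [prodPerm, assocPerm, swapPerm]

lemma swapPerm_swapPerm (a b : ℕ) : (swapPerm a b).trans (swapPerm b a) = Equiv.refl _ := by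
  refine Equiv.ext fun x => ?_
  obtain ⟨⟨i, j⟩, rfl⟩ := finProdFinEquiv.surjective x
  simp only [swapPerm, Equiv.trans_apply, Equiv.symm_apply_apply, Equiv.prodComm_apply, Prod.swap,
    Equiv.refl_apply]

end Matrices

open Matrix.GeneralLinearGroup (map)

/-! ### The category of connections -/

/-- Objects of the category `𝓒` of connections. -/
structure Conn (p : ℕ) [p.AtLeastTwo] where
  /-- the rank -/
  n : ℕ
  A0 : GL (Fin n) ℂ
  A1 : GL (Fin n) ℂ
  AInf : GL (Fin n) ℂ
  M0 : GL (Fin n) (MeroT Sigma0)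
  MInf : GL (Fin n) (MeroT SigmaInf)
  phi_M0 : map (phi0 p) M0 = map (constHom Sigma0) A1 * M0 * (map (constHom Sigma0) A0)⁻¹
  phi_MInf : map (phiInf p) MInf = map (constHom SigmaInf) A1 * MInf * (map (constHom SigmaInf) AInf)⁻¹
  exists_W : ∃ (W1 : GL (Fin n) (MeroT Set.univ)) (W0 : GL (Fin n) (Mero disk))
    (WInf : GL (Fin n) MeroExt),
    map (resHom Sigma0) W1 * M0 = map projPull0 W0 ∧
    map (resHom SigmaInf) W1 * MInf = map projPullInf WInf

namespace Conn

variable {p : ℕ} [p.AtLeastTwo]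

/-- Morphisms of the category of connections. -/
@[ext]
structure Hom (X Y : Conn p) where
  S0 : Matrix (Fin Y.n) (Fin X.n) ℂ
  S1 : Matrix (Fin Y.n) (Fin X.n) ℂ[T;T⁻¹]
  SInf : Matrix (Fin Y.n) (Fin X.n) ℂ
  comm0 : S0 * X.A0.val = Y.A0.val * S0
  comm1 : S1.map (laurentPhi p) * X.A1.val.map LaurentPolynomial.C =
    Y.A1.val.map LaurentPolynomial.C * S1
  commInf : SInf * X.AInf.val = Y.AInf.val * SInf
  conn0 : S1.map (laurentHom Sigma0) * X.M0.val = Y.M0.val * S0.map (constHom Sigma0)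
  connInf : S1.map (laurentHom SigmaInf) * X.MInf.val = Y.MInf.val * SInf.map (constHom SigmaInf)

lemma map_smul_laurent {m n : ℕ} {R : Type} [CommRing R] (φ : ℂ[T;T⁻¹] →+* R) (c : ℂ)
    (S : Matrix (Fin m) (Fin n) ℂ[T;T⁻¹]) :
    (c • S).map φ = φ (LaurentPolynomial.C c) • S.map φ := by
  ext i j
  simp [LaurentPolynomial.smul_eq_C_mul]

lemma map_smul_const {m n : ℕ} {R : Type} [CommRing R] (φ : ℂ →+* R) (c : ℂ)
    (S : Matrix (Fin m) (Fin n) ℂ) : (c • S).map φ = φ c • S.map φ := by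
  ext i j
  simp

lemma smul_laurent {m n : ℕ} (c : ℂ) (S : Matrix (Fin m) (Fin n) ℂ[T;T⁻¹]) :
    c • S = LaurentPolynomial.C c • S := by
  ext i j
  simp [LaurentPolynomial.smul_eq_C_mul]

@[simp] lemma laurentPhi_C (c : ℂ) :
    laurentPhi p (LaurentPolynomial.C c) = LaurentPolynomial.C c := by
  simp [laurentPhi]

@[simp] lemma laurentHom_C (V : Set UnivCover) (c : ℂ) :
    laurentHom V (LaurentPolynomial.C c) = constHom _ c := by
  simp [laurentHom]

/-- The morphisms from `X` to `Y` as a space of triples of matrices. -/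
def homSubmodule (X Y : Conn p) :
    Submodule ℂ (Matrix (Fin Y.n) (Fin X.n) ℂ × Matrix (Fin Y.n) (Fin X.n) ℂ[T;T⁻¹] ×
      Matrix (Fin Y.n) (Fin X.n) ℂ) where
  carrier := {S | S.1 * X.A0.val = Y.A0.val * S.1 ∧
    S.2.1.map (laurentPhi p) * X.A1.val.map LaurentPolynomial.C =
      Y.A1.val.map LaurentPolynomial.C * S.2.1 ∧
    S.2.2 * X.AInf.val = Y.AInf.val * S.2.2 ∧
    S.2.1.map (laurentHom Sigma0) * X.M0.val = Y.M0.val * S.1.map (constHom Sigma0) ∧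
    S.2.1.map (laurentHom SigmaInf) * X.MInf.val = Y.MInf.val * S.2.2.map (constHom SigmaInf)}
  add_mem' := by
    rintro f g ⟨h1, h2, h3, h4, h5⟩ ⟨k1, k2, k3, k4, k5⟩
    refine ⟨?_, ?_, ?_, ?_, ?_⟩ <;>
      simp only [Prod.fst_add, Prod.snd_add, Matrix.map_add _ (map_add _), *, Matrix.add_mul, Matrix.mul_add]
  zero_mem' := by
    refine ⟨?_, ?_, ?_, ?_, ?_⟩ <;> simp
  smul_mem' := by
    rintro c f ⟨h1, h2, h3, h4, h5⟩
    refine ⟨?_, ?_, ?_, ?_, ?_⟩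
    · simp [h1]
    · simp only [Prod.smul_snd, Prod.smul_fst, map_smul_laurent, laurentPhi_C, Matrix.smul_mul, h2]
      rw [smul_laurent, Matrix.mul_smul]
    · simp [h3]
    · simp only [Prod.smul_snd, Prod.smul_fst, map_smul_laurent, laurentHom_C, Matrix.smul_mul, h4,
        map_smul_const, Matrix.mul_smul]
    · simp only [Prod.smul_snd, Prod.smul_fst, map_smul_laurent, laurentHom_C, Matrix.smul_mul, h5,
        map_smul_const, Matrix.mul_smul]

/-- Morphisms as elements of this space. -/
def homEquiv (X Y : Conn p) : Hom X Y ≃ homSubmodule X Y where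
  toFun f := ⟨(f.S0, f.S1, f.SInf), f.comm0, f.comm1, f.commInf, f.conn0, f.connInf⟩
  invFun f := ⟨f.1.1, f.1.2.1, f.1.2.2, f.2.1, f.2.2.1, f.2.2.2.1, f.2.2.2.2.1, f.2.2.2.2.2⟩
  left_inv _ := rfl
  right_inv _ := rfl

/-- Addition of morphisms is entrywise. -/
instance (X Y : Conn p) : AddCommGroup (Hom X Y) := (homEquiv X Y).addCommGroup

instance (X Y : Conn p) : Module ℂ (Hom X Y) := (homEquiv X Y).module ℂ

/-- The identity morphism. -/
def Hom.id (X : Conn p) : Hom X X where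
  S0 := 1
  S1 := 1
  SInf := 1
  comm0 := by simp
  comm1 := by simp
  commInf := by simp
  conn0 := by simp
  connInf := by simp

/-- Composition of morphisms: first `f`, then `g`. -/
def Hom.comp {X Y Z : Conn p} (f : Hom X Y) (g : Hom Y Z) : Hom X Z where
  S0 := g.S0 * f.S0
  S1 := g.S1 * f.S1
  SInf := g.SInf * f.SInf
  comm0 := by rw [Matrix.mul_assoc, f.comm0, ← Matrix.mul_assoc, g.comm0, Matrix.mul_assoc]
  comm1 := by
    rw [Matrix.map_mul, Matrix.mul_assoc, f.comm1, ← Matrix.mul_assoc, g.comm1, Matrix.mul_assoc]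
  commInf := by rw [Matrix.mul_assoc, f.commInf, ← Matrix.mul_assoc, g.commInf, Matrix.mul_assoc]
  conn0 := by
    rw [Matrix.map_mul, Matrix.mul_assoc, f.conn0, ← Matrix.mul_assoc, g.conn0, Matrix.mul_assoc,
      Matrix.map_mul]
  connInf := by
    rw [Matrix.map_mul, Matrix.mul_assoc, f.connInf, ← Matrix.mul_assoc, g.connInf,
      Matrix.mul_assoc, Matrix.map_mul]

instance : Category (Conn p) where
  Hom := Hom
  id := Hom.id
  comp := Hom.comp
  id_comp _ := Hom.ext (Matrix.mul_one _) (Matrix.mul_one _) (Matrix.mul_one _)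
  comp_id _ := Hom.ext (Matrix.one_mul _) (Matrix.one_mul _) (Matrix.one_mul _)
  assoc _ _ _ := Hom.ext (Matrix.mul_assoc _ _ _).symm (Matrix.mul_assoc _ _ _).symm
    (Matrix.mul_assoc _ _ _).symm

@[ext] lemma hom_ext {X Y : Conn p} {f g : X ⟶ Y} (h0 : Hom.S0 f = Hom.S0 g)
    (h1 : Hom.S1 f = Hom.S1 g) (hInf : Hom.SInf f = Hom.SInf g) : f = g := Hom.ext h0 h1 hInf

instance : Preadditive (Conn p) where
  homGroup X Y := inferInstanceAs (AddCommGroup (Hom X Y))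
  add_comp _ _ _ _ _ _ :=
    Hom.ext (Matrix.mul_add _ _ _) (Matrix.mul_add _ _ _) (Matrix.mul_add _ _ _)
  comp_add _ _ _ _ _ _ :=
    Hom.ext (Matrix.add_mul _ _ _) (Matrix.add_mul _ _ _) (Matrix.add_mul _ _ _)

instance : Linear ℂ (Conn p) where
  homModule X Y := inferInstanceAs (Module ℂ (Hom X Y))
  smul_comp _ _ _ _ _ _ :=
    Hom.ext (Matrix.mul_smul _ _ _) (Matrix.mul_smul _ _ _) (Matrix.mul_smul _ _ _)
  comp_smul _ _ _ _ _ _ :=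
    Hom.ext (Matrix.smul_mul _ _ _) (Matrix.smul_mul _ _ _) (Matrix.smul_mul _ _ _)

/-! ### The tensor structure -/

/-- The unit object, of rank one. -/
def unit : Conn p where
  n := 1
  A0 := 1
  A1 := 1
  AInf := 1
  M0 := 1
  MInf := 1
  phi_M0 := by simp
  phi_MInf := by simp
  exists_W := ⟨1, 1, 1, by simp, by simp⟩

/-- The tensor product of objects: the Kronecker product of each of the five matrices. -/
def tensor (X Y : Conn p) : Conn p where
  n := X.n * Y.n
  A0 := kronGL X.A0 Y.A0
  A1 := kronGL X.A1 Y.A1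
  AInf := kronGL X.AInf Y.AInf
  M0 := kronGL X.M0 Y.M0
  MInf := kronGL X.MInf Y.MInf
  phi_M0 := by
    simp only [kronGL_map, kronGL_inv, X.phi_M0, Y.phi_M0, kronGL_mul]
  phi_MInf := by
    simp only [kronGL_map, kronGL_inv, X.phi_MInf, Y.phi_MInf, kronGL_mul]
  exists_W := by
    obtain ⟨W1, W0, WInf, h, h'⟩ := X.exists_W
    obtain ⟨V1, V0, VInf, k, k'⟩ := Y.exists_W
    refine ⟨kronGL W1 V1, kronGL W0 V0, kronGL WInf VInf, ?_, ?_⟩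
    · rw [kronGL_map, kronGL_map, ← h, ← k, kronGL_mul]
    · rw [kronGL_map, kronGL_map, ← h', ← k', kronGL_mul]

lemma kron_C_comm {a b c d : ℕ} (φ : ℂ[T;T⁻¹] →+* ℂ[T;T⁻¹])
    {A : Matrix (Fin a) (Fin a) ℂ} {B : Matrix (Fin b) (Fin b) ℂ}
    {A' : Matrix (Fin c) (Fin c) ℂ} {B' : Matrix (Fin d) (Fin d) ℂ}
    {s : Matrix (Fin b) (Fin a) ℂ[T;T⁻¹]} {t : Matrix (Fin d) (Fin c) ℂ[T;T⁻¹]}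
    (h : s.map φ * A.map LaurentPolynomial.C = B.map LaurentPolynomial.C * s)
    (h' : t.map φ * A'.map LaurentPolynomial.C = B'.map LaurentPolynomial.C * t) :
    (kron s t).map φ * (kron A A').map LaurentPolynomial.C =
      (kron B B').map LaurentPolynomial.C * kron s t := by
  rw [kron_map, kron_map, kron_map]
  exact kron_comm h h'

lemma kron_conn {a b c d : ℕ} {R : Type} [CommRing R] (φ : ℂ[T;T⁻¹] →+* R) (ψ : ℂ →+* R)
    {A : Matrix (Fin a) (Fin a) R} {B : Matrix (Fin b) (Fin b) R}
    {A' : Matrix (Fin c) (Fin c) R} {B' : Matrix (Fin d) (Fin d) R}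
    {s : Matrix (Fin b) (Fin a) ℂ[T;T⁻¹]} {t : Matrix (Fin d) (Fin c) ℂ[T;T⁻¹]}
    {s' : Matrix (Fin b) (Fin a) ℂ} {t' : Matrix (Fin d) (Fin c) ℂ}
    (h : s.map φ * A = B * s'.map ψ) (h' : t.map φ * A' = B' * t'.map ψ) :
    (kron s t).map φ * kron A A' = kron B B' * (kron s' t').map ψ := by
  rw [kron_map, kron_map]
  exact kron_comm h h'

/-- The tensor product of morphisms: the Kronecker product of each of the three matrices. -/
def tensorMor {X Y X' Y' : Conn p} (f : Hom X Y) (g : Hom X' Y') :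
    Hom (tensor X X') (tensor Y Y') where
  S0 := kron f.S0 g.S0
  S1 := kron f.S1 g.S1
  SInf := kron f.SInf g.SInf
  comm0 := kron_comm f.comm0 g.comm0
  comm1 := kron_C_comm _ f.comm1 g.comm1
  commInf := kron_comm f.commInf g.commInf
  conn0 := kron_conn _ _ f.conn0 g.conn0
  connInf := kron_conn _ _ f.connInf g.connInf

/-- The matrices of `Y` are obtained from those of `X` by a permutation of the basis. -/
structure IsPerm (X Y : Conn p) (σ : Fin X.n ≃ Fin Y.n) : Prop where
  A0 : permMat ℂ σ * X.A0.val = Y.A0.val * permMat ℂ σ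
  A1 : permMat ℂ σ * X.A1.val = Y.A1.val * permMat ℂ σ
  AInf : permMat ℂ σ * X.AInf.val = Y.AInf.val * permMat ℂ σ
  M0 : permMat (MeroT Sigma0) σ * X.M0.val = Y.M0.val * permMat (MeroT Sigma0) σ
  MInf : permMat (MeroT SigmaInf) σ * X.MInf.val = Y.MInf.val * permMat (MeroT SigmaInf) σ

lemma permMat_mul_symm {R : Type} [CommRing R] {a b : ℕ} (σ : Fin a ≃ Fin b) :
    permMat R σ.symm * permMat R σ = 1 := by
  simp [permMat_mul]

lemma permMat_mul_symm' {R : Type} [CommRing R] {a b : ℕ} (σ : Fin a ≃ Fin b) :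
    permMat R σ * permMat R σ.symm = 1 := by
  simp [permMat_mul]

lemma permMat_symm {R : Type} [CommRing R] {a b : ℕ} {σ : Fin a ≃ Fin b}
    {A : Matrix (Fin a) (Fin a) R} {B : Matrix (Fin b) (Fin b) R}
    (h : permMat R σ * A = B * permMat R σ) : permMat R σ.symm * B = A * permMat R σ.symm := by
  have h1 : permMat R σ.symm * permMat R σ = 1 := by simp [permMat_mul]
  have h2 : permMat R σ * permMat R σ.symm = 1 := by simp [permMat_mul]
  calc permMat R σ.symm * B = permMat R σ.symm * (B * permMat R σ) * permMat R σ.symm := by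
        rw [Matrix.mul_assoc, Matrix.mul_assoc, h2, Matrix.mul_one]
    _ = A * permMat R σ.symm := by rw [← h, ← Matrix.mul_assoc, h1, Matrix.one_mul]

lemma IsPerm.symm {X Y : Conn p} {σ : Fin X.n ≃ Fin Y.n} (h : IsPerm X Y σ) :
    IsPerm Y X σ.symm :=
  ⟨permMat_symm h.A0, permMat_symm h.A1, permMat_symm h.AInf, permMat_symm h.M0,
    permMat_symm h.MInf⟩

/-- The morphism given by a permutation of the basis. -/
def permHom {X Y : Conn p} {σ : Fin X.n ≃ Fin Y.n} (h : IsPerm X Y σ) : Hom X Y where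
  S0 := permMat ℂ σ
  S1 := permMat ℂ[T;T⁻¹] σ
  SInf := permMat ℂ σ
  comm0 := h.A0
  comm1 := by
    rw [permMat_map, ← permMat_map LaurentPolynomial.C σ, ← Matrix.map_mul, ← Matrix.map_mul, h.A1]
  commInf := h.AInf
  conn0 := by rw [permMat_map, permMat_map, h.M0]
  connInf := by rw [permMat_map, permMat_map, h.MInf]

/-- The isomorphism given by a permutation of the basis. -/
def permIso {X Y : Conn p} {σ : Fin X.n ≃ Fin Y.n} (h : IsPerm X Y σ) : X ≅ Y where
  hom := permHom h
  inv := permHom h.symm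
  hom_inv_id :=
    Hom.ext (permMat_mul_symm σ) (permMat_mul_symm σ) (permMat_mul_symm σ)
  inv_hom_id :=
    Hom.ext (permMat_mul_symm' σ) (permMat_mul_symm' σ) (permMat_mul_symm' σ)

lemma isPerm_assoc (X Y Z : Conn p) :
    IsPerm (tensor (tensor X Y) Z) (tensor X (tensor Y Z)) (assocPerm X.n Y.n Z.n) :=
  ⟨assocPerm_kron _ _ _, assocPerm_kron _ _ _, assocPerm_kron _ _ _, assocPerm_kron _ _ _,
    assocPerm_kron _ _ _⟩

lemma isPerm_left (X : Conn p) : IsPerm (tensor unit X) X (leftPerm X.n) :=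
  ⟨leftPerm_kron _, leftPerm_kron _, leftPerm_kron _, leftPerm_kron _, leftPerm_kron _⟩

lemma isPerm_right (X : Conn p) : IsPerm (tensor X unit) X (rightPerm X.n) :=
  ⟨rightPerm_kron _, rightPerm_kron _, rightPerm_kron _, rightPerm_kron _, rightPerm_kron _⟩

lemma isPerm_swap (X Y : Conn p) : IsPerm (tensor X Y) (tensor Y X) (swapPerm X.n Y.n) :=
  ⟨swapPerm_kron _ _, swapPerm_kron _ _, swapPerm_kron _ _, swapPerm_kron _ _, swapPerm_kron _ _⟩

instance : MonoidalCategoryStruct (Conn p) where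
  tensorObj := tensor
  tensorUnit := unit
  tensorHom f g := tensorMor f g
  whiskerLeft X _ _ f := tensorMor (Hom.id X) f
  whiskerRight f Y := tensorMor f (Hom.id Y)
  associator X Y Z := permIso (isPerm_assoc X Y Z)
  leftUnitor X := permIso (isPerm_left X)
  rightUnitor X := permIso (isPerm_right X)

lemma pentagon_mat (R : Type) [CommRing R] (a b c d : ℕ) :
    kron (1 : Matrix (Fin a) (Fin a) R) (permMat R (assocPerm b c d)) *
      permMat R (assocPerm a (b * c) d) *
        kron (permMat R (assocPerm a b c)) (1 : Matrix (Fin d) (Fin d) R) =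
    permMat R (assocPerm a b (c * d)) * permMat R (assocPerm (a * b) c d) := by
  rw [← permMat_refl, ← permMat_refl, kron_permMat, kron_permMat, permMat_mul, permMat_mul,
    permMat_mul, ← pentagonPerm, Equiv.trans_assoc]

lemma triangle_mat (R : Type) [CommRing R] (a b : ℕ) :
    kron (1 : Matrix (Fin a) (Fin a) R) (permMat R (leftPerm b)) * permMat R (assocPerm a 1 b) =
      kron (permMat R (rightPerm a)) (1 : Matrix (Fin b) (Fin b) R) := by
  rw [← permMat_refl, ← permMat_refl, kron_permMat, kron_permMat, permMat_mul, trianglePerm]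

lemma swap_mat (R : Type) [CommRing R] (a b : ℕ) :
    permMat R (swapPerm b a) * permMat R (swapPerm a b) = 1 := by
  rw [permMat_mul, swapPerm_swapPerm, permMat_refl]

lemma hexagon_mat (R : Type) [CommRing R] (a b c : ℕ) :
    permMat R (assocPerm b c a) * permMat R (swapPerm a (b * c)) * permMat R (assocPerm a b c) =
    kron (1 : Matrix (Fin b) (Fin b) R) (permMat R (swapPerm a c)) *
      permMat R (assocPerm b a c) *
        kron (permMat R (swapPerm a b)) (1 : Matrix (Fin c) (Fin c) R) := by
  rw [← permMat_refl, ← permMat_refl, kron_permMat, kron_permMat, permMat_mul, permMat_mul,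
    permMat_mul, permMat_mul, ← Equiv.trans_assoc, ← Equiv.trans_assoc, hexagonPerm]

lemma hexagon_mat' (R : Type) [CommRing R] (a b c : ℕ) :
    permMat R (assocPerm c a b).symm *
      permMat R (swapPerm (a * b) c) * permMat R (assocPerm a b c).symm =
    kron (permMat R (swapPerm a c)) (1 : Matrix (Fin b) (Fin b) R) *
      permMat R (assocPerm a c b).symm *
        kron (1 : Matrix (Fin a) (Fin a) R) (permMat R (swapPerm b c)) := by
  rw [← permMat_refl, ← permMat_refl, kron_permMat, kron_permMat, permMat_mul, permMat_mul,
    permMat_mul, permMat_mul, ← Equiv.trans_assoc, ← Equiv.trans_assoc, hexagonPerm']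

instance : MonoidalCategory (Conn p) :=
  MonoidalCategory.ofTensorHom
    (id_tensorHom_id := fun _ _ => Hom.ext kron_one kron_one kron_one)
    (id_tensorHom := fun _ _ _ _ => rfl)
    (tensorHom_id := fun _ _ => rfl)
    (tensorHom_comp_tensorHom := fun _ _ _ _ =>
      Hom.ext (kron_mul _ _ _ _).symm (kron_mul _ _ _ _).symm (kron_mul _ _ _ _).symm)
    (associator_naturality := fun _ _ _ =>
      Hom.ext (assocPerm_kron _ _ _) (assocPerm_kron _ _ _) (assocPerm_kron _ _ _))
    (leftUnitor_naturality := fun _ =>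
      Hom.ext (leftPerm_kron _) (leftPerm_kron _) (leftPerm_kron _))
    (rightUnitor_naturality := fun _ =>
      Hom.ext (rightPerm_kron _) (rightPerm_kron _) (rightPerm_kron _))
    (pentagon := fun _ _ _ _ =>
      Hom.ext (pentagon_mat _ _ _ _ _) (pentagon_mat _ _ _ _ _) (pentagon_mat _ _ _ _ _))
    (triangle := fun _ _ => Hom.ext (triangle_mat _ _ _) (triangle_mat _ _ _) (triangle_mat _ _ _))

instance : SymmetricCategory (Conn p) where
  braiding X Y := permIso (isPerm_swap X Y)
  braiding_naturality_right _ _ _ _ :=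
    Hom.ext (swapPerm_kron _ _) (swapPerm_kron _ _) (swapPerm_kron _ _)
  braiding_naturality_left _ _ :=
    Hom.ext (swapPerm_kron _ _) (swapPerm_kron _ _) (swapPerm_kron _ _)
  hexagon_forward _ _ _ :=
    Hom.ext (hexagon_mat _ _ _ _) (hexagon_mat _ _ _ _) (hexagon_mat _ _ _ _)
  hexagon_reverse _ _ _ :=
    Hom.ext (hexagon_mat' _ _ _ _) (hexagon_mat' _ _ _ _) (hexagon_mat' _ _ _ _)
  symmetry _ _ := Hom.ext (swap_mat _ _ _) (swap_mat _ _ _) (swap_mat _ _ _)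

/-! ### The subcategories with prescribed singularities -/

lemma regularAt_kron {U : Set ℂ} {x : ℂ} {a b c d : ℕ} {A : Matrix (Fin a) (Fin b) (Mero U)}
    {B : Matrix (Fin c) (Fin d) (Mero U)} (hA : ∀ i j, RegularAt (A i j) x)
    (hB : ∀ i j, RegularAt (B i j) x) (i : Fin (a * c)) (j : Fin (b * d)) :
    RegularAt (kron A B i j) x := by
  rw [kron_apply]
  exact (hA _ _).mul (hB _ _)

lemma regularAt_one {U : Set ℂ} {x : ℂ} {a : ℕ} (i j : Fin a) :
    RegularAt ((1 : Matrix (Fin a) (Fin a) (Mero U)) i j) x := by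
  rw [Matrix.one_apply]
  split_ifs
  · exact RegularAt.one x
  · exact RegularAt.zero x

lemma singularLocus_one (V : Set UnivCover) (n : ℕ) :
    singularLocus (1 : GL (Fin n) (MeroT V)) = ∅ := by
  refine Set.eq_empty_of_forall_notMem ?_
  rintro x ⟨-, ⟨i, j, h⟩ | ⟨i, j, h⟩⟩
  · exact h (regularAt_one i j)
  · rw [inv_one] at h
    exact h (regularAt_one i j)

lemma singularLocus_kronGL {V : Set UnivCover} {a b : ℕ} (A : GL (Fin a) (MeroT V))
    (B : GL (Fin b) (MeroT V)) :
    singularLocus (kronGL A B) ⊆ singularLocus A ∪ singularLocus B := by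
  rintro x ⟨hx, h⟩
  by_contra hc
  simp only [singularLocus, Set.mem_union, Set.mem_ofPred_eq, not_or, not_and, not_exists,
    not_not] at hc
  obtain ⟨hA, hB⟩ := hc
  obtain ⟨hA, hA'⟩ := hA hx
  obtain ⟨hB, hB'⟩ := hB hx
  rcases h with ⟨i, j, h⟩ | ⟨i, j, h⟩
  · exact h (regularAt_kron hA hB i j)
  · exact h (regularAt_kron hA' hB' i j)

/-- The objects of `𝓒_{E₀, E_∞}`. -/
def singProp (p : ℕ) [p.AtLeastTwo] (E0 EInf : Set ℂ) : ObjectProperty (Conn p) := fun X =>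
  singularLocus X.M0 ⊆ tildeSet p E0 ∧ singularLocus X.MInf ⊆ tildeSet p EInf

instance (E0 EInf : Set ℂ) : (singProp p E0 EInf).IsMonoidal where
  prop_unit := ⟨(singularLocus_one Sigma0 1).subset.trans (Set.empty_subset _),
    (singularLocus_one SigmaInf 1).subset.trans (Set.empty_subset _)⟩
  prop_tensor X Y hX hY :=
    ⟨(singularLocus_kronGL X.M0 Y.M0).trans (Set.union_subset hX.1 hY.1),
      (singularLocus_kronGL X.MInf Y.MInf).trans (Set.union_subset hX.2 hY.2)⟩

/-- The full subcategory `𝓒_{E₀, E_∞}` of `𝓒`. -/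
abbrev SubConn (p : ℕ) [p.AtLeastTwo] (E0 EInf : Set ℂ) : Type :=
  (singProp p E0 EInf).FullSubcategory

/-! ### The functors to vector spaces -/

/-- The identification `ℂ^a ⊗ ℂ^b = ℂ^(ab)`. -/
def tensorEquiv (a b : ℕ) :
    TensorProduct ℂ (Fin a → ℂ) (Fin b → ℂ) ≃ₗ[ℂ] (Fin (a * b) → ℂ) :=
  (((Pi.basisFun ℂ (Fin a)).tensorProduct (Pi.basisFun ℂ (Fin b))).reindex
    finProdFinEquiv).equivFun

@[simp] lemma tensorEquiv_tmul {a b : ℕ} (v : Fin a → ℂ) (w : Fin b → ℂ) (k : Fin (a * b)) :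
    tensorEquiv a b (TensorProduct.tmul ℂ v w) k =
      v (finProdFinEquiv.symm k).1 * w (finProdFinEquiv.symm k).2 := by
  simp [tensorEquiv, Module.Basis.tensorProduct_repr_tmul_apply, mul_comm]

/-- A rule that assigns to each morphism a complex matrix, compatibly with all the structure. -/
structure MatRule (p : ℕ) [p.AtLeastTwo] where
  mat : ∀ {X Y : Conn p}, (X ⟶ Y) → Matrix (Fin Y.n) (Fin X.n) ℂ
  mat_id : ∀ X : Conn p, mat (𝟙 X) = 1
  mat_comp : ∀ {X Y Z : Conn p} (f : X ⟶ Y) (g : Y ⟶ Z), mat (f ≫ g) = mat g * mat f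
  mat_tensor : ∀ {X Y X' Y' : Conn p} (f : X ⟶ Y) (g : X' ⟶ Y'),
    mat (f ⊗ₘ g) = kron (mat f) (mat g)
  mat_perm : ∀ {X Y : Conn p} {σ : Fin X.n ≃ Fin Y.n} (h : IsPerm X Y σ),
    mat (X := X) (Y := Y) (permHom h) = permMat ℂ σ

/-- The functor to finite-dimensional vector spaces that sends an object of rank `n` to `ℂ^n`. -/
def MatRule.functor (F : MatRule p) : Conn p ⥤ FGModuleCat ℂ where
  obj X := FGModuleCat.of ℂ (Fin X.n → ℂ)
  map f := FGModuleCat.ofHom (Matrix.mulVecLin (F.mat f))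
  map_id X := by
    rw [F.mat_id, Matrix.mulVecLin_one]
    rfl
  map_comp f g := by
    rw [F.mat_comp, Matrix.mulVecLin_mul]
    rfl

lemma kron_mulVec {a b c d : ℕ} (A : Matrix (Fin a) (Fin b) ℂ) (B : Matrix (Fin c) (Fin d) ℂ)
    (v : Fin b → ℂ) (w : Fin d → ℂ) :
    Matrix.mulVec (kron A B) (tensorEquiv b d (TensorProduct.tmul ℂ v w)) =
      tensorEquiv a c (TensorProduct.tmul ℂ (Matrix.mulVec A v) (Matrix.mulVec B w)) := by
  ext k
  simp only [Matrix.mulVec, dotProduct, tensorEquiv_tmul, kron_apply]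
  rw [← finProdFinEquiv.sum_comp, Fintype.sum_prod_type, Finset.sum_mul_sum]
  refine Finset.sum_congr rfl fun i _ => Finset.sum_congr rfl fun j _ => ?_
  rw [Equiv.symm_apply_apply]
  ring

lemma permMat_mulVec {a b : ℕ} (σ : Fin a ≃ Fin b) (v : Fin a → ℂ) (k : Fin b) :
    Matrix.mulVec (permMat ℂ σ) v k = v (σ.symm k) := by
  simp [permMat, Matrix.mulVec, dotProduct, Matrix.one_apply, ← Equiv.symm_apply_eq]

/-- The identification `ℂ = ℂ^1`. -/
def unitEquiv : ℂ ≃ₗ[ℂ] (Fin 1 → ℂ) := (LinearEquiv.funUnique (Fin 1) ℂ ℂ).symm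

lemma kron_one_mulVec {a b c : ℕ} (A : Matrix (Fin a) (Fin b) ℂ) (v : Fin b → ℂ) (w : Fin c → ℂ) :
    tensorEquiv a c (TensorProduct.tmul ℂ (Matrix.mulVec A v) w) =
      Matrix.mulVec (kron A 1) (tensorEquiv b c (TensorProduct.tmul ℂ v w)) := by
  rw [kron_mulVec, Matrix.one_mulVec]

lemma one_kron_mulVec {a b c : ℕ} (A : Matrix (Fin a) (Fin b) ℂ) (v : Fin c → ℂ) (w : Fin b → ℂ) :
    tensorEquiv c a (TensorProduct.tmul ℂ v (Matrix.mulVec A w)) =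
      Matrix.mulVec (kron 1 A) (tensorEquiv c b (TensorProduct.tmul ℂ v w)) := by
  rw [kron_mulVec, Matrix.one_mulVec]

lemma assocPerm_mulVec {a b c : ℕ} (u : Fin a → ℂ) (v : Fin b → ℂ) (w : Fin c → ℂ) :
    Matrix.mulVec (permMat ℂ (assocPerm a b c))
        (tensorEquiv (a * b) c (TensorProduct.tmul ℂ
          (tensorEquiv a b (TensorProduct.tmul ℂ u v)) w)) =
      tensorEquiv a (b * c) (TensorProduct.tmul ℂ u
        (tensorEquiv b c (TensorProduct.tmul ℂ v w))) := by
  ext k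
  rw [permMat_mulVec]
  simp [assocPerm, mul_assoc]

lemma leftPerm_mulVec {a : ℕ} (c : ℂ) (v : Fin a → ℂ) :
    c • v = Matrix.mulVec (permMat ℂ (leftPerm a))
      (tensorEquiv 1 a (TensorProduct.tmul ℂ (unitEquiv c) v)) := by
  ext k
  rw [permMat_mulVec]
  simp [leftPerm, unitEquiv]

lemma rightPerm_mulVec {a : ℕ} (c : ℂ) (v : Fin a → ℂ) :
    c • v = Matrix.mulVec (permMat ℂ (rightPerm a))
      (tensorEquiv a 1 (TensorProduct.tmul ℂ v (unitEquiv c))) := by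
  ext k
  rw [permMat_mulVec]
  simp [rightPerm, unitEquiv, mul_comm]

lemma swapPerm_mulVec {a b : ℕ} (v : Fin a → ℂ) (w : Fin b → ℂ) :
    Matrix.mulVec (permMat ℂ (swapPerm a b)) (tensorEquiv a b (TensorProduct.tmul ℂ v w)) =
      tensorEquiv b a (TensorProduct.tmul ℂ w v) := by
  ext k
  rw [permMat_mulVec]
  simp [swapPerm, mul_comm]

lemma MatRule.functor_map {X Y : Conn p} (F : MatRule p) (f : X ⟶ Y) (v : Fin X.n → ℂ)
    {A : Matrix (Fin Y.n) (Fin X.n) ℂ} (h : F.mat f = A) :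
    (F.functor.map f).hom.hom v = Matrix.mulVec A v := by
  rw [← h]
  rfl

/-- The tensor structure of the functor: `ℂ = ℂ^1` and `ℂ^a ⊗ ℂ^b = ℂ^(ab)`. -/
def MatRule.core (F : MatRule p) : F.functor.CoreMonoidal where
  εIso := unitEquiv.toFGModuleCatIso
  μIso X Y := (tensorEquiv X.n Y.n).toFGModuleCatIso
  μIso_hom_natural_left {X Y} f X' :=
    FGModuleCat.hom_ext <| TensorProduct.ext' fun v w =>
      (kron_one_mulVec (F.mat f) v w).trans <| (F.functor_map (f ▷ X') _ <| by
        rw [← tensorHom_id, F.mat_tensor, F.mat_id]).symm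
  μIso_hom_natural_right {X Y} X' f :=
    FGModuleCat.hom_ext <| TensorProduct.ext' fun v w =>
      (one_kron_mulVec (F.mat f) v w).trans <| (F.functor_map (X' ◁ f) _ <| by
        rw [← id_tensorHom, F.mat_tensor, F.mat_id]).symm
  associativity X Y Z :=
    FGModuleCat.hom_ext <| TensorProduct.ext_threefold fun u v w =>
      (F.functor_map (α_ X Y Z).hom _ (F.mat_perm (isPerm_assoc X Y Z))).trans
        (assocPerm_mulVec u v w)
  left_unitality X :=
    FGModuleCat.hom_ext <| TensorProduct.ext' fun c v =>
      (leftPerm_mulVec c v).trans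
        (F.functor_map (λ_ X).hom _ (F.mat_perm (isPerm_left X))).symm
  right_unitality X :=
    FGModuleCat.hom_ext <| TensorProduct.ext' fun v c =>
      (rightPerm_mulVec c v).trans
        (F.functor_map (ρ_ X).hom _ (F.mat_perm (isPerm_right X))).symm

instance (F : MatRule p) : F.functor.Braided where
  toMonoidal := F.core.toMonoidal
  braided X Y :=
    FGModuleCat.hom_ext <| TensorProduct.ext' fun v w =>
      (F.functor_map (β_ X Y).hom _ (F.mat_perm (isPerm_swap X Y))).trans (swapPerm_mulVec v w)

/-- The rule `(S₀, S̃₁, S_∞) ↦ S₀`. -/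
def rule0 : MatRule p where
  mat f := Hom.S0 f
  mat_id _ := rfl
  mat_comp _ _ := rfl
  mat_tensor _ _ := rfl
  mat_perm _ := rfl

/-- The rule `(S₀, S̃₁, S_∞) ↦ S_∞`. -/
def ruleInf : MatRule p where
  mat f := Hom.SInf f
  mat_id _ := rfl
  mat_comp _ _ := rfl
  mat_tensor _ _ := rfl
  mat_perm _ := rfl

/-- The rule `(S₀, S̃₁, S_∞) ↦ S̃₁(a)`. -/
def rule1 (a : UnivCover) (ha : a ≠ oneT) : MatRule p where
  mat f := (Hom.S1 f).map (laurentEval a ha)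
  mat_id X := by
    change (1 : Matrix (Fin X.n) (Fin X.n) ℂ[T;T⁻¹]).map (laurentEval a ha) = 1
    simp
  mat_comp f g := Matrix.map_mul
  mat_tensor _ _ := kron_map _ _ _
  mat_perm _ := permMat_map _ _

end Conn

/-- The functor `ω₀`, with its tensor structure. -/
abbrev omega0 (p : ℕ) [p.AtLeastTwo] : Conn p ⥤ FGModuleCat ℂ := Conn.rule0.functor

/-- The functor `ω_∞`, with its tensor structure. -/
abbrev omegaInf (p : ℕ) [p.AtLeastTwo] : Conn p ⥤ FGModuleCat ℂ := Conn.ruleInf.functor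

/-- The functor `ω₁^{(a)}`, with its tensor structure. -/
abbrev omega1 (p : ℕ) [p.AtLeastTwo] (a : UnivCover) (ha : a ≠ oneT) : Conn p ⥤ FGModuleCat ℂ :=
  (Conn.rule1 a ha).functor

/-! ### Tannakian categories -/

/-- A fibre functor: an exact faithful `k`-linear tensor functor (the tensor structure, compatible
with the symmetries, being the given one) to the finite-dimensional vector spaces over `k`. -/
structure IsFibreFunctor (k : Type) [Field k] {C : Type} [Category.{0} C] [Preadditive C]
    [Linear k C] [MonoidalCategory C] [SymmetricCategory C] (F : C ⥤ FGModuleCat.{0} k)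
    [F.Braided] : Prop where
  additive : F.Additive
  linear : F.Linear k
  faithful : F.Faithful
  leftExact : PreservesFiniteLimits F
  rightExact : PreservesFiniteColimits F

/-- A neutral Tannakian category over `k`: a `k`-linear abelian rigid symmetric monoidal category
with bilinear tensor product and `End(𝟙) = k` that has a fibre functor. -/
structure IsNeutralTannakian (k : Type) [Field k] (C : Type) [Category.{0} C]
    [inst : Preadditive C] [Linear k C] [MonoidalCategory C] [SymmetricCategory C] : Prop where
  abelian : ∃ a : Abelian C, a.toPreadditive = inst
  tensorAdditive : MonoidalPreadditive C
  tensorLinear : MonoidalLinear k C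
  rigid : Nonempty (RigidCategory C)
  endUnit : Function.Bijective fun c : k => c • 𝟙 (𝟙_ C)
  exists_fibreFunctor : ∃ (F : C ⥤ FGModuleCat.{0} k) (_ : F.Braided), IsFibreFunctor k F

end Mahler

end

open Mahler

/-!
The abelian structure comes down to kernels, and kernels are handled by equations. A kernel of a
matrix `S` is given by a basis `i`, coordinates `j` and a matrix `t` with `S i = 0`, `j i = 1` and
`i j + t S = 1` (`IsSplitKernel`). This is preserved by all ring homomorphisms, so it can be moved
between constants, Laurent polynomials in the logarithm and meromorphic functions.

*Kernels.* A component `S̃₁` of a morphism satisfies `S̃₁(p T) A₁ = B₁ S̃₁(T)`. On each generalized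
eigenspace of `A₁`, a power of `T` multiplies the eigenvalue by a power of `p`; this gauge
transformation moves all eigenvalues to the annulus `1 ≤ |z| < p` (`exists_gauge`). Between two
systems of that kind the coefficient `C` of `T ^ k` in an intertwiner satisfies `C (p ^ k A) = B C`,
where for `k ≠ 0` the eigenvalues of `p ^ k A` and of `B` are disjoint, so `C = 0`
(`eq_zero_of_intertwines`). Hence the intertwiner is constant, its kernel is split, and the kernel
of `S̃₁` is split over `ℂ[T, T⁻¹]` and has a constant matrix `A'` (`exists_isSplitKernel_laurent`).
The trivialization of the kernel comes from those of the source and the target: they turn the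
morphism into one matrix over the triples of meromorphic functions on the universal cover, on the
disk and on its exterior that match on `Σ₀` and on `Σ_∞`. By the identity theorem these triples form
a field (`isField_matchingTriples`), so this matrix has a split kernel, and comparing bases
trivializes the kernel of the morphism (`Conn.exists_isSplitKernelHom`).

*Tannakian structure.* Contragredient matrices give duals, hence rigidity, and turn kernels into
cokernels. The functors `ω₀`, `ω_∞` and `ω₁` compute kernels and cokernels, reflect isomorphisms and
are faithful (`Conn.MatRule.IsExact`), so the comparison of coimage and image is an isomorphism in
`𝓒` because it is one after applying `ω₀`. An endomorphism of the unit is a scalar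
(`Conn.bijective_smul_id_unit`), as the coefficients of a Laurent polynomial with `f(p T) = f(T)`
vanish outside degree `0`.

*Subcategories.* A split kernel has a left inverse over `ℂ[T, T⁻¹]`. A Laurent polynomial in the
logarithm has its only pole at `(1, 0)`, which is neither in `Σ₀` nor in `Σ_∞`, so a kernel has no
singularities that its ambient object does not have (`singularLocus_subset_of_leftInverse`). With
duals and direct sums it follows that `𝓒_{E₀, E_∞}` is closed under all the operations used above.

*Finiteness.* In the coordinate `u` of the universal cover, put `w = W₀ ∘ exp`. By the functional
equation, a singular point `u` of `M₀` gives the singular points `u / p ^ n`, which tend to `0`,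
where the poles of `W₁` are finite in number, so some `u / p ^ n` is singular for `w`. As
`φ(w) A₀ w⁻¹ = φ(W₁) A₁ W₁⁻¹`, a singular point `v` of `w` is followed by the singular point `p v`
unless `v` is one of the singular points of the right hand side. By periodicity `v` can be taken in
a compact rectangle or far to the left, and either way finitely many values of `exp v` remain: these
are `E₀` (`exists_finite_powOrbit`, `regularGL_of_trivialization`).
-/

noncomputable section

namespace Mahler

open Matrix

/-! ### Split kernels of matrices -/

section SplitKernel

variable {R R' : Type} [CommRing R] [CommRing R'] {k k' l m m' n n' : ℕ}

lemma val_glMap (φ : R →+* R') (A : GL (Fin n) R) :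
    (GeneralLinearGroup.map φ A).val = A.val.map φ := rfl

/-- The columns of `i` form a basis of the kernel of `S`, with coordinate functions `j`, and the
kernel is split off by `t`. Being given by equations, this is preserved by all ring
homomorphisms. -/
structure IsSplitKernel (S : Matrix (Fin m) (Fin n) R) (i : Matrix (Fin n) (Fin k) R)
    (j : Matrix (Fin k) (Fin n) R) (t : Matrix (Fin n) (Fin m) R) : Prop where
  mul_eq_zero : S * i = 0
  left_inv : j * i = 1
  decomp : i * j + t * S = 1

namespace IsSplitKernel

variable {S : Matrix (Fin m) (Fin n) R} {i : Matrix (Fin n) (Fin k) R}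
  {j : Matrix (Fin k) (Fin n) R} {t : Matrix (Fin n) (Fin m) R}
  {S' : Matrix (Fin m) (Fin n) R} {i' : Matrix (Fin n) (Fin k') R}
  {j' : Matrix (Fin k') (Fin n) R} {t' : Matrix (Fin n) (Fin m) R}

lemma map (h : IsSplitKernel S i j t) (φ : R →+* R') :
    IsSplitKernel (S.map φ) (i.map φ) (j.map φ) (t.map φ) where
  mul_eq_zero := by rw [← Matrix.map_mul, h.mul_eq_zero]; simp
  left_inv := by rw [← Matrix.map_mul, h.left_inv]; simp
  decomp := by
    rw [← Matrix.map_mul, ← Matrix.map_mul, ← Matrix.map_add _ (map_add φ), h.decomp]; simp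

/-- The kernel after a change of bases in the source and in the target. -/
lemma conj (h : IsSplitKernel S i j t) (P : GL (Fin n) R) (Q : GL (Fin m) R) :
    IsSplitKernel (Q⁻¹.val * S * P.val) (P⁻¹.val * i) (j * P.val) (P⁻¹.val * t * Q.val) where
  mul_eq_zero := by
    have : P.val * P⁻¹.val = 1 := P.mul_inv
    rw [Matrix.mul_assoc, ← Matrix.mul_assoc P.val, this, Matrix.one_mul, Matrix.mul_assoc,
      h.mul_eq_zero, Matrix.mul_zero]
  left_inv := by
    have : P.val * P⁻¹.val = 1 := P.mul_inv
    rw [Matrix.mul_assoc, ← Matrix.mul_assoc P.val, this, Matrix.one_mul, h.left_inv]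
  decomp := by
    have hQ : Q.val * Q⁻¹.val = 1 := Q.mul_inv
    have hP : P⁻¹.val * P.val = 1 := P.inv_mul
    calc _ = P⁻¹.val * (i * j + t * (Q.val * Q⁻¹.val) * S) * P.val := by
            simp only [Matrix.mul_add, Matrix.add_mul, Matrix.mul_assoc]
      _ = 1 := by rw [hQ, Matrix.mul_one, h.decomp, Matrix.mul_one, hP]

lemma proj_mul (h : IsSplitKernel S i j t) {v : Matrix (Fin n) (Fin l) R} (hv : S * v = 0) :
    i * (j * v) = v := by
  have := congrArg (· * v) h.decomp
  simp only [Matrix.add_mul, Matrix.mul_assoc, hv, Matrix.mul_zero, add_zero, Matrix.one_mul]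
    at this
  exact this

lemma left_cancel (h : IsSplitKernel S i j t) {v w : Matrix (Fin k) (Fin l) R}
    (hvw : i * v = i * w) : v = w := by
  rw [← Matrix.one_mul v, ← Matrix.one_mul w, ← h.left_inv, Matrix.mul_assoc, hvw,
    Matrix.mul_assoc]

/-- If `M` and `N` intertwine `S'` and `S`, then `M` maps the kernel of `S'` to that of `S`, and
`j * M * i'` is the matrix of this map in the bases `i'` and `i`. -/
lemma mul_mul_proj (h : IsSplitKernel S i j t) (h' : IsSplitKernel S' i' j' t')
    {M : Matrix (Fin n) (Fin n) R} {N : Matrix (Fin m) (Fin m) R} (hM : S * M = N * S') :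
    i * (j * M * i') = M * i' := by
  rw [Matrix.mul_assoc]
  refine h.proj_mul ?_
  rw [← Matrix.mul_assoc, hM, Matrix.mul_assoc, h'.mul_eq_zero, Matrix.mul_zero]

lemma inv_intertwines {M : GL (Fin n) R} {N : GL (Fin m) R} (hM : S * M.val = N.val * S') :
    S' * M⁻¹.val = N⁻¹.val * S := by
  have hN : N⁻¹.val * N.val = 1 := N.inv_mul
  have hM' : M.val * M⁻¹.val = 1 := M.mul_inv
  calc S' * M⁻¹.val = N⁻¹.val * N.val * S' * M⁻¹.val := by rw [hN, Matrix.one_mul]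
    _ = N⁻¹.val * (S * M.val) * M⁻¹.val := by rw [hM]; simp only [Matrix.mul_assoc]
    _ = N⁻¹.val * S := by
      rw [Matrix.mul_assoc, Matrix.mul_assoc, hM', Matrix.mul_one]

lemma restrict_mul (h : IsSplitKernel S i j t) (h' : IsSplitKernel S' i' j' t')
    {M : GL (Fin n) R} {N : GL (Fin m) R} (hM : S * M.val = N.val * S') :
    (j * M.val * i') * (j' * M⁻¹.val * i) = 1 := by
  have h1 : M.val * M⁻¹.val = 1 := M.mul_inv
  rw [Matrix.mul_assoc (j * M.val), h'.mul_mul_proj h (inv_intertwines hM), Matrix.mul_assoc,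
    ← Matrix.mul_assoc M.val, h1, Matrix.one_mul, h.left_inv]

lemma restrict_mul' (h : IsSplitKernel S i j t) (h' : IsSplitKernel S' i' j' t')
    {M : GL (Fin n) R} {N : GL (Fin m) R} (hM : S * M.val = N.val * S') :
    (j' * M⁻¹.val * i) * (j * M.val * i') = 1 := by
  have := h'.restrict_mul h (M := M⁻¹) (N := N⁻¹) (inv_intertwines hM)
  rwa [inv_inv] at this

/-- Intertwined matrices have kernels of the same rank. -/
lemma rank_eq [Nontrivial R] (h : IsSplitKernel S i j t) (h' : IsSplitKernel S' i' j' t')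
    {M : GL (Fin n) R} {N : GL (Fin m) R} (hM : S * M.val = N.val * S') : k = k' := by
  have := Matrix.square_of_invertible (j * M.val * i') (j' * M⁻¹.val * i)
    (h.restrict_mul h' hM) (h.restrict_mul' h' hM)
  simpa using this

/-- The isomorphism of kernels induced by `M`, if `S * M = N * S'`. -/
def restrictGL {i' : Matrix (Fin n) (Fin k) R} {j' : Matrix (Fin k) (Fin n) R}
    (h : IsSplitKernel S i j t) (h' : IsSplitKernel S' i' j' t')
    {M : GL (Fin n) R} {N : GL (Fin m) R} (hM : S * M.val = N.val * S') : GL (Fin k) R where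
  val := j * M.val * i'
  inv := j' * M⁻¹.val * i
  val_inv := h.restrict_mul h' hM
  inv_val := h.restrict_mul' h' hM

lemma restrictGL_val {i' : Matrix (Fin n) (Fin k) R} {j' : Matrix (Fin k) (Fin n) R}
    (h : IsSplitKernel S i j t) (h' : IsSplitKernel S' i' j' t')
    {M : GL (Fin n) R} {N : GL (Fin m) R} (hM : S * M.val = N.val * S') :
    (h.restrictGL h' hM).val = j * M.val * i' := rfl

end IsSplitKernel

/-- Over a field every matrix has a split kernel. -/
lemma exists_isSplitKernel {F : Type} [Field F] (S : Matrix (Fin m) (Fin n) F) :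
    ∃ (k : ℕ) (i : Matrix (Fin n) (Fin k) F) (j : Matrix (Fin k) (Fin n) F)
      (t : Matrix (Fin n) (Fin m) F), IsSplitKernel S i j t := by
  set f : (Fin n → F) →ₗ[F] (Fin m → F) := Matrix.toLin' S with hf
  let b := Module.finBasis F (LinearMap.ker f)
  let ι : (Fin (Module.finrank F (LinearMap.ker f)) → F) →ₗ[F] (Fin n → F) :=
    (LinearMap.ker f).subtype ∘ₗ b.equivFun.symm.toLinearMap
  have hι : LinearMap.ker ι = ⊥ := LinearMap.ker_eq_bot.2
    ((Submodule.injective_subtype _).comp b.equivFun.symm.injective)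
  obtain ⟨π, hπ⟩ := ι.exists_leftInverse_of_injective hι
  have hker : LinearMap.ker f ≤ LinearMap.ker (LinearMap.id - ι ∘ₗ π) := by
    intro x hx
    have hx' : ι (b.equivFun ⟨x, hx⟩) = x := by simp [ι]
    have : π x = b.equivFun ⟨x, hx⟩ := by
      conv_lhs => rw [← hx']
      exact LinearMap.congr_fun hπ _
    rw [LinearMap.mem_ker, LinearMap.sub_apply, LinearMap.comp_apply, this, hx',
      LinearMap.id_apply, sub_self]
  obtain ⟨τ, hτ⟩ := LinearMap.exists_extend
    ((LinearMap.ker f).liftQ _ hker ∘ₗ f.quotKerEquivRange.symm.toLinearMap)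
  have hτ' : τ ∘ₗ f = LinearMap.id - ι ∘ₗ π := by
    ext1 i
    ext1
    simp only [LinearMap.comp_apply]
    set x := LinearMap.single F (fun _ : Fin n => F) i 1
    have h := LinearMap.congr_fun hτ ⟨f x, LinearMap.mem_range_self f x⟩
    simp only [LinearMap.comp_apply, Submodule.subtype_apply, LinearEquiv.coe_coe] at h
    rw [h]
    have : f.quotKerEquivRange.symm ⟨f x, LinearMap.mem_range_self f x⟩ =
        (LinearMap.ker f).mkQ x := by
      rw [LinearEquiv.symm_apply_eq]; rfl
    rw [this, Submodule.mkQ_apply, Submodule.liftQ_apply]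
  refine ⟨_, LinearMap.toMatrix' ι, LinearMap.toMatrix' π, LinearMap.toMatrix' τ, ?_, ?_, ?_⟩
  · rw [← LinearMap.toMatrix'_toLin' S, ← LinearMap.toMatrix'_comp]
    have : f ∘ₗ ι = 0 := LinearMap.ext fun v => (b.equivFun.symm v).2
    rw [← hf, this, map_zero]
  · rw [← LinearMap.toMatrix'_comp, hπ, LinearMap.toMatrix'_id]
  · rw [← LinearMap.toMatrix'_toLin' S, ← LinearMap.toMatrix'_comp, ← LinearMap.toMatrix'_comp,
      ← hf, hτ', ← map_add, add_sub_cancel, LinearMap.toMatrix'_id]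

end SplitKernel

/-! ### Kernels over the Laurent polynomials -/

section LaurentKernel

variable {p : ℕ} [p.AtLeastTwo] {m n : ℕ}

lemma natCast_ne_zero_of_atLeastTwo (p : ℕ) [p.AtLeastTwo] : (p : ℂ) ≠ 0 := by
  have := Nat.AtLeastTwo.prop (n := p)
  exact_mod_cast (by omega : p ≠ 0)

lemma laurentPhi_C_mul_T (a : ℂ) (k : ℤ) :
    laurentPhi p (LaurentPolynomial.C a * LaurentPolynomial.T k) =
      LaurentPolynomial.C (a * (p : ℂ) ^ k) * LaurentPolynomial.T k := by
  rw [map_mul LaurentPolynomial.C, mul_assoc, laurentPhi]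
  obtain ⟨k, rfl | rfl⟩ := k.eq_nat_or_neg
  · rw [LaurentPolynomial.eval₂_C_mul_T_n, mul_pow, LaurentPolynomial.T_pow, ← map_pow]
    simp
  · rw [LaurentPolynomial.eval₂_C_mul_T_neg_n]
    simp only [Units.inv_mk, mul_pow, LaurentPolynomial.T_pow, ← map_pow]
    simp

lemma coeff_laurentPhi (f : ℂ[T;T⁻¹]) (k : ℤ) :
    (laurentPhi p f).coeff k = (p : ℂ) ^ k * f.coeff k := by
  induction f using LaurentPolynomial.induction_on' with
  | add f g hf hg => simp [hf, hg, mul_add]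
  | C_mul_T l a =>
    rw [laurentPhi_C_mul_T, ← LaurentPolynomial.single_eq_C_mul_T,
      ← LaurentPolynomial.single_eq_C_mul_T, AddMonoidAlgebra.coeff_single,
      AddMonoidAlgebra.coeff_single, Finsupp.single_apply, Finsupp.single_apply]
    split_ifs with h
    · rw [h, mul_comm]
    · rw [mul_zero]

/-- A basis adapted to the decomposition into generalized eigenspaces. -/
lemma exists_genEigenbasis (f : Module.End ℂ (Fin n → ℂ)) :
    ∃ (b : Module.Basis (Fin n) ℂ (Fin n → ℂ)) (μ : Fin n → ℂ),
      (∀ i, b i ∈ f.maxGenEigenspace (μ i)) ∧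
      ∀ (ν : ℂ) (x : Fin n → ℂ), x ∈ f.maxGenEigenspace ν → ∀ i, μ i ≠ ν → b.repr x i = 0 := by
  have hint : DirectSum.IsInternal fun ν => f.maxGenEigenspace ν :=
    DirectSum.isInternal_submodule_of_iSupIndep_of_iSup_eq_top
      f.independent_maxGenEigenspace f.iSup_maxGenEigenspace_eq_top
  let b := hint.collectedBasis fun ν => Module.finBasis ℂ (f.maxGenEigenspace ν)
  have : Fintype (Σ ν : ℂ, Fin (Module.finrank ℂ (f.maxGenEigenspace ν))) :=
    FiniteDimensional.fintypeBasisIndex b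
  have hcard : Fintype.card (Σ ν : ℂ, Fin (Module.finrank ℂ (f.maxGenEigenspace ν))) = n := by
    rw [← Module.finrank_eq_card_basis b, Module.finrank_fin_fun]
  let e := Fintype.equivFinOfCardEq hcard
  refine ⟨b.reindex e, fun i => (e.symm i).1, fun i => ?_, fun ν x hx i hi => ?_⟩
  · rw [Module.Basis.reindex_apply]
    exact hint.collectedBasis_mem _ _
  · rw [Module.Basis.repr_reindex_apply]
    exact hint.collectedBasis_repr_of_mem_ne _ hi.symm hx

/-- Intertwined matrices without common eigenvalue are intertwined by zero only. -/
lemma eq_zero_of_intertwines {A : Matrix (Fin n) (Fin n) ℂ} {B : Matrix (Fin m) (Fin m) ℂ}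
    {S : Matrix (Fin m) (Fin n) ℂ} (h : S * A = B * S)
    (hd : Disjoint (spectrum ℂ A) (spectrum ℂ B)) : S = 0 := by
  have key : ∀ q : Polynomial ℂ, S * Polynomial.aeval A q = Polynomial.aeval B q * S := by
    intro q
    induction q using Polynomial.induction_on' with
    | add q r hq hr => simp [Matrix.mul_add, Matrix.add_mul, hq, hr]
    | monomial k a =>
      have hk : S * A ^ k = B ^ k * S := by
        induction k with
        | zero => simp
        | succ k ih => rw [pow_succ, ← Matrix.mul_assoc, ih, Matrix.mul_assoc, h, pow_succ,
            Matrix.mul_assoc]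
      rw [Polynomial.aeval_monomial, Polynomial.aeval_monomial, ← Algebra.smul_def,
        ← Algebra.smul_def, Matrix.mul_smul, hk, Matrix.smul_mul]
  have h0 := key B.charpoly
  rw [Matrix.aeval_self_charpoly, Matrix.zero_mul] at h0
  have hu : IsUnit (Polynomial.aeval A B.charpoly) := by
    by_contra hc
    rw [(IsAlgClosed.splits B.charpoly).eq_prod_roots_of_monic B.charpoly_monic] at hc
    obtain ⟨ν, hν, hν'⟩ := spectrum.exists_mem_of_not_isUnit_aeval_prod hc
    exact Set.disjoint_left.1 hd hν (Matrix.mem_spectrum_iff_isRoot_charpoly.2 hν')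
  obtain ⟨u, hu⟩ := hu
  rw [← hu] at h0
  calc S = S * u.val * u⁻¹.val := by rw [Matrix.mul_assoc, ← Units.val_mul]; simp
    _ = 0 := by rw [h0, Matrix.zero_mul]

/-- The invertible diagonal matrix with given entries. -/
def diagGL {R : Type} [CommRing R] (d : Fin n → Rˣ) : GL (Fin n) R where
  val := Matrix.diagonal fun i => (d i).val
  inv := Matrix.diagonal fun i => (d i)⁻¹.val
  val_inv := by simp
  inv_val := by simp

/-- The powers of `logT` as units. -/
def laurentT (k : ℤ) : (ℂ[T;T⁻¹])ˣ where
  val := LaurentPolynomial.T k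
  inv := LaurentPolynomial.T (-k)
  val_inv := by rw [← LaurentPolynomial.T_add]; simp
  inv_val := by rw [← LaurentPolynomial.T_add]; simp

/-- A gauge transformation by powers of `logT` multiplies the eigenvalues of `A` by powers of `p`,
so that they can be moved to the annulus `1 ≤ |z| < p`. -/
lemma exists_gauge (A : GL (Fin n) ℂ) :
    ∃ (P : GL (Fin n) ℂ[T;T⁻¹]) (A' : GL (Fin n) ℂ),
      GeneralLinearGroup.map (laurentPhi p) P * GeneralLinearGroup.map LaurentPolynomial.C A =
        GeneralLinearGroup.map LaurentPolynomial.C A' * P ∧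
      ∀ ν ∈ spectrum ℂ A'.val, 1 ≤ ‖ν‖ ∧ ‖ν‖ < p := by
  have hp := natCast_ne_zero_of_atLeastTwo p
  have hp1 : (1 : ℝ) < p := by exact_mod_cast Nat.AtLeastTwo.prop (n := p)
  -- `κ z` is the exponent of the power of `p` that moves `z` to the annulus
  have hκ : ∀ z : ℂ, ∃ k : ℤ, z ≠ 0 → 1 ≤ ‖(p : ℂ) ^ k * z‖ ∧ ‖(p : ℂ) ^ k * z‖ < p := by
    intro z
    by_cases hz : z = 0
    · exact ⟨0, fun h => (h hz).elim⟩
    obtain ⟨k, hk, hk'⟩ := exists_mem_Ico_zpow (norm_pos_iff.2 hz) hp1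
    have hp0 : (0 : ℝ) < p := by linarith
    have hpk := zpow_pos hp0 k
    refine ⟨-k, fun _ => ?_⟩
    rw [norm_mul, norm_zpow, Complex.norm_natCast, _root_.zpow_neg, inv_mul_eq_div, le_div_iff₀ hpk,
      div_lt_iff₀ hpk, one_mul, mul_comm, ← zpow_add_one₀ hp0.ne']
    exact ⟨hk, hk'⟩
  choose κ hκ using hκ
  -- conjugate `A` by `R` to the matrix `At`, which is block diagonal with one block for each
  -- generalized eigenspace
  set f : Module.End ℂ (Fin n → ℂ) := Matrix.toLin' A.val with hf
  obtain ⟨b, μ, hb, hb'⟩ := exists_genEigenbasis f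
  have hA : ∀ i j, μ i ≠ μ j → LinearMap.toMatrix b b f i j = 0 := by
    intro i j hij
    rw [LinearMap.toMatrix_apply]
    exact hb' (μ j) _ (f.mapsTo_maxGenEigenspace_of_comm (Commute.refl f) _ (hb j)) i hij
  let R : GL (Fin n) ℂ := ⟨(Pi.basisFun ℂ (Fin n)).toMatrix b, b.toMatrix (Pi.basisFun ℂ (Fin n)),
    Module.Basis.toMatrix_mul_toMatrix_flip _ _, Module.Basis.toMatrix_mul_toMatrix_flip _ _⟩
  have hR : (R⁻¹ * A * R).val = LinearMap.toMatrix b b f := by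
    rw [← basis_toMatrix_mul_linearMap_toMatrix_mul_basis_toMatrix b (Pi.basisFun ℂ (Fin n)) b
      (Pi.basisFun ℂ (Fin n)), hf, LinearMap.toMatrix_eq_toMatrix', LinearMap.toMatrix'_toLin']
    rfl
  obtain ⟨At, hAt⟩ : ∃ At, At = R⁻¹ * A * R := ⟨_, rfl⟩
  rw [← hAt] at hR
  let D : GL (Fin n) ℂ[T;T⁻¹] := diagGL fun i => laurentT (κ (μ i))
  let Dp : GL (Fin n) ℂ := diagGL fun i => (Units.mk0 (p : ℂ) hp) ^ (κ (μ i))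
  have hD : GeneralLinearGroup.map (laurentPhi p) D =
      GeneralLinearGroup.map LaurentPolynomial.C Dp * D := by
    refine Units.ext (Matrix.ext fun i j => ?_)
    simp only [D, Dp, diagGL, Units.val_mul, val_glMap, laurentT]
    rw [Matrix.diagonal_map (map_zero _), Matrix.diagonal_map (map_zero _),
      Matrix.diagonal_mul_diagonal]
    simp only [Matrix.diagonal_apply]
    split_ifs
    · simpa using laurentPhi_C_mul_T (p := p) 1 (κ (μ i))
    · simp
  -- `D` is scalar on each diagonal block of `At`
  have hcomm : D * GeneralLinearGroup.map LaurentPolynomial.C At =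
      GeneralLinearGroup.map LaurentPolynomial.C At * D := by
    refine Units.ext (Matrix.ext fun i j => ?_)
    simp only [D, diagGL, Units.val_mul, val_glMap, hR, laurentT,
      Matrix.diagonal_mul, Matrix.mul_diagonal, Matrix.map_apply]
    by_cases hij : μ i = μ j
    · rw [hij, mul_comm]
    · rw [hA i j hij, map_zero, mul_zero, zero_mul]
  refine ⟨D * GeneralLinearGroup.map LaurentPolynomial.C R⁻¹, Dp * At, ?_, ?_⟩
  · have : R⁻¹ * A = At * R⁻¹ := by rw [hAt, mul_assoc, mul_inv_cancel, mul_one]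
    have hconst : GeneralLinearGroup.map (laurentPhi p)
        (GeneralLinearGroup.map LaurentPolynomial.C R⁻¹) =
        GeneralLinearGroup.map LaurentPolynomial.C R⁻¹ :=
      Units.ext (Matrix.ext fun i j => Conn.laurentPhi_C _)
    have hswap : GeneralLinearGroup.map LaurentPolynomial.C R⁻¹ *
        GeneralLinearGroup.map LaurentPolynomial.C A =
        GeneralLinearGroup.map LaurentPolynomial.C At *
          GeneralLinearGroup.map LaurentPolynomial.C R⁻¹ := by
      rw [← map_mul, this, map_mul]
    rw [map_mul, hconst, hD, map_mul _ Dp At, mul_assoc _ (GeneralLinearGroup.map _ R⁻¹), hswap,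
      ← mul_assoc, mul_assoc _ D, hcomm]
    simp only [mul_assoc]
  intro ν hν
  rw [← Matrix.spectrum_toLin', ← Module.End.hasEigenvalue_iff_mem_spectrum] at hν
  obtain ⟨v, hv⟩ := hν.exists_hasEigenvector
  obtain ⟨i₀, hi₀⟩ := Function.ne_iff.1 hv.2
  have hv' : ∀ i, (p : ℂ) ^ κ (μ i) * (At.val *ᵥ v) i = ν * v i := by
    intro i
    have := congrFun hv.apply_eq_smul i
    rw [Matrix.toLin'_apply, Units.val_mul, ← Matrix.mulVec_mulVec] at this
    simpa [Dp, diagGL, Matrix.mulVec_diagonal] using this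
  -- an eigenvector `v` of `Dp * At` restricts to an eigenvector `w` of a single block of `At`, so
  -- that `ν` is the eigenvalue of that block times its power of `p`
  let w : Fin n → ℂ := fun i => if μ i = μ i₀ then v i else 0
  have hw : At.val *ᵥ w = ((p : ℂ) ^ (-κ (μ i₀)) * ν) • w := by
    funext i
    rw [Pi.smul_apply, smul_eq_mul]
    by_cases hi : μ i = μ i₀
    · have h1 : (At.val *ᵥ w) i = (At.val *ᵥ v) i := by
        simp only [Matrix.mulVec, dotProduct]
        refine Finset.sum_congr rfl fun j _ => ?_
        by_cases hj : μ j = μ i₀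
        · simp only [w, if_pos hj]
        · rw [hR, hA i j fun h => hj (h.symm.trans hi), zero_mul, zero_mul]
      have hw' : w i = v i := if_pos hi
      rw [h1, hw', mul_assoc, ← hv' i, hi, ← mul_assoc, ← zpow_add₀ hp]
      simp
    · have hw' : w i = 0 := if_neg hi
      rw [hw', mul_zero]
      simp only [Matrix.mulVec, dotProduct]
      refine Finset.sum_eq_zero fun j _ => ?_
      by_cases hj : μ j = μ i₀
      · rw [hR, hA i j fun h => hi (h.trans hj), zero_mul]
      · simp only [w, if_neg hj, mul_zero]
  set x := b.equivFun.symm w with hx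
  have hrepr : ⇑(b.repr x) = w := by
    rw [hx, ← b.equivFun_apply, LinearEquiv.apply_symm_apply]
  have hx0 : x ≠ 0 := by
    rw [hx, Ne, LinearEquiv.map_eq_zero_iff]
    exact fun h => hi₀ (by simpa [w] using congrFun h i₀)
  have hfx : f x = ((p : ℂ) ^ (-κ (μ i₀)) * ν) • x := by
    apply b.equivFun.injective
    rw [b.equivFun_apply, ← LinearMap.toMatrix_mulVec_repr b b f x, hrepr, ← hR, hw, map_smul,
      hx, LinearEquiv.apply_symm_apply]
  have hxμ : x ∈ f.maxGenEigenspace (μ i₀) := by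
    rw [hx, b.equivFun_symm_apply]
    refine Submodule.sum_mem _ fun i _ => ?_
    by_cases hi : μ i = μ i₀
    · exact Submodule.smul_mem _ _ (hi ▸ hb i)
    · simp only [w, if_neg hi, zero_smul, Submodule.zero_mem]
  have hν : (p : ℂ) ^ (-κ (μ i₀)) * ν = μ i₀ := by
    by_contra hne
    refine hx0 (Submodule.disjoint_def.1 (f.disjoint_genEigenspace hne ⊤ ⊤) x ?_ hxμ)
    exact Module.End.eigenspace_le_maxGenEigenspace (Module.End.mem_eigenspace_iff.2 hfx)
  have hμ : μ i₀ ≠ 0 := by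
    intro h0
    rw [hν, h0, zero_smul, hf, Matrix.toLin'_apply] at hfx
    refine hx0 ?_
    calc x = (A⁻¹.val * A.val) *ᵥ x := by rw [← Units.val_mul]; simp
      _ = 0 := by rw [← Matrix.mulVec_mulVec, hfx, Matrix.mulVec_zero]
  have hν' : ν = (p : ℂ) ^ κ (μ i₀) * μ i₀ := by
    conv_rhs => rw [← hν, ← mul_assoc, ← zpow_add₀ hp, hν]
    simp
  rw [hν']
  exact hκ _ hμ

/-- The kernel of an intertwiner over the Laurent polynomials is split, and it carries a functional
equation with constant coefficients: between systems whose eigenvalues lie in the annulus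
`1 ≤ |z| < p`, to which the gauge transformations reduce the problem, all intertwiners are constant.
-/
lemma exists_isSplitKernel_laurent (A : GL (Fin n) ℂ) (B : GL (Fin m) ℂ)
    (S : Matrix (Fin m) (Fin n) ℂ[T;T⁻¹])
    (h : S.map (laurentPhi p) * A.val.map LaurentPolynomial.C =
      B.val.map LaurentPolynomial.C * S) :
    ∃ (k : ℕ) (i : Matrix (Fin n) (Fin k) ℂ[T;T⁻¹]) (j : Matrix (Fin k) (Fin n) ℂ[T;T⁻¹])
      (t : Matrix (Fin n) (Fin m) ℂ[T;T⁻¹]) (A' : GL (Fin k) ℂ), IsSplitKernel S i j t ∧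
      A.val.map LaurentPolynomial.C * i =
        i.map (laurentPhi p) * A'.val.map LaurentPolynomial.C := by
  obtain ⟨P, A', hP, hA'⟩ := exists_gauge (p := p) A
  obtain ⟨Q, B', hQ, hB'⟩ := exists_gauge (p := p) B
  have hp1 : (1 : ℝ) < p := by exact_mod_cast Nat.AtLeastTwo.prop (n := p)
  have hPinv : P⁻¹.val.map (laurentPhi p) * A'.val.map LaurentPolynomial.C =
      A.val.map LaurentPolynomial.C * P⁻¹.val := by
    have h1 : GeneralLinearGroup.map (laurentPhi p) P⁻¹ *
        GeneralLinearGroup.map LaurentPolynomial.C A' =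
        GeneralLinearGroup.map LaurentPolynomial.C A * P⁻¹ := by
      rw [map_inv, eq_mul_inv_iff_mul_eq, mul_assoc, ← hP, inv_mul_cancel_left]
    exact congrArg Units.val h1
  set S' : Matrix (Fin m) (Fin n) ℂ[T;T⁻¹] := Q.val * S * P⁻¹.val with hS'
  have hS : S = Q⁻¹.val * S' * P.val := by
    have h1 : Q⁻¹.val * Q.val = 1 := Q.inv_mul
    have h2 : P⁻¹.val * P.val = 1 := P.inv_mul
    rw [hS', Matrix.mul_assoc, Matrix.mul_assoc, h2, Matrix.mul_one, ← Matrix.mul_assoc, h1,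
      Matrix.one_mul]
  have h' : S'.map (laurentPhi p) * A'.val.map LaurentPolynomial.C =
      B'.val.map LaurentPolynomial.C * S' := by
    have hQ' := congrArg Units.val hQ
    simp only [Units.val_mul, val_glMap] at hQ'
    rw [hS', Matrix.map_mul, Matrix.map_mul, Matrix.mul_assoc, hPinv, ← Matrix.mul_assoc,
      Matrix.mul_assoc _ _ (A.val.map _), h, ← Matrix.mul_assoc, hQ']
    simp only [Matrix.mul_assoc]
  have hcoeff : ∀ k : ℤ, (S'.map fun f => f.coeff k) * ((p : ℂ) ^ k • A'.val) =
      B'.val * S'.map fun f => f.coeff k := by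
    intro k
    have hl : ∀ (c : ℂ) (f : ℂ[T;T⁻¹]), (LaurentPolynomial.C c * f).coeff k = c * f.coeff k := by
      intro c f
      rw [← LaurentPolynomial.smul_eq_C_mul]
      rfl
    ext i j
    have := congrArg (fun f : ℂ[T;T⁻¹] => f.coeff k) (congrFun (congrFun h' i) j)
    simp only [Matrix.mul_apply, Matrix.map_apply, AddMonoidAlgebra.coeff_sum,
      Finsupp.finsetSum_apply, hl] at this
    simp only [mul_comm _ (LaurentPolynomial.C _), hl, coeff_laurentPhi] at this
    simp only [Matrix.mul_apply, Matrix.map_apply, Matrix.smul_apply, smul_eq_mul]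
    rw [← this]
    exact Finset.sum_congr rfl fun l _ => by ring
  -- an annulus `1 ≤ |z| < p` does not meet its multiple by `p ^ k` if `k ≠ 0`
  have hS0 : ∀ k : ℤ, k ≠ 0 → (S'.map fun f => f.coeff k) = 0 := by
    intro k hk
    refine eq_zero_of_intertwines (hcoeff k) (Set.disjoint_left.2 fun ν hν hν' => ?_)
    have hp := natCast_ne_zero_of_atLeastTwo p
    have hpk : (p : ℂ) ^ k ≠ 0 := zpow_ne_zero _ hp
    have hsm : (p : ℂ) ^ k • A'.val = Units.mk0 ((p : ℂ) ^ k) hpk • A'.val := rfl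
    rw [hsm, spectrum.unit_smul_eq_smul] at hν
    obtain ⟨μ, hμ, rfl⟩ := hν
    obtain ⟨h1, h2⟩ := hA' μ hμ
    obtain ⟨h3, h4⟩ := hB' _ hν'
    have hn : ‖Units.mk0 ((p : ℂ) ^ k) hpk • μ‖ = (p : ℝ) ^ k * ‖μ‖ := by
      rw [Units.smul_def, Units.val_mk0, norm_smul, norm_zpow, Complex.norm_natCast]
    change 1 ≤ ‖Units.mk0 ((p : ℂ) ^ k) hpk • μ‖ at h3
    change ‖Units.mk0 ((p : ℂ) ^ k) hpk • μ‖ < p at h4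
    rw [hn] at h3 h4
    have hp0 : (0 : ℝ) < p := by linarith
    rcases lt_or_gt_of_ne hk with hk | hk
    · have : (p : ℝ) ^ k ≤ (p : ℝ) ^ (-1 : ℤ) := zpow_le_zpow_right₀ hp1.le (by omega)
      rw [_root_.zpow_neg_one] at this
      have h5 : (p : ℝ) ^ k * ‖μ‖ < (p : ℝ)⁻¹ * p :=
        mul_lt_mul' this h2 (norm_nonneg _) (inv_pos.2 hp0)
      rw [inv_mul_cancel₀ hp0.ne'] at h5
      linarith
    · have : (p : ℝ) ^ (1 : ℤ) ≤ (p : ℝ) ^ k := zpow_le_zpow_right₀ hp1.le (by omega)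
      rw [zpow_one] at this
      have h5 : (p : ℝ) * 1 ≤ (p : ℝ) ^ k * ‖μ‖ := mul_le_mul this h1 zero_le_one (by positivity)
      linarith
  have hC : S' = (S'.map fun f => f.coeff 0).map LaurentPolynomial.C := by
    ext i j k
    simp only [Matrix.map_apply, LaurentPolynomial.C_apply]
    split_ifs with hk
    · rw [hk]
    · exact congrFun (congrFun (hS0 k hk) i) j
  obtain ⟨k, i, j, t, hk⟩ := exists_isSplitKernel (S'.map fun f => f.coeff 0)
  have h0 := hcoeff 0
  rw [zpow_zero, one_smul] at h0
  have hk' := (hk.map LaurentPolynomial.C).conj P Q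
  rw [← hC, ← hS] at hk'
  refine ⟨k, _, _, _, hk.restrictGL hk h0, hk', ?_⟩
  have hk0 := congrArg (fun M : Matrix (Fin n) (Fin k) ℂ => M.map LaurentPolynomial.C)
    (hk.mul_mul_proj hk h0)
  simp only [Matrix.map_mul] at hk0
  have hi : (i.map LaurentPolynomial.C).map (laurentPhi p) = i.map LaurentPolynomial.C := by
    ext1 a b
    simp
  rw [Matrix.map_mul, hi, Matrix.mul_assoc, IsSplitKernel.restrictGL_val, Matrix.map_mul,
    Matrix.map_mul, hk0, ← Matrix.mul_assoc, ← Matrix.mul_assoc, hPinv]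

end LaurentKernel

/-! ### Fields of meromorphic functions -/

section Meromorphic

variable {U V : Set ℂ}

lemma Mero.exists_mk (f : Mero U) : ∃ (g : ℂ → ℂ) (hg : MeromorphicOn g U), Mero.mk g hg = f := by
  obtain ⟨f, g, hg, rfl⟩ := f
  exact ⟨g, hg, rfl⟩

lemma Mero.mk_eq_mk {f g : ℂ → ℂ} {hf : MeromorphicOn f U} {hg : MeromorphicOn g U} :
    Mero.mk f hf = Mero.mk g hg ↔ f =ᶠ[codiscreteWithin U] g := by
  rw [← (Mero.toGerm_injective U).eq_iff, Mero.toGerm_mk, Mero.toGerm_mk, Germ.coe_eq]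

lemma pullback_mk {h : ℂ → ℂ} (H : IsPullbackMap h U V) {g : ℂ → ℂ} (hg : MeromorphicOn g V) :
    ∃ hgh : MeromorphicOn (g ∘ h) U, pullback H (Mero.mk g hg) = Mero.mk (g ∘ h) hgh :=
  ⟨fun x hx => (hg _ (H.mapsTo hx)).comp_analyticAt (H.analytic x hx), rfl⟩

lemma codiscreteWithin_neBot (hU : IsOpen U) (hne : U.Nonempty) : (codiscreteWithin U).NeBot := by
  obtain ⟨x, hx⟩ := hne
  refine neBot_iff.2 fun h => ?_
  have h' : (∅ : Set ℂ) ∈ codiscreteWithin U := by rw [h]; exact mem_bot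
  rw [mem_codiscreteWithin_iff_forall_mem_nhdsNE] at h'
  have h2 : U ∈ 𝓝[≠] x := mem_nhdsWithin_of_mem_nhds (hU.mem_nhds hx)
  have h3 := Filter.inter_mem (h' x hx) h2
  rw [Set.empty_union, Set.compl_inter_self] at h3
  exact (NormedField.nhdsNE_neBot x).ne (Filter.empty_mem_iff_bot.1 h3)

lemma Mero.nontrivial (hU : IsOpen U) (hne : U.Nonempty) : Nontrivial (Mero U) := by
  have := codiscreteWithin_neBot hU hne
  refine ⟨⟨0, 1, fun h => ?_⟩⟩
  have h' := congrArg (Mero.toGerm U) h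
  rw [map_zero, map_one] at h'
  exact zero_ne_one h'

lemma eventually_nhdsNE_of_codiscreteWithin (hU : IsOpen U) {x : ℂ} (hx : x ∈ U) {P : ℂ → Prop}
    (h : ∀ᶠ y in codiscreteWithin U, P y) : ∀ᶠ y in 𝓝[≠] x, P y := by
  filter_upwards [mem_codiscreteWithin_iff_forall_mem_nhdsNE.1 h x hx,
    mem_nhdsWithin_of_mem_nhds (hU.mem_nhds hx)] with y hy hyU
  exact hy.resolve_right fun h => h hyU

/-- The identity theorem. -/
lemma meromorphic_eq_zero_or_ne_zero (hU : IsPreconnected U) {f : ℂ → ℂ}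
    (hf : MeromorphicOn f U) :
    f =ᶠ[codiscreteWithin U] 0 ∨ ∀ᶠ x in codiscreteWithin U, f x ≠ 0 := by
  by_cases h : ∃ x ∈ U, meromorphicOrderAt f x ≠ ⊤
  · obtain ⟨x, hx, hx'⟩ := h
    exact .inr (MeromorphicOn.eventually_codiscreteWithin_apply_ne_zero hf fun y hy =>
      hf.meromorphicOrderAt_ne_top_of_isPreconnected hU hx hy hx')
  · push Not at h
    refine .inl (mem_codiscreteWithin_iff_forall_mem_nhdsNE.2 fun x hx => ?_)
    filter_upwards [meromorphicOrderAt_eq_top_iff.1 (h x hx)] with y hy using .inl hy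

lemma Mero.exists_mul_eq_one (hU : IsPreconnected U) {f : Mero U} (hf : f ≠ 0) :
    ∃ g, f * g = 1 := by
  obtain ⟨f, hf', rfl⟩ := f.exists_mk
  rcases meromorphic_eq_zero_or_ne_zero hU hf' with h | h
  · exact (hf (Mero.mk_eq_mk (hg := MeromorphicOn.const 0).2 h)).elim
  refine ⟨Mero.mk f⁻¹ hf'.inv, Mero.mk_eq_mk (hf := hf'.mul hf'.inv)
    (hg := MeromorphicOn.const 1).2 ?_⟩
  filter_upwards [h] with x hx using mul_inv_cancel₀ hx

lemma isPreconnected_extDisk : IsPreconnected extDisk := by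
  have : extDisk = Complex.exp '' {z | 0 < z.re} := by
    ext z
    constructor
    · intro hz
      have hz : 1 < ‖z‖ := hz
      have hz0 : z ≠ 0 := norm_pos_iff.1 (by linarith)
      refine ⟨Complex.log z, ?_, Complex.exp_log hz0⟩
      change 0 < (Complex.log z).re
      rw [Complex.log_re]
      exact Real.log_pos hz
    · rintro ⟨u, hu, rfl⟩
      change 1 < ‖Complex.exp u‖
      rw [Complex.norm_exp]
      exact Real.one_lt_exp_iff.2 hu
  rw [this]
  exact (convex_halfSpace_re_gt 0).isPreconnected.image _ Complex.continuous_exp.continuousOn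

lemma MeroExt.exists_mk (f : MeroExt) : ∃ (g : ℂ → ℂ) (hg : MeromorphicOn g extDisk),
    MeromorphicAt (fun w => g w⁻¹) 0 ∧ MeroExt.toMero f = Mero.mk g hg := by
  obtain ⟨f, g, hg, rfl⟩ := f
  exact ⟨g, hg.1, hg.2, rfl⟩

lemma MeroExt.exists_mul_eq_one {f : MeroExt} (hf : f ≠ 0) : ∃ g, f * g = 1 := by
  obtain ⟨f, f', hf', rfl⟩ := f
  rcases meromorphic_eq_zero_or_ne_zero isPreconnected_extDisk hf'.1 with h | h
  · exact (hf (Subtype.ext (Germ.coe_eq.2 h))).elim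
  refine ⟨⟨_, f'⁻¹, ⟨hf'.1.inv, hf'.2.inv⟩, rfl⟩, Subtype.ext (Germ.coe_eq.2 ?_)⟩
  filter_upwards [h] with x hx using mul_inv_cancel₀ hx

lemma mem_coord_Sigma0 {u : ℂ} : u ∈ coord Sigma0 ↔ u.re < 0 := by
  change ‖Complex.exp u‖ < 1 ↔ _
  rw [Complex.norm_exp, Real.exp_lt_one_iff]

lemma mem_coord_SigmaInf {u : ℂ} : u ∈ coord SigmaInf ↔ 0 < u.re := by
  change 1 < ‖Complex.exp u‖ ↔ _
  rw [Complex.norm_exp, Real.one_lt_exp_iff]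

lemma isOpen_coord_Sigma0 : IsOpen (coord Sigma0) := by
  have : coord Sigma0 = {u : ℂ | u.re < 0} := Set.ext fun _ => mem_coord_Sigma0
  rw [this]
  exact isOpen_lt Complex.continuous_re continuous_const

lemma isOpen_coord_SigmaInf : IsOpen (coord SigmaInf) := by
  have : coord SigmaInf = {u : ℂ | 0 < u.re} := Set.ext fun _ => mem_coord_SigmaInf
  rw [this]
  exact isOpen_lt continuous_const Complex.continuous_re

lemma isOpen_disk : IsOpen disk := isOpen_lt continuous_norm continuous_const

lemma isOpen_extDisk : IsOpen extDisk := isOpen_lt continuous_const continuous_norm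

instance : Nontrivial (MeroT Sigma0) :=
  Mero.nontrivial isOpen_coord_Sigma0 ⟨-1, mem_coord_Sigma0.2 (by simp)⟩

instance : Nontrivial (MeroT SigmaInf) :=
  Mero.nontrivial isOpen_coord_SigmaInf ⟨1, mem_coord_SigmaInf.2 (by simp)⟩

/-- The triples of a meromorphic function on the universal cover, one on the open unit disk and one
on the complement of the closed unit disk in the sphere that agree on `Σ₀` and on `Σ_∞`. (They are
the rational functions, but only the structure of a field is needed.) -/
def matchingTriples : Subring (MeroT Set.univ × Mero disk × MeroExt) :=
  RingHom.eqLocus ((resHom Sigma0).comp (RingHom.fst _ _))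
    (projPull0.comp ((RingHom.fst _ _).comp (RingHom.snd _ _))) ⊓
  RingHom.eqLocus ((resHom SigmaInf).comp (RingHom.fst _ _))
    (projPullInf.comp ((RingHom.snd _ _).comp (RingHom.snd _ _)))

/-- Each of the three rings is a field, so the pullbacks between them are injective and one entry of
a triple vanishes only if all do; then inverses may be taken entrywise. -/
lemma isField_matchingTriples : IsField matchingTriples where
  exists_pair_ne := by
    have : Nontrivial (MeroT Set.univ) := Mero.nontrivial isOpen_univ Set.univ_nonempty
    exact ⟨0, 1, zero_ne_one⟩
  mul_comm := mul_comm
  mul_inv_cancel := by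
    have key : ∀ {R R' : Type} [CommRing R] [CommRing R'] [Nontrivial R'] (φ : R →+* R')
        {x : R}, (x ≠ 0 → ∃ y, x * y = 1) → φ x = 0 → x = 0 := by
      intro R R' _ _ _ φ x hx h
      by_contra hne
      obtain ⟨y, hy⟩ := hx hne
      have := congrArg φ hy
      rw [map_mul, h, zero_mul, map_one] at this
      exact zero_ne_one this
    have hdisk : ∀ f : Mero disk, f ≠ 0 → ∃ g, f * g = 1 := by
      have : disk = Metric.ball (0 : ℂ) 1 := by ext z; simp [disk]
      exact fun f => Mero.exists_mul_eq_one (this ▸ (convex_ball 0 1).isPreconnected)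
    rintro ⟨⟨f, f₀, f₁⟩, h₀, h₁⟩ hne
    have h₀ : resHom Sigma0 f = projPull0 f₀ := h₀
    have h₁ : resHom SigmaInf f = projPullInf f₁ := h₁
    have hf : f ≠ 0 := by
      rintro rfl
      rw [map_zero] at h₀ h₁
      have h₀' := key projPull0 (hdisk f₀) h₀.symm
      have h₁' := key projPullInf MeroExt.exists_mul_eq_one h₁.symm
      exact hne (Subtype.ext (Prod.ext rfl (Prod.ext h₀' h₁')))
    have hinv : ∀ f : MeroT Set.univ, f ≠ 0 → ∃ g, f * g = 1 :=
      fun f => Mero.exists_mul_eq_one isPreconnected_univ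
    have hf₀ : f₀ ≠ 0 := by
      rintro rfl
      rw [map_zero] at h₀
      exact hf (key _ (hinv f) h₀)
    have hf₁ : f₁ ≠ 0 := by
      rintro rfl
      rw [map_zero] at h₁
      exact hf (key _ (hinv f) h₁)
    obtain ⟨g, hg⟩ := hinv f hf
    obtain ⟨g₀, hg₀⟩ := hdisk f₀ hf₀
    obtain ⟨g₁, hg₁⟩ := MeroExt.exists_mul_eq_one hf₁
    have huniq : ∀ {R : Type} [CommRing R] {x y z : R}, x * y = 1 → x * z = 1 → y = z :=
      fun hy hz => left_inv_eq_right_inv ((mul_comm _ _).trans hy) hz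
    refine ⟨⟨(g, g₀, g₁), ?_, ?_⟩, Subtype.ext (Prod.ext hg (Prod.ext hg₀ hg₁))⟩
    · refine huniq (x := resHom Sigma0 f) ?_ ?_
      · exact (map_mul (resHom Sigma0) f g).symm.trans (by rw [hg, map_one])
      · rw [h₀]
        exact (map_mul projPull0 f₀ g₀).symm.trans (by rw [hg₀, map_one])
    · refine huniq (x := resHom SigmaInf f) ?_ ?_
      · exact (map_mul (resHom SigmaInf) f g).symm.trans (by rw [hg, map_one])
      · rw [h₁]
        exact (map_mul projPullInf f₁ g₁).symm.trans (by rw [hg₁, map_one])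

/-! ### Regular points -/

/-- Regularity may be read off from any representative: regularity at `x` means that the
representative can be made analytic at `x` by changing its value at that point. -/
lemma regularAt_mk (hU : IsOpen U) {x : ℂ} (hx : x ∈ U) {g : ℂ → ℂ} {hg : MeromorphicOn g U} :
    RegularAt (Mero.mk g hg) x ↔ 0 ≤ meromorphicOrderAt g x := by
  constructor
  · rintro ⟨g', hg', han, heq⟩
    rw [← meromorphicOrderAt_congr
      (eventually_nhdsNE_of_codiscreteWithin hU hx (Mero.mk_eq_mk.1 heq))]
    exact han.meromorphicOrderAt_nonneg
  · intro h
    have heq : toMeromorphicNFAt g x =ᶠ[codiscreteWithin U] g := by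
      filter_upwards [compl_singleton_mem_codiscreteWithin (s := U) x] with y hy
      exact ((hg x hx).eqOn_compl_singleton_toMeromorphicNFAt hy).symm
    have hmer : MeromorphicOn (toMeromorphicNFAt g x) U :=
      hg.congr_codiscreteWithin heq.symm hU
    exact ⟨_, hmer, (hg x hx).meromorphicOrderAt_nonneg_iff_analyticAt_toMeromorphicNFAt.1 h,
      Mero.mk_eq_mk.2 heq⟩

lemma regularAt_pullback {h : ℂ → ℂ} (H : IsPullbackMap h U V) (hU : IsOpen U) (hV : IsOpen V)
    {f : Mero V} {x : ℂ} (hx : x ∈ U) : RegularAt (pullback H f) x ↔ RegularAt f (h x) := by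
  obtain ⟨g, hg, rfl⟩ := f.exists_mk
  obtain ⟨hgh, hp⟩ := pullback_mk H hg
  rw [hp, regularAt_mk hU hx, regularAt_mk hV (H.mapsTo hx),
    meromorphicOrderAt_comp_of_deriv_ne_zero (H.analytic x hx) (H.deriv_ne_zero x hx)]

lemma finite_not_regularAt {K : Set ℂ} (hK : IsCompact K) (hKU : K ⊆ U) (f : Mero U) :
    {x ∈ K | ¬ RegularAt f x}.Finite := by
  obtain ⟨g, hg, rfl⟩ := f.exists_mk
  refine (hK.finite_sdiff_of_mem_codiscreteWithin
    (hg.mono_set hKU).analyticAt_mem_codiscreteWithin).subset ?_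
  exact fun x hx => ⟨hx.1, fun h => hx.2 ⟨g, hg, h, rfl⟩⟩

/-- Away from finitely many points, a meromorphic function on the complement of the closed unit
disk in the sphere is regular at a positive distance from the disk. -/
lemma finite_not_regularAt_ext {r : ℝ} (hr : 1 < r) (f : MeroExt) :
    {z : ℂ | r ≤ ‖z‖ ∧ ¬ RegularAt (MeroExt.toMero f) z}.Finite := by
  obtain ⟨g, hg, hg', hf⟩ := f.exists_mk
  rw [hf]
  have hr0 : 0 < r := by linarith
  have hmer : MeromorphicOn (fun w => g w⁻¹) (Metric.closedBall 0 r⁻¹) := by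
    intro w hw
    rw [mem_closedBall_zero_iff] at hw
    by_cases hw0 : w = 0
    · rw [hw0]; exact hg'
    have hw1 : 0 < ‖w‖ := norm_pos_iff.2 hw0
    have : w⁻¹ ∈ extDisk := by
      change 1 < ‖w⁻¹‖
      rw [norm_inv]
      exact hr.trans_le ((le_inv_comm₀ hw1 hr0).1 hw)
    exact (hg _ this).comp_analyticAt (analyticAt_inv hw0)
  have hfin := (isCompact_closedBall (0 : ℂ) r⁻¹).finite_sdiff_of_mem_codiscreteWithin
    hmer.analyticAt_mem_codiscreteWithin
  refine (hfin.preimage (f := fun z : ℂ => z⁻¹) inv_injective.injOn).subset ?_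
  rintro z ⟨hz, hz'⟩
  have hz0 : z ≠ 0 := norm_pos_iff.1 (hr0.trans_le hz)
  refine ⟨?_, fun h => hz' ⟨g, hg, ?_, rfl⟩⟩
  · rw [mem_closedBall_zero_iff, norm_inv]
    exact inv_anti₀ hr0 hz
  · have h1 : AnalyticAt ℂ (fun w => g w⁻¹) z⁻¹ := h
    have h2 := h1.comp (analyticAt_inv hz0)
    have h3 : (fun w => g w⁻¹) ∘ Inv.inv = g := by ext w; simp
    rwa [h3] at h2

/-- The functions that are regular at `x`. -/
def regularSubring (U : Set ℂ) (x : ℂ) : Subring (Mero U) where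
  carrier := {f | RegularAt f x}
  mul_mem' := RegularAt.mul
  one_mem' := RegularAt.one x
  add_mem' := RegularAt.add
  zero_mem' := RegularAt.zero x
  neg_mem' := by
    rintro _ ⟨a, ha, ha', rfl⟩
    exact ⟨-a, ha.neg, ha'.neg, rfl⟩

lemma regularAt_constHom {V : Set UnivCover} (c x : ℂ) : RegularAt (constHom V c) x :=
  ⟨fun _ => c, MeromorphicOn.const c, analyticAt_const, rfl⟩

lemma regularAt_laurentHom {V : Set UnivCover} (f : ℂ[T;T⁻¹]) {x : ℂ} (hx : x ≠ 0) :
    RegularAt (laurentHom V f) x := by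
  induction f using LaurentPolynomial.induction_on' with
  | add f g hf hg => rw [map_add]; exact hf.add hg
  | C_mul_T k a =>
    have hT : laurentHom V (LaurentPolynomial.T 1) ∈ regularSubring (coord V) x := by
      rw [laurentHom, LaurentPolynomial.eval₂_T, zpow_one]
      exact ⟨_, fun x _ => MeromorphicAt.id x, analyticAt_id, rfl⟩
    have hT' : laurentHom V (LaurentPolynomial.T (-1)) ∈ regularSubring (coord V) x := by
      rw [laurentHom, LaurentPolynomial.eval₂_T, _root_.zpow_neg_one]
      exact ⟨_, fun x _ => (MeromorphicAt.id x).inv, analyticAt_inv hx, rfl⟩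
    rw [map_mul, Conn.laurentHom_C]
    refine (regularAt_constHom a x).mul ?_
    change _ ∈ regularSubring (coord V) x
    obtain ⟨k, rfl | rfl⟩ := k.eq_nat_or_neg
    · have := pow_mem hT k
      rwa [← map_pow, LaurentPolynomial.T_pow, mul_one] at this
    · have := pow_mem hT' k
      rwa [← map_pow, LaurentPolynomial.T_pow, mul_neg_one] at this

lemma regularAt_matrix_mul {l m n : ℕ} {A : Matrix (Fin l) (Fin m) (Mero U)}
    {B : Matrix (Fin m) (Fin n) (Mero U)} {x : ℂ} (hA : ∀ i j, RegularAt (A i j) x)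
    (hB : ∀ i j, RegularAt (B i j) x) (i : Fin l) (j : Fin n) : RegularAt ((A * B) i j) x := by
  rw [Matrix.mul_apply]
  exact (regularSubring U x).sum_mem fun k _ => (hA i k).mul (hB k j)

/-- The invertible matrices that are regular at `x` together with their inverses. -/
def regularGL (U : Set ℂ) (n : ℕ) (x : ℂ) : Subgroup (GL (Fin n) (Mero U)) where
  carrier := {M | (∀ i j, RegularAt (M.val i j) x) ∧ ∀ i j, RegularAt (M⁻¹.val i j) x}
  mul_mem' {M N} hM hN := by
    refine ⟨regularAt_matrix_mul hM.1 hN.1, ?_⟩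
    rw [_root_.mul_inv_rev]
    exact regularAt_matrix_mul hN.2 hM.2
  one_mem' := ⟨Conn.regularAt_one, by rw [inv_one]; exact Conn.regularAt_one⟩
  inv_mem' {M} hM := ⟨hM.2, by rw [inv_inv]; exact hM.1⟩

lemma mem_regularGL {n : ℕ} {x : ℂ} {M : GL (Fin n) (Mero U)} : M ∈ regularGL U n x ↔
    (∀ i j, RegularAt (M.val i j) x) ∧ ∀ i j, RegularAt (M⁻¹.val i j) x := Iff.rfl

lemma mem_singularLocus {V : Set UnivCover} {n : ℕ} {M : GL (Fin n) (MeroT V)} {x : UnivCover} :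
    x ∈ singularLocus M ↔ x ∈ V ∧ M ∉ regularGL (coord V) n (logT x) := by
  rw [mem_regularGL, not_and_or]
  push Not
  rfl

lemma map_constHom_mem_regularGL {V : Set UnivCover} {n : ℕ} (A : GL (Fin n) ℂ) (x : ℂ) :
    GeneralLinearGroup.map (constHom V) A ∈ regularGL (coord V) n x :=
  ⟨fun _ _ => regularAt_constHom _ _, fun _ _ => regularAt_constHom _ _⟩

lemma map_pullback_mem_regularGL {h : ℂ → ℂ} (H : IsPullbackMap h U V) (hU : IsOpen U)
    (hV : IsOpen V) {n : ℕ} {M : GL (Fin n) (Mero V)} {x : ℂ} (hx : x ∈ U) :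
    GeneralLinearGroup.map (pullback H) M ∈ regularGL U n x ↔ M ∈ regularGL V n (h x) :=
  and_congr (forall₂_congr fun _ _ => regularAt_pullback H hU hV hx)
    (forall₂_congr fun _ _ => regularAt_pullback H hU hV hx)

/-- The singular points of an invertible matrix do not accumulate in `U`. -/
lemma finite_notMem_regularGL {K : Set ℂ} (hK : IsCompact K) (hKU : K ⊆ U) {n : ℕ}
    (M : GL (Fin n) (Mero U)) : {x ∈ K | M ∉ regularGL U n x}.Finite := by
  have h : ∀ A : Matrix (Fin n) (Fin n) (Mero U),
      (⋃ i, ⋃ j, {x ∈ K | ¬ RegularAt (A i j) x}).Finite := fun A =>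
    Set.finite_iUnion fun i => Set.finite_iUnion fun j => finite_not_regularAt hK hKU _
  refine ((h M.val).union (h M⁻¹.val)).subset ?_
  rintro x ⟨hx, hx'⟩
  rw [mem_regularGL, not_and_or] at hx'
  push Not at hx'
  simp only [Set.mem_union, Set.mem_iUnion]
  exact hx'.imp (fun ⟨i, j, h⟩ => ⟨i, j, hx, h⟩) fun ⟨i, j, h⟩ => ⟨i, j, hx, h⟩

lemma finite_notMem_regularGL_ext {r : ℝ} (hr : 1 < r) {n : ℕ} (M : GL (Fin n) MeroExt) :
    {z : ℂ | r ≤ ‖z‖ ∧ GeneralLinearGroup.map MeroExt.toMero M ∉ regularGL extDisk n z}.Finite := by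
  have h : ∀ A : Matrix (Fin n) (Fin n) MeroExt,
      (⋃ i, ⋃ j, {z : ℂ | r ≤ ‖z‖ ∧ ¬ RegularAt (MeroExt.toMero (A i j)) z}).Finite := fun A =>
    Set.finite_iUnion fun i => Set.finite_iUnion fun j => finite_not_regularAt_ext hr _
  refine ((h M.val).union (h M⁻¹.val)).subset ?_
  rintro x ⟨hx, hx'⟩
  rw [mem_regularGL, not_and_or] at hx'
  push Not at hx'
  simp only [Set.mem_union, Set.mem_iUnion]
  exact hx'.imp (fun ⟨i, j, h⟩ => ⟨i, j, hx, h⟩) fun ⟨i, j, h⟩ => ⟨i, j, hx, h⟩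

end Meromorphic

/-! ### Kernels of morphisms -/

section RingHoms

/-- Constants as meromorphic functions on an open subset of `ℂ`. -/
def Mero.const (U : Set ℂ) : ℂ →+* Mero U :=
  ((Germ.coeRingHom (codiscreteWithin U)).comp (Pi.constRingHom ℂ ℂ)).codRestrict
    (meroSubring U) fun c => ⟨fun _ => c, MeromorphicOn.const c, rfl⟩

/-- Constants as meromorphic functions on the complement of the closed unit disk in the sphere. -/
def MeroExt.const : ℂ →+* MeroExt :=
  ((Germ.coeRingHom (codiscreteWithin extDisk)).comp (Pi.constRingHom ℂ ℂ)).codRestrict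
    meroExtSubring fun c => ⟨fun _ => c, ⟨MeromorphicOn.const c, MeromorphicAt.const c 0⟩, rfl⟩

lemma projPull0_const (c : ℂ) : projPull0 (Mero.const disk c) = constHom Sigma0 c := rfl

lemma projPullInf_const (c : ℂ) : projPullInf (MeroExt.const c) = constHom SigmaInf c := rfl

lemma laurentHom_ext {R : Type} [CommRing R] {φ ψ : ℂ[T;T⁻¹] →+* R}
    (hC : ∀ a, φ (LaurentPolynomial.C a) = ψ (LaurentPolynomial.C a))
    (hT : φ (LaurentPolynomial.T 1) = ψ (LaurentPolynomial.T 1)) (f : ℂ[T;T⁻¹]) : φ f = ψ f := by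
  let u : (ℂ[T;T⁻¹])ˣ := laurentT 1
  have hu : Units.map (φ : ℂ[T;T⁻¹] →* R) u = Units.map (ψ : ℂ[T;T⁻¹] →* R) u := Units.ext hT
  have huk : ∀ k : ℤ, (u ^ k).val = LaurentPolynomial.T k := by
    intro k
    obtain ⟨k, rfl | rfl⟩ := k.eq_nat_or_neg
    · simp [u, laurentT]
    · rw [_root_.zpow_neg, zpow_natCast, ← inv_pow, Units.val_pow_eq_pow_val]
      simp [u, laurentT]
  induction f using LaurentPolynomial.induction_on' with
  | add f g hf hg => rw [map_add, map_add, hf, hg]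
  | C_mul_T k a =>
    have := congrArg (fun v : Rˣ => (v ^ k).val) hu
    simp only [← map_zpow, Units.coe_map, huk] at this
    rw [map_mul, map_mul, hC]
    exact congrArg _ this

lemma laurentHom_T (V : Set UnivCover) :
    laurentHom V (LaurentPolynomial.T 1) = (logUnit V).val := by
  rw [laurentHom, LaurentPolynomial.eval₂_T, zpow_one]

lemma resHom_laurentHom (V : Set UnivCover) (f : ℂ[T;T⁻¹]) :
    resHom V (laurentHom Set.univ f) = laurentHom V f := by
  refine laurentHom_ext (φ := (resHom V).comp (laurentHom Set.univ)) (ψ := laurentHom V)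
    (fun a => ?_) ?_ f
  · rw [RingHom.comp_apply, Conn.laurentHom_C, Conn.laurentHom_C]
    rfl
  · rw [RingHom.comp_apply, laurentHom_T, laurentHom_T]
    rfl

variable {p : ℕ} [p.AtLeastTwo]

lemma pullback_laurentHom {V : Set UnivCover}
    (H : IsPullbackMap (fun u => (p : ℂ) * u) (coord V) (coord V)) (f : ℂ[T;T⁻¹]) :
    pullback H (laurentHom V f) = laurentHom V (laurentPhi p f) := by
  refine laurentHom_ext (φ := (pullback H).comp (laurentHom V))
    (ψ := (laurentHom V).comp (laurentPhi p)) (fun a => ?_) ?_ f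
  · simp only [RingHom.comp_apply, Conn.laurentHom_C, Conn.laurentPhi_C]
    rfl
  · have : laurentPhi p (LaurentPolynomial.T 1) =
        LaurentPolynomial.C (p : ℂ) * LaurentPolynomial.T 1 := by
      have := laurentPhi_C_mul_T (p := p) 1 1
      simpa using this
    rw [RingHom.comp_apply, RingHom.comp_apply, this, map_mul, Conn.laurentHom_C, laurentHom_T]
    rfl

lemma phi0_laurentHom (f : ℂ[T;T⁻¹]) :
    phi0 p (laurentHom Sigma0 f) = laurentHom Sigma0 (laurentPhi p f) := pullback_laurentHom _ f

lemma phiInf_laurentHom (f : ℂ[T;T⁻¹]) :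
    phiInf p (laurentHom SigmaInf f) = laurentHom SigmaInf (laurentPhi p f) :=
  pullback_laurentHom _ f

end RingHoms

section Restriction

variable {p : ℕ} [p.AtLeastTwo] {k m n : ℕ}

namespace IsSplitKernel

lemma restrict_comp {R : Type} [CommRing R] {k' k'' l : ℕ} {i : Matrix (Fin n) (Fin k) R}
    {j : Matrix (Fin k) (Fin n) R} {t : Matrix (Fin n) (Fin m) R} {S S' : Matrix (Fin m) (Fin n) R}
    {i' : Matrix (Fin n) (Fin k') R} {j' : Matrix (Fin k') (Fin n) R}
    {t' : Matrix (Fin n) (Fin m) R} (h : IsSplitKernel S i j t) (h' : IsSplitKernel S' i' j' t')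
    {M : Matrix (Fin n) (Fin n) R} {N : Matrix (Fin m) (Fin m) R} (hM : S * M = N * S')
    (a : Matrix (Fin l) (Fin k'') R) (M' : Matrix (Fin k'') (Fin n) R) :
    (a * M' * i) * (j * M * i') = a * (M' * M) * i' := by
  rw [Matrix.mul_assoc _ i, h.mul_mul_proj h' hM]
  simp only [Matrix.mul_assoc]

variable {R : Type} [CommRing R] {S₀ : Matrix (Fin m) (Fin n) ℂ} {i₀ : Matrix (Fin n) (Fin k) ℂ}
  {j₀ : Matrix (Fin k) (Fin n) ℂ} {t₀ : Matrix (Fin n) (Fin m) ℂ}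
  {S₁ : Matrix (Fin m) (Fin n) ℂ[T;T⁻¹]} {i₁ : Matrix (Fin n) (Fin k) ℂ[T;T⁻¹]}
  {j₁ : Matrix (Fin k) (Fin n) ℂ[T;T⁻¹]} {t₁ : Matrix (Fin n) (Fin m) ℂ[T;T⁻¹]}

/-- The functional equation of `M` is inherited by the kernel. -/
lemma map_phi_restrictGL (φ : R →+* R) (c : ℂ →+* R) (l : ℂ[T;T⁻¹] →+* R)
    (hφc : ∀ a, φ (c a) = c a) (hlc : ∀ a, l (LaurentPolynomial.C a) = c a)
    (hφl : ∀ f, φ (l f) = l (laurentPhi p f))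
    (h₀ : IsSplitKernel S₀ i₀ j₀ t₀) (h₁ : IsSplitKernel S₁ i₁ j₁ t₁)
    {A₀ A₁ : GL (Fin n) ℂ} {B₀ : GL (Fin m) ℂ} {A' : GL (Fin k) ℂ}
    (e₀ : S₀ * A₀.val = B₀.val * S₀)
    (hA' : A₁.val.map LaurentPolynomial.C * i₁ =
      i₁.map (laurentPhi p) * A'.val.map LaurentPolynomial.C)
    {M : GL (Fin n) R} {N : GL (Fin m) R} (hM : S₁.map l * M.val = N.val * S₀.map c)
    (hφ : GeneralLinearGroup.map φ M =
      GeneralLinearGroup.map c A₁ * M * (GeneralLinearGroup.map c A₀)⁻¹) :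
    GeneralLinearGroup.map φ ((h₁.map l).restrictGL (h₀.map c) hM) =
      GeneralLinearGroup.map c A' * (h₁.map l).restrictGL (h₀.map c) hM *
        (GeneralLinearGroup.map c (h₀.restrictGL h₀ e₀))⁻¹ := by
  rw [eq_mul_inv_iff_mul_eq] at hφ ⊢
  have hφ' := congrArg Units.val hφ
  refine Units.ext ?_
  simp only [Units.val_mul, val_glMap, restrictGL_val] at hφ' ⊢
  have hcφ : (i₀.map c).map φ = i₀.map c := by ext1 a b; exact hφc _
  have hlφ : ∀ {a b : ℕ} (Q : Matrix (Fin a) (Fin b) ℂ[T;T⁻¹]),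
      (Q.map l).map φ = (Q.map (laurentPhi p)).map l := by
    intro a b Q; ext1 x y; exact hφl _
  have hlC : ∀ {a b : ℕ} (Q : Matrix (Fin a) (Fin b) ℂ),
      (Q.map LaurentPolynomial.C).map l = Q.map c := by
    intro a b Q; ext1 x y; exact hlc _
  have e₀' := congrArg (fun Q : Matrix (Fin m) (Fin n) ℂ => Q.map c) e₀
  simp only [Matrix.map_mul] at e₀'
  have hA := congrArg (fun Q : Matrix (Fin n) (Fin k) ℂ[T;T⁻¹] => Q.map l) hA'
  simp only [Matrix.map_mul, hlC] at hA
  have hj : (j₁.map (laurentPhi p)).map l * (i₁.map (laurentPhi p)).map l = 1 :=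
    ((h₁.map (laurentPhi p)).map l).left_inv
  rw [Matrix.map_mul, Matrix.map_mul, Matrix.map_mul, Matrix.map_mul, hcφ, hlφ,
    restrict_comp (h₀.map c) (h₀.map c) e₀', hφ', ← Matrix.mul_assoc, Matrix.mul_assoc _ M.val,
    ← (h₁.map l).mul_mul_proj (h₀.map c) hM, Matrix.mul_assoc _ (A₁.val.map c),
    ← Matrix.mul_assoc (A₁.val.map c), hA]
  simp only [← Matrix.mul_assoc]
  rw [hj, Matrix.one_mul]

/-- A trivialization of `M` restricts to the kernel, if the trivializing matrices of the source and
of the target turn `S` into a matrix `F` with a split kernel. -/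
lemma map_restrictGL_mul_restrictGL {R₀ R₁ K : Type} [CommRing R₀] [CommRing R₁] [CommRing K]
    (res : R₁ →+* R) (pp : R₀ →+* R) (π₁ : K →+* R₁) (π₀ : K →+* R₀)
    (hπ : ∀ x, res (π₁ x) = pp (π₀ x)) (c : ℂ →+* R) (l : ℂ[T;T⁻¹] →+* R)
    (c₀ : ℂ →+* R₀) (l₁ : ℂ[T;T⁻¹] →+* R₁) (hc : ∀ a, pp (c₀ a) = c a)
    (hl : ∀ f, res (l₁ f) = l f)
    (h₀ : IsSplitKernel S₀ i₀ j₀ t₀) (h₁ : IsSplitKernel S₁ i₁ j₁ t₁)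
    {M : GL (Fin n) R} {N : GL (Fin m) R} (hM : S₁.map l * M.val = N.val * S₀.map c)
    {F : Matrix (Fin m) (Fin n) K} {i : Matrix (Fin n) (Fin k) K} {j : Matrix (Fin k) (Fin n) K}
    {t : Matrix (Fin n) (Fin m) K} (hF : IsSplitKernel F i j t)
    {W₁ : GL (Fin n) R₁} {V₁ : GL (Fin m) R₁} (hW₁ : F.map π₁ * W₁.val = V₁.val * S₁.map l₁)
    {W₀ : GL (Fin n) R₀} {V₀ : GL (Fin m) R₀} (hW₀ : F.map π₀ * W₀.val = V₀.val * S₀.map c₀)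
    (hW : GeneralLinearGroup.map res W₁ * M = GeneralLinearGroup.map pp W₀) :
    GeneralLinearGroup.map res ((hF.map π₁).restrictGL (h₁.map l₁) hW₁) *
        (h₁.map l).restrictGL (h₀.map c) hM =
      GeneralLinearGroup.map pp ((hF.map π₀).restrictGL (h₀.map c₀) hW₀) := by
  have hW' := congrArg Units.val hW
  refine Units.ext ?_
  simp only [Units.val_mul, val_glMap, restrictGL_val, Matrix.map_mul] at hW' ⊢
  have e₁ : (i₁.map l₁).map res = i₁.map l := by ext1 a b; exact hl _
  have e₂ : (i₀.map c₀).map pp = i₀.map c := by ext1 a b; exact hc _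
  have e₃ : (j.map π₁).map res = (j.map π₀).map pp := by ext1 a b; exact hπ _
  rw [e₁, e₂, e₃, restrict_comp (h₁.map l) (h₀.map c) hM, hW']

end IsSplitKernel

end Restriction

namespace Conn

variable {p : ℕ} [p.AtLeastTwo] {K X Y Z : Conn p}

/-- The three matrices of `ι` are bases of the kernels of the three matrices of `f`. -/
structure IsSplitKernelHom (f : X ⟶ Y) (ι : K ⟶ X) : Prop where
  split0 : ∃ j t, IsSplitKernel (Hom.S0 f) (Hom.S0 ι) j t
  split1 : ∃ j t, IsSplitKernel (Hom.S1 f) (Hom.S1 ι) j t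
  splitInf : ∃ j t, IsSplitKernel (Hom.SInf f) (Hom.SInf ι) j t

/-- Trivializations of `X` and `Y` turn `f` into a matrix over the field of matching triples. -/
lemma exists_matching_matrix (f : X ⟶ Y)
    {W₁ : GL (Fin X.n) (MeroT Set.univ)} {W₀ : GL (Fin X.n) (Mero disk)}
    {W₂ : GL (Fin X.n) MeroExt}
    (h₀ : GeneralLinearGroup.map (resHom Sigma0) W₁ * X.M0 = GeneralLinearGroup.map projPull0 W₀)
    (h₂ : GeneralLinearGroup.map (resHom SigmaInf) W₁ * X.MInf =
      GeneralLinearGroup.map projPullInf W₂)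
    {V₁ : GL (Fin Y.n) (MeroT Set.univ)} {V₀ : GL (Fin Y.n) (Mero disk)}
    {V₂ : GL (Fin Y.n) MeroExt}
    (k₀ : GeneralLinearGroup.map (resHom Sigma0) V₁ * Y.M0 = GeneralLinearGroup.map projPull0 V₀)
    (k₂ : GeneralLinearGroup.map (resHom SigmaInf) V₁ * Y.MInf =
      GeneralLinearGroup.map projPullInf V₂) :
    ∃ F : Matrix (Fin Y.n) (Fin X.n) matchingTriples,
      F.map ((RingHom.fst _ _).comp matchingTriples.subtype) * W₁.val =
        V₁.val * (Hom.S1 f).map (laurentHom Set.univ) ∧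
      F.map (((RingHom.fst _ _).comp (RingHom.snd _ _)).comp matchingTriples.subtype) * W₀.val =
        V₀.val * (Hom.S0 f).map (Mero.const disk) ∧
      F.map (((RingHom.snd _ _).comp (RingHom.snd _ _)).comp matchingTriples.subtype) * W₂.val =
        V₂.val * (Hom.SInf f).map MeroExt.const := by
  have key : ∀ {R : Type} [CommRing R] {M W : GL (Fin X.n) R} {N V : GL (Fin Y.n) R}
      {W' : GL (Fin X.n) R} {V' : GL (Fin Y.n) R} {S S' : Matrix (Fin Y.n) (Fin X.n) R},
      W * M = W' → V * N = V' → S * M.val = N.val * S' →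
      V.val * S * W⁻¹.val = V'.val * S' * W'⁻¹.val := by
    intro R _ M W N V W' V' S S' h k hS
    have hM : M.val * M⁻¹.val = 1 := M.mul_inv
    rw [← h, ← k, _root_.mul_inv_rev, Units.val_mul, Units.val_mul, Matrix.mul_assoc V.val N.val,
      ← hS, Matrix.mul_assoc, Matrix.mul_assoc, Matrix.mul_assoc S, ← Matrix.mul_assoc M.val, hM,
      Matrix.one_mul]
  have hmap : ∀ {R R' : Type} [CommRing R] [CommRing R'] (φ : R →+* R') (V : GL (Fin Y.n) R)
      (S : Matrix (Fin Y.n) (Fin X.n) R) (W : GL (Fin X.n) R), (V.val * S * W⁻¹.val).map φ =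
      (GeneralLinearGroup.map φ V).val * S.map φ * (GeneralLinearGroup.map φ W)⁻¹.val := by
    intro R R' _ _ φ V S W
    rw [Matrix.map_mul, Matrix.map_mul, ← map_inv]
    rfl
  have hcancel : ∀ {R : Type} [CommRing R] (W : GL (Fin X.n) R)
      (S : Matrix (Fin Y.n) (Fin X.n) R), S * W⁻¹.val * W.val = S := by
    intro R _ W S
    have : W⁻¹.val * W.val = 1 := W.inv_mul
    rw [Matrix.mul_assoc, this, Matrix.mul_one]
  have e₀ : ((V₁.val * (Hom.S1 f).map (laurentHom Set.univ) * W₁⁻¹.val).map (resHom Sigma0)) =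
      (V₀.val * (Hom.S0 f).map (Mero.const disk) * W₀⁻¹.val).map projPull0 := by
    rw [hmap, hmap]
    refine key h₀ k₀ ?_
    convert Hom.conn0 f using 2
    · ext1 i j
      exact resHom_laurentHom _ _
    · ext1 i j
      exact projPull0_const _
  have e₂ : ((V₁.val * (Hom.S1 f).map (laurentHom Set.univ) * W₁⁻¹.val).map (resHom SigmaInf)) =
      (V₂.val * (Hom.SInf f).map MeroExt.const * W₂⁻¹.val).map projPullInf := by
    rw [hmap, hmap]
    refine key h₂ k₂ ?_
    convert Hom.connInf f using 2
    · ext1 i j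
      exact resHom_laurentHom _ _
    · ext1 i j
      exact projPullInf_const _
  refine ⟨fun i j => ⟨((V₁.val * (Hom.S1 f).map (laurentHom Set.univ) * W₁⁻¹.val) i j,
    (V₀.val * (Hom.S0 f).map (Mero.const disk) * W₀⁻¹.val) i j,
    (V₂.val * (Hom.SInf f).map MeroExt.const * W₂⁻¹.val) i j),
    congrFun (congrFun e₀ i) j, congrFun (congrFun e₂ i) j⟩, ?_, ?_, ?_⟩
  · exact hcancel W₁ _
  · exact hcancel W₀ _
  · exact hcancel W₂ _

/-- Every morphism has a kernel whose three matrices are bases of the three kernels. -/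
lemma exists_isSplitKernelHom (f : X ⟶ Y) : ∃ (K : Conn p) (ι : K ⟶ X), IsSplitKernelHom f ι := by
  -- the three kernels have the same rank, as the matrices of `f` are intertwined by invertible ones
  obtain ⟨k, i₁, j₁, t₁, A', h₁, hA'⟩ := exists_isSplitKernel_laurent X.A1 Y.A1 _ (Hom.comm1 f)
  obtain ⟨k₀, i₀, j₀, t₀, h₀⟩ := exists_isSplitKernel (Hom.S0 f)
  obtain ⟨k₂, i₂, j₂, t₂, h₂⟩ := exists_isSplitKernel (Hom.SInf f)
  obtain rfl : k = k₀ := (h₁.map (laurentHom Sigma0)).rank_eq (h₀.map (constHom Sigma0))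
    (Hom.conn0 f)
  obtain rfl : k = k₂ := (h₁.map (laurentHom SigmaInf)).rank_eq (h₂.map (constHom SigmaInf))
    (Hom.connInf f)
  obtain ⟨W₁, W₀, W₂, hW₀, hW₂⟩ := X.exists_W
  obtain ⟨V₁, V₀, V₂, hV₀, hV₂⟩ := Y.exists_W
  obtain ⟨F, hF₁, hF₀, hF₂⟩ := exists_matching_matrix f hW₀ hW₂ hV₀ hV₂
  obtain ⟨k', i, j, t, hF⟩ :
      ∃ (k : ℕ) (i : Matrix (Fin X.n) (Fin k) matchingTriples)
        (j : Matrix (Fin k) (Fin X.n) matchingTriples)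
        (t : Matrix (Fin X.n) (Fin Y.n) matchingTriples), IsSplitKernel F i j t :=
    letI := isField_matchingTriples.toField
    exists_isSplitKernel F
  have : Nontrivial (MeroT Set.univ) := Mero.nontrivial isOpen_univ Set.univ_nonempty
  obtain rfl : k' = k := (hF.map _).rank_eq (h₁.map (laurentHom Set.univ)) hF₁
  let K : Conn p :=
    { n := k'
      A0 := h₀.restrictGL h₀ (Hom.comm0 f)
      A1 := A'
      AInf := h₂.restrictGL h₂ (Hom.commInf f)
      M0 := (h₁.map (laurentHom Sigma0)).restrictGL (h₀.map (constHom Sigma0)) (Hom.conn0 f)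
      MInf := (h₁.map (laurentHom SigmaInf)).restrictGL (h₂.map (constHom SigmaInf)) (Hom.connInf f)
      phi_M0 := h₀.map_phi_restrictGL (phi0 p) _ _ (fun _ => rfl) (laurentHom_C _)
        phi0_laurentHom h₁ (Hom.comm0 f) hA' (Hom.conn0 f) X.phi_M0
      phi_MInf := h₂.map_phi_restrictGL (phiInf p) _ _ (fun _ => rfl) (laurentHom_C _)
        phiInf_laurentHom h₁ (Hom.commInf f) hA' (Hom.connInf f) X.phi_MInf
      exists_W := ⟨(hF.map _).restrictGL (h₁.map _) hF₁, (hF.map _).restrictGL (h₀.map _) hF₀,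
        (hF.map _).restrictGL (h₂.map _) hF₂,
        h₀.map_restrictGL_mul_restrictGL _ _ _ _ (fun x => x.2.1) _ _ _ _ projPull0_const
          (resHom_laurentHom _) h₁ (Hom.conn0 f) hF hF₁ hF₀ hW₀,
        h₂.map_restrictGL_mul_restrictGL _ _ _ _ (fun x => x.2.2) _ _ _ _ projPullInf_const
          (resHom_laurentHom _) h₁ (Hom.connInf f) hF hF₁ hF₂ hW₂⟩ }
  let ι : Hom K X :=
    { S0 := i₀
      S1 := i₁
      SInf := i₂
      comm0 := h₀.mul_mul_proj h₀ (Hom.comm0 f)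
      comm1 := hA'.symm
      commInf := h₂.mul_mul_proj h₂ (Hom.commInf f)
      conn0 := (h₁.map (laurentHom Sigma0)).mul_mul_proj (h₀.map (constHom Sigma0)) (Hom.conn0 f)
      connInf := (h₁.map (laurentHom SigmaInf)).mul_mul_proj (h₂.map (constHom SigmaInf))
        (Hom.connInf f) }
  exact ⟨K, ι, ⟨_, _, h₀⟩, ⟨_, _, h₁⟩, ⟨_, _, h₂⟩⟩

end Conn

/-! ### Contragredient and block diagonal matrices -/

section MatrixLemmas

variable {R : Type} [CommRing R] {k k' l l' m m' n n' : ℕ}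

/-- Maps into two kernels that are intertwined by `A` and `B` stay intertwined when they are
expressed in the bases of the kernels. -/
lemma IsSplitKernel.lift_comm {S : Matrix (Fin m) (Fin n) R} {i : Matrix (Fin n) (Fin k) R}
    {j : Matrix (Fin k) (Fin n) R} {t : Matrix (Fin n) (Fin m) R}
    {S' : Matrix (Fin m') (Fin n') R} {i' : Matrix (Fin n') (Fin k') R}
    {j' : Matrix (Fin k') (Fin n') R} {t' : Matrix (Fin n') (Fin m') R}
    (h : IsSplitKernel S i j t) (h' : IsSplitKernel S' i' j' t')
    {g : Matrix (Fin n) (Fin l) R} {g' : Matrix (Fin n') (Fin l') R}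
    (hg : S * g = 0) (hg' : S' * g' = 0)
    {A : Matrix (Fin l) (Fin l') R} {M : Matrix (Fin n) (Fin n') R} {B : Matrix (Fin k) (Fin k') R}
    (hA : g * A = M * g') (hB : i * B = M * i') : j * g * A = B * (j' * g') := by
  refine h.left_cancel ?_
  rw [← Matrix.mul_assoc i B, hB, Matrix.mul_assoc M, h'.proj_mul hg', ← hA, Matrix.mul_assoc j,
    h.proj_mul (by rw [← Matrix.mul_assoc, hg, Matrix.zero_mul])]

/-- The inverse of an intertwining matrix is intertwining. -/
lemma intertwines_of_inverse {s : Matrix (Fin m) (Fin n) R} {t : Matrix (Fin n) (Fin m) R}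
    {s' : Matrix (Fin m') (Fin n') R} {t' : Matrix (Fin n') (Fin m') R}
    {A : Matrix (Fin n) (Fin n') R} {B : Matrix (Fin m) (Fin m') R}
    (hts : t * s = 1) (hst : s' * t' = 1) (h : s * A = B * s') : t * B = A * t' := by
  calc t * B = t * (B * s') * t' := by
        rw [Matrix.mul_assoc, Matrix.mul_assoc, hst, Matrix.mul_one]
    _ = A * t' := by rw [← h, ← Matrix.mul_assoc, hts, Matrix.one_mul]

/-- The contragredient matrix. -/
def dualGL (A : GL (Fin n) R) : GL (Fin n) R where
  val := A⁻¹.valᵀ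
  inv := A.valᵀ
  val_inv := by
    have : A.val * A⁻¹.val = 1 := A.mul_inv
    rw [← Matrix.transpose_mul, this, Matrix.transpose_one]
  inv_val := by
    have : A⁻¹.val * A.val = 1 := A.inv_mul
    rw [← Matrix.transpose_mul, this, Matrix.transpose_one]

lemma dualGL_mul (A B : GL (Fin n) R) : dualGL (A * B) = dualGL A * dualGL B :=
  Units.ext <| by
    change (A * B)⁻¹.valᵀ = A⁻¹.valᵀ * B⁻¹.valᵀ
    rw [_root_.mul_inv_rev, Units.val_mul, Matrix.transpose_mul]

lemma dualGL_inv (A : GL (Fin n) R) : dualGL A⁻¹ = (dualGL A)⁻¹ := rfl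

lemma dualGL_map {S : Type} [CommRing S] (φ : R →+* S) (A : GL (Fin n) R) :
    GeneralLinearGroup.map φ (dualGL A) = dualGL (GeneralLinearGroup.map φ A) := rfl

/-- An integral matrix as a matrix over `R`. -/
def castMat (R : Type) [CommRing R] (s : Matrix (Fin m) (Fin n) ℤ) : Matrix (Fin m) (Fin n) R :=
  s.map (Int.castRingHom R)

lemma castMat_mul (s : Matrix (Fin m) (Fin n) ℤ) (t : Matrix (Fin n) (Fin k) ℤ) :
    castMat R (s * t) = castMat R s * castMat R t := Matrix.map_mul

lemma castMat_add (s t : Matrix (Fin m) (Fin n) ℤ) :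
    castMat R (s + t) = castMat R s + castMat R t := Matrix.map_add _ (map_add _) _ _

lemma castMat_one : castMat R (1 : Matrix (Fin n) (Fin n) ℤ) = 1 := by
  simp [castMat]

lemma castMat_zero : castMat R (0 : Matrix (Fin m) (Fin n) ℤ) = 0 := by
  simp [castMat]

lemma castMat_map {S : Type} [CommRing S] (φ : R →+* S) (s : Matrix (Fin m) (Fin n) ℤ) :
    (castMat R s).map φ = castMat S s := by
  ext i j
  simp [castMat]

/-- The matrix of the inclusion of the first summand. -/
def inlMat (m n : ℕ) : Matrix (Fin (m + n)) (Fin m) ℤ :=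
  (Matrix.fromRows 1 0).submatrix finSumFinEquiv.symm id

/-- The matrix of the inclusion of the second summand. -/
def inrMat (m n : ℕ) : Matrix (Fin (m + n)) (Fin n) ℤ :=
  (Matrix.fromRows 0 1).submatrix finSumFinEquiv.symm id

/-- The matrix of the projection to the first summand. -/
def fstMat (m n : ℕ) : Matrix (Fin m) (Fin (m + n)) ℤ :=
  (Matrix.fromCols 1 0).submatrix id finSumFinEquiv.symm

/-- The matrix of the projection to the second summand. -/
def sndMat (m n : ℕ) : Matrix (Fin n) (Fin (m + n)) ℤ :=
  (Matrix.fromCols 0 1).submatrix id finSumFinEquiv.symm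

lemma fstMat_mul_inlMat : fstMat m n * inlMat m n = 1 := by
  rw [fstMat, inlMat, Matrix.submatrix_mul_equiv, Matrix.fromCols_mul_fromRows]
  simp

lemma fstMat_mul_inrMat : fstMat m n * inrMat m n = 0 := by
  rw [fstMat, inrMat, Matrix.submatrix_mul_equiv, Matrix.fromCols_mul_fromRows]
  simp

lemma sndMat_mul_inlMat : sndMat m n * inlMat m n = 0 := by
  rw [sndMat, inlMat, Matrix.submatrix_mul_equiv, Matrix.fromCols_mul_fromRows]
  simp

lemma sndMat_mul_inrMat : sndMat m n * inrMat m n = 1 := by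
  rw [sndMat, inrMat, Matrix.submatrix_mul_equiv, Matrix.fromCols_mul_fromRows]
  simp

lemma inlMat_mul_fstMat_add : inlMat m n * fstMat m n + inrMat m n * sndMat m n = 1 := by
  have h : ∀ {l : ℕ} (A : Matrix (Fin m ⊕ Fin n) (Fin l) ℤ) (B : Matrix (Fin l) (Fin m ⊕ Fin n) ℤ),
      A.submatrix finSumFinEquiv.symm id * B.submatrix id finSumFinEquiv.symm =
        (A * B).submatrix finSumFinEquiv.symm finSumFinEquiv.symm := fun A B =>
    (Matrix.submatrix_mul A B _ _ _ Function.bijective_id).symm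
  rw [inlMat, fstMat, inrMat, sndMat, h, h, Matrix.fromRows_mul_fromCols,
    Matrix.fromRows_mul_fromCols]
  refine Eq.trans (b := Matrix.submatrix
    (Matrix.fromBlocks _ _ _ _ + Matrix.fromBlocks _ _ _ _)
    finSumFinEquiv.symm finSumFinEquiv.symm) rfl ?_
  rw [Matrix.fromBlocks_add]
  simp

/-- The block diagonal matrix with blocks `A` and `B`. -/
def blockDiag (A : Matrix (Fin m) (Fin m) R) (B : Matrix (Fin n) (Fin n) R) :
    Matrix (Fin (m + n)) (Fin (m + n)) R :=
  castMat R (inlMat m n) * A * castMat R (fstMat m n) +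
    castMat R (inrMat m n) * B * castMat R (sndMat m n)

lemma castMat_inlMat_mul (A : Matrix (Fin m) (Fin m) R) (B : Matrix (Fin n) (Fin n) R) :
    castMat R (inlMat m n) * A = blockDiag A B * castMat R (inlMat m n) := by
  rw [blockDiag, Matrix.add_mul, Matrix.mul_assoc _ (castMat R (fstMat m n)),
    Matrix.mul_assoc _ (castMat R (sndMat m n)), ← castMat_mul, ← castMat_mul, fstMat_mul_inlMat,
    sndMat_mul_inlMat, castMat_one, castMat_zero, Matrix.mul_one, Matrix.mul_zero, add_zero]

lemma castMat_inrMat_mul (A : Matrix (Fin m) (Fin m) R) (B : Matrix (Fin n) (Fin n) R) :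
    castMat R (inrMat m n) * B = blockDiag A B * castMat R (inrMat m n) := by
  rw [blockDiag, Matrix.add_mul, Matrix.mul_assoc _ (castMat R (fstMat m n)),
    Matrix.mul_assoc _ (castMat R (sndMat m n)), ← castMat_mul, ← castMat_mul, fstMat_mul_inrMat,
    sndMat_mul_inrMat, castMat_one, castMat_zero, Matrix.mul_one, Matrix.mul_zero, zero_add]

lemma castMat_fstMat_mul (A : Matrix (Fin m) (Fin m) R) (B : Matrix (Fin n) (Fin n) R) :
    castMat R (fstMat m n) * blockDiag A B = A * castMat R (fstMat m n) := by
  rw [blockDiag, Matrix.mul_add, Matrix.mul_assoc (castMat R (inlMat m n)),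
    Matrix.mul_assoc (castMat R (inrMat m n)), ← Matrix.mul_assoc, ← castMat_mul,
    fstMat_mul_inlMat, ← Matrix.mul_assoc (castMat R (fstMat m n)), ← castMat_mul,
    fstMat_mul_inrMat, castMat_one, castMat_zero, Matrix.one_mul, Matrix.zero_mul, add_zero]

lemma castMat_sndMat_mul (A : Matrix (Fin m) (Fin m) R) (B : Matrix (Fin n) (Fin n) R) :
    castMat R (sndMat m n) * blockDiag A B = B * castMat R (sndMat m n) := by
  rw [blockDiag, Matrix.mul_add, Matrix.mul_assoc (castMat R (inlMat m n)),
    Matrix.mul_assoc (castMat R (inrMat m n)), ← Matrix.mul_assoc, ← castMat_mul,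
    sndMat_mul_inlMat, ← Matrix.mul_assoc (castMat R (sndMat m n)), ← castMat_mul,
    sndMat_mul_inrMat, castMat_one, castMat_zero, Matrix.one_mul, Matrix.zero_mul, zero_add]

lemma blockDiag_mul (A A' : Matrix (Fin m) (Fin m) R) (B B' : Matrix (Fin n) (Fin n) R) :
    blockDiag (A * A') (B * B') = blockDiag A B * blockDiag A' B' := by
  conv_rhs => rw [blockDiag, Matrix.add_mul, Matrix.mul_assoc, castMat_fstMat_mul,
    Matrix.mul_assoc _ (castMat R (sndMat m n)), castMat_sndMat_mul]
  simp only [blockDiag, Matrix.mul_assoc]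

lemma blockDiag_one :
    blockDiag (1 : Matrix (Fin m) (Fin m) R) (1 : Matrix (Fin n) (Fin n) R) = 1 := by
  rw [blockDiag, Matrix.mul_one, Matrix.mul_one, ← castMat_mul, ← castMat_mul, ← castMat_add,
    inlMat_mul_fstMat_add, castMat_one]

lemma blockDiag_map {S : Type} [CommRing S] (φ : R →+* S) (A : Matrix (Fin m) (Fin m) R)
    (B : Matrix (Fin n) (Fin n) R) : (blockDiag A B).map φ = blockDiag (A.map φ) (B.map φ) := by
  simp only [blockDiag, Matrix.map_add _ (map_add φ), Matrix.map_mul, castMat_map]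

/-- The block diagonal matrix with invertible blocks `A` and `B`. -/
def blockDiagGL (A : GL (Fin m) R) (B : GL (Fin n) R) : GL (Fin (m + n)) R where
  val := blockDiag A.val B.val
  inv := blockDiag A⁻¹.val B⁻¹.val
  val_inv := by
    rw [← blockDiag_mul, ← Units.val_mul, ← Units.val_mul, mul_inv_cancel, mul_inv_cancel,
      Units.val_one, Units.val_one, blockDiag_one]
  inv_val := by
    rw [← blockDiag_mul, ← Units.val_mul, ← Units.val_mul, inv_mul_cancel, inv_mul_cancel,
      Units.val_one, Units.val_one, blockDiag_one]

lemma blockDiagGL_mul (A A' : GL (Fin m) R) (B B' : GL (Fin n) R) :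
    blockDiagGL (A * A') (B * B') = blockDiagGL A B * blockDiagGL A' B' :=
  Units.ext (blockDiag_mul _ _ _ _)

lemma blockDiagGL_inv (A : GL (Fin m) R) (B : GL (Fin n) R) :
    (blockDiagGL A B)⁻¹ = blockDiagGL A⁻¹ B⁻¹ := rfl

lemma blockDiagGL_map {S : Type} [CommRing S] (φ : R →+* S) (A : GL (Fin m) R) (B : GL (Fin n) R) :
    GeneralLinearGroup.map φ (blockDiagGL A B) =
      blockDiagGL (GeneralLinearGroup.map φ A) (GeneralLinearGroup.map φ B) :=
  Units.ext (blockDiag_map φ _ _)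

end MatrixLemmas

namespace Conn

variable {p : ℕ} [p.AtLeastTwo] {K X Y Z : Conn p}

lemma IsSplitKernelHom.comp_eq_zero {f : X ⟶ Y} {ι : K ⟶ X} (h : IsSplitKernelHom f ι) :
    ι ≫ f = 0 := by
  obtain ⟨⟨_, _, h₀⟩, ⟨_, _, h₁⟩, ⟨_, _, h₂⟩⟩ := h
  exact hom_ext h₀.mul_eq_zero h₁.mul_eq_zero h₂.mul_eq_zero

lemma IsSplitKernelHom.exists_lift {f : X ⟶ Y} {ι : K ⟶ X} (h : IsSplitKernelHom f ι)
    (g : Z ⟶ X) (hg : g ≫ f = 0) : ∃ l : Z ⟶ K, l ≫ ι = g := by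
  obtain ⟨⟨j₀, _, h₀⟩, ⟨j₁, _, h₁⟩, ⟨j₂, _, h₂⟩⟩ := h
  have g₀ : Hom.S0 f * Hom.S0 g = 0 := congrArg Hom.S0 hg
  have g₁ : Hom.S1 f * Hom.S1 g = 0 := congrArg Hom.S1 hg
  have g₂ : Hom.SInf f * Hom.SInf g = 0 := congrArg Hom.SInf hg
  have hmap : ∀ {R R' : Type} [CommRing R] [CommRing R'] (φ : R →+* R')
      {F : Matrix (Fin Y.n) (Fin X.n) R} {G : Matrix (Fin X.n) (Fin Z.n) R},
      F * G = 0 → F.map φ * G.map φ = 0 := by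
    intro R R' _ _ φ F G h
    rw [← Matrix.map_mul, h]
    simp
  let l : Hom Z K :=
    { S0 := j₀ * Hom.S0 g
      S1 := j₁ * Hom.S1 g
      SInf := j₂ * Hom.SInf g
      comm0 := h₀.lift_comm h₀ g₀ g₀ (Hom.comm0 g) (Hom.comm0 ι)
      comm1 := by
        rw [Matrix.map_mul]
        exact (h₁.map _).lift_comm h₁ (hmap _ g₁) g₁ (Hom.comm1 g) (Hom.comm1 ι)
      commInf := h₂.lift_comm h₂ g₂ g₂ (Hom.commInf g) (Hom.commInf ι)
      conn0 := by
        rw [Matrix.map_mul, Matrix.map_mul]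
        exact (h₁.map _).lift_comm (h₀.map _) (hmap _ g₁) (hmap _ g₀) (Hom.conn0 g) (Hom.conn0 ι)
      connInf := by
        rw [Matrix.map_mul, Matrix.map_mul]
        exact (h₁.map _).lift_comm (h₂.map _) (hmap _ g₁) (hmap _ g₂) (Hom.connInf g)
          (Hom.connInf ι) }
  exact ⟨l, hom_ext (h₀.proj_mul g₀) (h₁.proj_mul g₁) (h₂.proj_mul g₂)⟩

lemma IsSplitKernelHom.left_cancel {f : X ⟶ Y} {ι : K ⟶ X} (h : IsSplitKernelHom f ι)
    {l l' : Z ⟶ K} (hl : l ≫ ι = l' ≫ ι) : l = l' := by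
  obtain ⟨⟨_, _, h₀⟩, ⟨_, _, h₁⟩, ⟨_, _, h₂⟩⟩ := h
  exact hom_ext (h₀.left_cancel (congrArg Hom.S0 hl)) (h₁.left_cancel (congrArg Hom.S1 hl))
    (h₂.left_cancel (congrArg Hom.SInf hl))

/-- A morphism given by bases of the three kernels is a kernel. -/
def IsSplitKernelHom.isLimit {f : X ⟶ Y} {ι : K ⟶ X} (h : IsSplitKernelHom f ι) :
    IsLimit (KernelFork.ofι ι h.comp_eq_zero) :=
  KernelFork.IsLimit.ofι ι h.comp_eq_zero (fun g hg => (h.exists_lift g hg).choose)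
    (fun g hg => (h.exists_lift g hg).choose_spec)
    fun g hg _ hm => h.left_cancel (hm.trans (h.exists_lift g hg).choose_spec.symm)

instance : HasKernels (Conn p) where
  has_limit f := by
    obtain ⟨K, ι, h⟩ := exists_isSplitKernelHom f
    exact ⟨⟨_, h.isLimit⟩⟩

/-! ### Duals and cokernels -/

/-- The dual object: the contragredients of the five matrices. -/
def dual (X : Conn p) : Conn p where
  n := X.n
  A0 := dualGL X.A0
  A1 := dualGL X.A1
  AInf := dualGL X.AInf
  M0 := dualGL X.M0
  MInf := dualGL X.MInf
  phi_M0 := by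
    simp only [dualGL_map, X.phi_M0, dualGL_mul, dualGL_inv]
  phi_MInf := by
    simp only [dualGL_map, X.phi_MInf, dualGL_mul, dualGL_inv]
  exists_W := by
    obtain ⟨W1, W0, WInf, h, h'⟩ := X.exists_W
    refine ⟨dualGL W1, dualGL W0, dualGL WInf, ?_, ?_⟩
    · rw [dualGL_map, dualGL_map, ← h, dualGL_mul]
    · rw [dualGL_map, dualGL_map, ← h', dualGL_mul]

lemma transpose_intertwines {R : Type} [CommRing R] {m n : ℕ} {s s' : Matrix (Fin m) (Fin n) R}
    {A : GL (Fin n) R} {B : GL (Fin m) R} (h : s * A.val = B.val * s') :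
    sᵀ * (dualGL B).val = (dualGL A).val * s'ᵀ := by
  have := congrArg Matrix.transpose (IsSplitKernel.inv_intertwines h)
  rw [Matrix.transpose_mul, Matrix.transpose_mul] at this
  exact this.symm

/-- The transpose of a morphism. -/
def dualHom (f : X ⟶ Y) : dual Y ⟶ dual X :=
  let S0 : Matrix (Fin Y.n) (Fin X.n) ℂ := Hom.S0 f
  let S1 : Matrix (Fin Y.n) (Fin X.n) ℂ[T;T⁻¹] := Hom.S1 f
  let SInf : Matrix (Fin Y.n) (Fin X.n) ℂ := Hom.SInf f
  have h1 : (S1.map (laurentPhi p))ᵀ *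
      (dualGL (GeneralLinearGroup.map LaurentPolynomial.C Y.A1)).val =
      (dualGL (GeneralLinearGroup.map LaurentPolynomial.C X.A1)).val * S1ᵀ :=
    transpose_intertwines (Hom.comm1 f)
  Hom.mk (X := dual Y) (Y := dual X) S0ᵀ S1ᵀ SInfᵀ
    (transpose_intertwines (Hom.comm0 f)) h1 (transpose_intertwines (Hom.commInf f))
    (transpose_intertwines (Hom.conn0 f)) (transpose_intertwines (Hom.connInf f))

lemma dualHom_dualHom (f : X ⟶ Y) : dualHom (dualHom f) = f := rfl

lemma dualHom_comp (f : X ⟶ Y) (g : Y ⟶ Z) : dualHom (f ≫ g) = dualHom g ≫ dualHom f :=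
  hom_ext (Matrix.transpose_mul _ _) (Matrix.transpose_mul _ _) (Matrix.transpose_mul _ _)

lemma dualHom_zero : dualHom (0 : X ⟶ Y) = 0 :=
  hom_ext Matrix.transpose_zero Matrix.transpose_zero Matrix.transpose_zero

lemma IsSplitKernelHom.comp_dualHom {f : X ⟶ Y} {ι : K ⟶ dual Y}
    (h : IsSplitKernelHom (dualHom f) ι) : f ≫ (dualHom ι : Y ⟶ dual K) = 0 := by
  have := congrArg dualHom h.comp_eq_zero
  rwa [dualHom_comp, dualHom_dualHom, dualHom_zero] at this

/-- The dual of the kernel of the dual of `f` is a cokernel of `f`. -/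
def IsSplitKernelHom.isColimit {f : X ⟶ Y} {ι : K ⟶ dual Y}
    (h : IsSplitKernelHom (dualHom f) ι) :
    IsColimit (CokernelCofork.ofπ (dualHom ι : Y ⟶ dual K) h.comp_dualHom) :=
  have key : ∀ {Z : Conn p} (g : Y ⟶ Z), f ≫ g = 0 →
      ∃ l : dual K ⟶ Z, (dualHom ι : Y ⟶ dual K) ≫ l = g := by
    intro Z g hg
    obtain ⟨l, hl⟩ := h.exists_lift (dualHom g) (by rw [← dualHom_comp, hg, dualHom_zero])
    refine ⟨dualHom l, ?_⟩
    have := congrArg dualHom hl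
    rwa [dualHom_comp, dualHom_dualHom] at this
  CokernelCofork.IsColimit.ofπ _ h.comp_dualHom (fun g hg => (key g hg).choose)
    (fun g hg => (key g hg).choose_spec)
    fun {Z} g hg m hm => by
      have hm' := hm.trans (key g hg).choose_spec.symm
      exact congrArg dualHom (h.left_cancel
        (((dualHom_comp (X := Y) (Y := dual K) (dualHom ι) m).symm.trans
          (congrArg dualHom hm')).trans (dualHom_comp (X := Y) (Y := dual K) (dualHom ι) _)))

instance : HasCokernels (Conn p) where
  has_colimit f := by
    obtain ⟨K, ι, h⟩ := exists_isSplitKernelHom (dualHom f)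
    exact ⟨⟨_, h.isColimit⟩⟩

/-! ### Direct sums -/

/-- The morphism given by an integral matrix. -/
def ofInt (s : Matrix (Fin Y.n) (Fin X.n) ℤ)
    (h0 : castMat ℂ s * X.A0.val = Y.A0.val * castMat ℂ s)
    (h1 : castMat ℂ s * X.A1.val = Y.A1.val * castMat ℂ s)
    (hInf : castMat ℂ s * X.AInf.val = Y.AInf.val * castMat ℂ s)
    (hM0 : castMat _ s * X.M0.val = Y.M0.val * castMat _ s)
    (hMInf : castMat _ s * X.MInf.val = Y.MInf.val * castMat _ s) : X ⟶ Y :=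
  Hom.mk (X := X) (Y := Y) (castMat ℂ s) (castMat _ s) (castMat ℂ s) h0
    (by rw [castMat_map, ← castMat_map LaurentPolynomial.C s, ← Matrix.map_mul, ← Matrix.map_mul,
      h1])
    hInf (by rw [castMat_map, castMat_map]; exact hM0)
    (by rw [castMat_map, castMat_map]; exact hMInf)

/-- The object of rank `0`. -/
def zeroObj (p : ℕ) [p.AtLeastTwo] : Conn p where
  n := 0
  A0 := 1
  A1 := 1
  AInf := 1
  M0 := 1
  MInf := 1
  phi_M0 := by simp
  phi_MInf := by simp
  exists_W := ⟨1, 1, 1, by simp, by simp⟩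

lemma isZero_zeroObj : IsZero (zeroObj p) := by
  rw [IsZero.iff_id_eq_zero]
  have : IsEmpty (Fin (zeroObj p).n) := Fin.isEmpty
  exact hom_ext (Subsingleton.elim _ _) (Subsingleton.elim _ _) (Subsingleton.elim _ _)

instance : HasZeroObject (Conn p) := ⟨⟨_, isZero_zeroObj⟩⟩

/-- The direct sum of two objects: block diagonal matrices. -/
def sum (X Y : Conn p) : Conn p where
  n := X.n + Y.n
  A0 := blockDiagGL X.A0 Y.A0
  A1 := blockDiagGL X.A1 Y.A1
  AInf := blockDiagGL X.AInf Y.AInf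
  M0 := blockDiagGL X.M0 Y.M0
  MInf := blockDiagGL X.MInf Y.MInf
  phi_M0 := by
    simp only [blockDiagGL_map, blockDiagGL_inv, X.phi_M0, Y.phi_M0, blockDiagGL_mul]
  phi_MInf := by
    simp only [blockDiagGL_map, blockDiagGL_inv, X.phi_MInf, Y.phi_MInf, blockDiagGL_mul]
  exists_W := by
    obtain ⟨W1, W0, WInf, h, h'⟩ := X.exists_W
    obtain ⟨V1, V0, VInf, k, k'⟩ := Y.exists_W
    refine ⟨blockDiagGL W1 V1, blockDiagGL W0 V0, blockDiagGL WInf VInf, ?_, ?_⟩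
    · rw [blockDiagGL_map, blockDiagGL_map, ← h, ← k, blockDiagGL_mul]
    · rw [blockDiagGL_map, blockDiagGL_map, ← h', ← k', blockDiagGL_mul]

lemma castMat_hom_ext {f g : X ⟶ Y} {s : Matrix (Fin Y.n) (Fin X.n) ℤ}
    {t : Matrix (Fin Y.n) (Fin X.n) ℤ} (h : s = t)
    (f0 : Hom.S0 f = castMat _ s) (f1 : Hom.S1 f = castMat _ s) (fInf : Hom.SInf f = castMat _ s)
    (g0 : Hom.S0 g = castMat _ t) (g1 : Hom.S1 g = castMat _ t)
    (gInf : Hom.SInf g = castMat _ t) : f = g := by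
  subst h
  exact hom_ext (f0.trans g0.symm) (f1.trans g1.symm) (fInf.trans gInf.symm)

/-- The direct sum with its inclusions and projections. -/
def sumBicone (X Y : Conn p) : BinaryBicone X Y where
  pt := sum X Y
  fst := ofInt (X := sum X Y) (Y := X) (fstMat X.n Y.n) (castMat_fstMat_mul _ _)
    (castMat_fstMat_mul _ _) (castMat_fstMat_mul _ _) (castMat_fstMat_mul _ _)
    (castMat_fstMat_mul _ _)
  snd := ofInt (X := sum X Y) (Y := Y) (sndMat X.n Y.n) (castMat_sndMat_mul _ _)
    (castMat_sndMat_mul _ _) (castMat_sndMat_mul _ _) (castMat_sndMat_mul _ _)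
    (castMat_sndMat_mul _ _)
  inl := ofInt (X := X) (Y := sum X Y) (inlMat X.n Y.n) (castMat_inlMat_mul _ _)
    (castMat_inlMat_mul _ _) (castMat_inlMat_mul _ _) (castMat_inlMat_mul _ _)
    (castMat_inlMat_mul _ _)
  inr := ofInt (X := Y) (Y := sum X Y) (inrMat X.n Y.n) (castMat_inrMat_mul _ _)
    (castMat_inrMat_mul _ _) (castMat_inrMat_mul _ _) (castMat_inrMat_mul _ _)
    (castMat_inrMat_mul _ _)
  inl_fst := castMat_hom_ext fstMat_mul_inlMat (castMat_mul _ _).symm (castMat_mul _ _).symm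
    (castMat_mul _ _).symm castMat_one.symm castMat_one.symm castMat_one.symm
  inl_snd := castMat_hom_ext sndMat_mul_inlMat (castMat_mul _ _).symm (castMat_mul _ _).symm
    (castMat_mul _ _).symm castMat_zero.symm castMat_zero.symm castMat_zero.symm
  inr_fst := castMat_hom_ext fstMat_mul_inrMat (castMat_mul _ _).symm (castMat_mul _ _).symm
    (castMat_mul _ _).symm castMat_zero.symm castMat_zero.symm castMat_zero.symm
  inr_snd := castMat_hom_ext sndMat_mul_inrMat (castMat_mul _ _).symm (castMat_mul _ _).symm
    (castMat_mul _ _).symm castMat_one.symm castMat_one.symm castMat_one.symm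

lemma sumBicone_total (X Y : Conn p) :
    (sumBicone X Y).fst ≫ (sumBicone X Y).inl + (sumBicone X Y).snd ≫ (sumBicone X Y).inr =
      𝟙 (sumBicone X Y).pt := by
  have key : ∀ (R : Type) [CommRing R], castMat R (inlMat X.n Y.n) * castMat R (fstMat X.n Y.n) +
      castMat R (inrMat X.n Y.n) * castMat R (sndMat X.n Y.n) = 1 := by
    intro R _
    rw [← castMat_mul, ← castMat_mul, ← castMat_add, inlMat_mul_fstMat_add, castMat_one]
  exact hom_ext (key ℂ) (key _) (key ℂ)

instance : HasBinaryBiproducts (Conn p) :=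
  ⟨fun X Y => hasBinaryBiproduct_of_total (sumBicone X Y) (sumBicone_total X Y)⟩

instance : HasFiniteProducts (Conn p) := hasFiniteProducts_of_has_binary_and_terminal

instance : HasFiniteCoproducts (Conn p) := hasFiniteCoproducts_of_has_binary_and_initial

end Conn

/-! ### Exactness of the functors -/

lemma IsSplitKernel.of_transpose {R : Type} [CommRing R] {k m n : ℕ}
    {S : Matrix (Fin n) (Fin m) R} {i : Matrix (Fin n) (Fin k) R} {j : Matrix (Fin k) (Fin n) R}
    {t : Matrix (Fin n) (Fin m) R} (h : IsSplitKernel Sᵀ i j t) :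
    iᵀ * S = 0 ∧ iᵀ * jᵀ = 1 ∧ jᵀ * iᵀ + S * tᵀ = 1 := by
  refine ⟨?_, ?_, ?_⟩
  · rw [← Matrix.transpose_transpose S, ← Matrix.transpose_mul, h.mul_eq_zero,
      Matrix.transpose_zero]
  · rw [← Matrix.transpose_mul, h.left_inv, Matrix.transpose_one]
  · nth_rw 1 [← Matrix.transpose_transpose S]
    rw [← Matrix.transpose_mul, ← Matrix.transpose_mul, ← Matrix.transpose_add, h.decomp,
      Matrix.transpose_one]

section Split

variable {C : Type*} [Category C] [Preadditive C] {K X Y : C} {f : X ⟶ Y}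

/-- A split kernel in a preadditive category. -/
def isLimitOfSplit {ι : K ⟶ X} {j : X ⟶ K} {t : Y ⟶ X} (w : ι ≫ f = 0) (hj : ι ≫ j = 𝟙 K)
    (ht : j ≫ ι + f ≫ t = 𝟙 X) : IsLimit (KernelFork.ofι ι w) :=
  KernelFork.IsLimit.ofι ι w (fun g _ => g ≫ j)
    (fun g hg => by
      conv_rhs => rw [← Category.comp_id g, ← ht, Preadditive.comp_add, ← Category.assoc g f, hg,
        zero_comp, add_zero]
      rw [Category.assoc])
    fun g hg m hm => by rw [← hm, Category.assoc, hj, Category.comp_id]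

/-- A split cokernel in a preadditive category. -/
def isColimitOfSplit {π : Y ⟶ K} {j : K ⟶ Y} {t : Y ⟶ X} (w : f ≫ π = 0) (hj : j ≫ π = 𝟙 K)
    (ht : π ≫ j + t ≫ f = 𝟙 Y) : IsColimit (CokernelCofork.ofπ π w) :=
  CokernelCofork.IsColimit.ofπ π w (fun g _ => j ≫ g)
    (fun g hg => by
      conv_rhs => rw [← Category.id_comp g, ← ht, Preadditive.add_comp, Category.assoc t, hg,
        comp_zero, add_zero]
      rw [Category.assoc])
    fun g hg m hm => by rw [← hm, ← Category.assoc, hj, Category.id_comp]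

end Split

/-- The linear map given by a matrix, as a morphism. -/
def vecHom {m n : ℕ} (A : Matrix (Fin m) (Fin n) ℂ) :
    FGModuleCat.of ℂ (Fin n → ℂ) ⟶ FGModuleCat.of ℂ (Fin m → ℂ) :=
  FGModuleCat.ofHom (Matrix.mulVecLin A)

section vecHom

variable {l m n : ℕ}

lemma vecHom_comp (A : Matrix (Fin m) (Fin n) ℂ) (B : Matrix (Fin l) (Fin m) ℂ) :
    vecHom A ≫ vecHom B = vecHom (B * A) := by
  rw [vecHom, vecHom, vecHom, Matrix.mulVecLin_mul]
  rfl

lemma vecHom_one : vecHom (1 : Matrix (Fin n) (Fin n) ℂ) = 𝟙 _ := by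
  rw [vecHom, Matrix.mulVecLin_one]
  rfl

lemma vecHom_add (A B : Matrix (Fin m) (Fin n) ℂ) : vecHom (A + B) = vecHom A + vecHom B := by
  rw [vecHom, Matrix.mulVecLin_add]
  rfl

lemma vecHom_zero : vecHom (0 : Matrix (Fin m) (Fin n) ℂ) = 0 := by
  rw [vecHom, Matrix.mulVecLin_zero]
  rfl

lemma vecHom_smul (c : ℂ) (A : Matrix (Fin m) (Fin n) ℂ) : vecHom (c • A) = c • vecHom A := by
  have : Matrix.mulVecLin (c • A) = c • Matrix.mulVecLin A :=
    LinearMap.ext fun v => Matrix.smul_mulVec c A v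
  rw [vecHom, this]
  rfl

lemma vecHom_injective {A B : Matrix (Fin m) (Fin n) ℂ} (h : vecHom A = vecHom B) : A = B :=
  Matrix.toLin'.injective (congrArg (fun f => f.hom.hom) h)

end vecHom

namespace Conn

variable {p : ℕ} [p.AtLeastTwo] {K X Y Z : Conn p}

/-- A rule that is linear, and compatible with duals and with bases of kernels. -/
structure MatRule.IsExact (F : MatRule p) : Prop where
  mat_add : ∀ {X Y : Conn p} (f g : X ⟶ Y), F.mat (f + g) = F.mat f + F.mat g
  mat_smul : ∀ {X Y : Conn p} (c : ℂ) (f : X ⟶ Y), F.mat (c • f) = c • F.mat f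
  mat_dual : ∀ {X Y : Conn p} (f : X ⟶ Y), F.mat (dualHom f) = (F.mat f)ᵀ
  split : ∀ {K X Y : Conn p} {f : X ⟶ Y} {ι : K ⟶ X}, IsSplitKernelHom f ι →
    ∃ j t, IsSplitKernel (F.mat f) (F.mat ι) j t

lemma isExact_rule0 : (rule0 : MatRule p).IsExact where
  mat_add _ _ := rfl
  mat_smul _ _ := rfl
  mat_dual _ := rfl
  split h := h.split0

lemma isExact_ruleInf : (ruleInf : MatRule p).IsExact where
  mat_add _ _ := rfl
  mat_smul _ _ := rfl
  mat_dual _ := rfl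
  split h := h.splitInf

lemma isExact_rule1 (a : UnivCover) (ha : a ≠ oneT) : (rule1 a ha : MatRule p).IsExact where
  mat_add _ _ := Matrix.map_add _ (map_add _) _ _
  mat_smul c f := by
    refine (map_smul_laurent _ c (Hom.S1 f)).trans ?_
    rw [laurentEval, LaurentPolynomial.eval₂_C, RingHom.id_apply]
    rfl
  mat_dual _ := rfl
  split h := by
    obtain ⟨_, _, h⟩ := h.split1
    exact ⟨_, _, h.map _⟩

/-- A morphism is an isomorphism if its three matrices are invertible. -/
lemma isIso_of_inverses (f : X ⟶ Y) {t₀ t₂ : Matrix (Fin X.n) (Fin Y.n) ℂ}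
    {t₁ : Matrix (Fin X.n) (Fin Y.n) ℂ[T;T⁻¹]}
    (h₀ : t₀ * Hom.S0 f = 1) (h₁ : t₁ * Hom.S1 f = 1) (h₂ : t₂ * Hom.SInf f = 1)
    (k₀ : Hom.S0 f * t₀ = 1) (k₁ : Hom.S1 f * t₁ = 1) (k₂ : Hom.SInf f * t₂ = 1) : IsIso f := by
  have hmap : ∀ {R R' : Type} [CommRing R] [CommRing R'] (φ : R →+* R') {m n : ℕ}
      {F : Matrix (Fin m) (Fin n) R} {G : Matrix (Fin n) (Fin m) R},
      F * G = 1 → F.map φ * G.map φ = 1 := by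
    intro R R' _ _ φ m n F G h
    rw [← Matrix.map_mul, h]
    simp
  let g : Hom Y X :=
    { S0 := t₀
      S1 := t₁
      SInf := t₂
      comm0 := intertwines_of_inverse h₀ k₀ (Hom.comm0 f)
      comm1 := intertwines_of_inverse (hmap _ h₁) k₁ (Hom.comm1 f)
      commInf := intertwines_of_inverse h₂ k₂ (Hom.commInf f)
      conn0 := intertwines_of_inverse (hmap _ h₁) (hmap _ k₀) (Hom.conn0 f)
      connInf := intertwines_of_inverse (hmap _ h₁) (hmap _ k₂) (Hom.connInf f) }
  exact ⟨g, hom_ext h₀ h₁ h₂, hom_ext k₀ k₁ k₂⟩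

/-- A morphism is an isomorphism as soon as a functor that computes kernels makes it one. -/
lemma MatRule.IsExact.isIso_of_inverse {F : MatRule p} (hF : F.IsExact) (f : X ⟶ Y)
    {t : Matrix (Fin X.n) (Fin Y.n) ℂ} (h : t * F.mat f = 1) (h' : F.mat f * t = 1) :
    IsIso f := by
  have hn : X.n = Y.n := by
    simpa using Matrix.square_of_invertible _ _ h h'
  obtain ⟨K, ι, hι⟩ := exists_isSplitKernelHom f
  have hK : IsEmpty (Fin K.n) := by
    obtain ⟨j, t', hs⟩ := hF.split hι
    have hi : F.mat ι = 0 := by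
      rw [← Matrix.one_mul (F.mat ι), ← h, Matrix.mul_assoc, hs.mul_eq_zero, Matrix.mul_zero]
    have h01 : (1 : Matrix (Fin K.n) (Fin K.n) ℂ) = 0 := by
      rw [← hs.left_inv, hi, Matrix.mul_zero]
    refine ⟨fun i => one_ne_zero (α := ℂ) ?_⟩
    simpa using congrFun (congrFun h01 i) i
  have key : ∀ {R : Type} [CommRing R] {S : Matrix (Fin Y.n) (Fin X.n) R}
      {i : Matrix (Fin X.n) (Fin K.n) R} {j : Matrix (Fin K.n) (Fin X.n) R}
      {t : Matrix (Fin X.n) (Fin Y.n) R}, IsSplitKernel S i j t → t * S = 1 ∧ S * t = 1 := by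
    intro R _ S i j t hs
    have h1 : t * S = 1 := by
      have hij : i * j = 0 := by
        ext a b
        simp [Matrix.mul_apply]
      rw [← hs.decomp, hij, zero_add]
    exact ⟨h1, (Matrix.mul_eq_one_comm_of_equiv (finCongr hn)).1 h1⟩
  obtain ⟨⟨_, _, h₀⟩, ⟨_, _, h₁⟩, ⟨_, _, h₂⟩⟩ := hι
  exact isIso_of_inverses f (key h₀).1 (key h₁).1 (key h₂).1 (key h₀).2 (key h₁).2 (key h₂).2

/-- A functor that computes kernels is faithful: the kernel of a morphism killed by it has full
rank. -/
lemma MatRule.IsExact.eq_zero {F : MatRule p} (hF : F.IsExact) {f : X ⟶ Y} (h : F.mat f = 0) :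
    f = 0 := by
  obtain ⟨K, ι, hι⟩ := exists_isSplitKernelHom f
  obtain ⟨j, t, hs⟩ := hF.split hι
  have hij := hs.decomp
  rw [h, Matrix.mul_zero, add_zero] at hij
  have := hF.isIso_of_inverse ι hs.left_inv hij
  rw [← cancel_epi ι, hι.comp_eq_zero, comp_zero]

namespace MatRule.IsExact

variable {F : MatRule p}

lemma additive (hF : F.IsExact) : F.functor.Additive where
  map_add {_ _ f g} := (congrArg vecHom (hF.mat_add f g)).trans (vecHom_add _ _)

lemma linear (hF : F.IsExact) : F.functor.Linear ℂ where
  map_smul f c := (congrArg vecHom (hF.mat_smul c f)).trans (vecHom_smul _ _)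

lemma faithful (hF : F.IsExact) : F.functor.Faithful where
  map_injective {X Y f g} h := by
    rw [← sub_eq_zero]
    refine hF.eq_zero ?_
    have := hF.mat_add (f - g) g
    rw [sub_add_cancel, vecHom_injective h] at this
    exact right_eq_add.1 this

/-- The functor maps the kernel of `f` to a split kernel. -/
lemma preservesKernel (hF : F.IsExact) [F.functor.PreservesZeroMorphisms] (f : X ⟶ Y) :
    PreservesLimit (parallelPair f 0) F.functor := by
  obtain ⟨K, ι, h⟩ := exists_isSplitKernelHom f
  obtain ⟨j, t, hs⟩ := hF.split h
  refine preservesLimit_of_preserves_limit_cone h.isLimit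
    ((KernelFork.isLimitMapConeEquiv _ F.functor).symm ?_)
  exact isLimitOfSplit (f := vecHom (F.mat f)) (ι := vecHom (F.mat ι)) (j := vecHom j)
    (t := vecHom t) (by rw [vecHom_comp, hs.mul_eq_zero, vecHom_zero])
    (by rw [vecHom_comp, hs.left_inv, vecHom_one])
    (by rw [vecHom_comp, vecHom_comp, ← vecHom_add, hs.decomp, vecHom_one])

/-- The cokernel of `f` given by duality is mapped to a split cokernel. -/
lemma exists_cokernel (hF : F.IsExact) (f : X ⟶ Y) :
    ∃ (Q : Conn p) (π : Y ⟶ Q) (w : f ≫ π = 0), Nonempty (IsColimit (CokernelCofork.ofπ π w)) ∧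
      ∃ (j : Matrix (Fin Y.n) (Fin Q.n) ℂ) (t : Matrix (Fin X.n) (Fin Y.n) ℂ),
        F.mat π * F.mat f = 0 ∧ F.mat π * j = 1 ∧ j * F.mat π + F.mat f * t = 1 := by
  obtain ⟨K, ι, h⟩ := exists_isSplitKernelHom (dualHom f)
  obtain ⟨j, t, hs⟩ := hF.split h
  have hs' : IsSplitKernel (m := X.n) (n := Y.n) (F.mat f)ᵀ (F.mat (Y := dual Y) ι) j t := by
    rw [← hF.mat_dual]
    exact hs
  obtain ⟨h1, h2, h3⟩ := hs'.of_transpose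
  have e : F.mat (dualHom ι : Y ⟶ dual K) =
      Matrix.transpose (m := Fin Y.n) (n := Fin K.n) (F.mat (Y := dual Y) ι) := hF.mat_dual ι
  exact ⟨dual K, dualHom ι, h.comp_dualHom, ⟨h.isColimit⟩, jᵀ, tᵀ,
    (congrArg (fun P : Matrix (Fin K.n) (Fin Y.n) ℂ => P * F.mat f) e).trans h1,
    (congrArg (fun P : Matrix (Fin K.n) (Fin Y.n) ℂ => P * _) e).trans h2,
    (congrArg (fun P : Matrix (Fin K.n) (Fin Y.n) ℂ => Matrix.transpose (n := Fin Y.n) j * P +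
      F.mat f * Matrix.transpose (m := Fin Y.n) (n := Fin X.n) t) e).trans h3⟩

lemma preservesCokernel (hF : F.IsExact) [F.functor.PreservesZeroMorphisms] (f : X ⟶ Y) :
    PreservesColimit (parallelPair f 0) F.functor := by
  obtain ⟨Q, π, w, ⟨hπ⟩, j, t, h1, h2, h3⟩ := hF.exists_cokernel f
  refine preservesColimit_of_preserves_colimit_cocone hπ
    ((CokernelCofork.isColimitMapCoconeEquiv _ F.functor).symm ?_)
  exact isColimitOfSplit (f := vecHom (F.mat f)) (π := vecHom (F.mat π)) (j := vecHom j)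
    (t := vecHom t) (by rw [vecHom_comp, h1, vecHom_zero]) (by rw [vecHom_comp, h2, vecHom_one])
    (by rw [vecHom_comp, vecHom_comp, ← vecHom_add, h3, vecHom_one])

lemma reflectsIsos (hF : F.IsExact) (f : X ⟶ Y) [IsIso (F.functor.map f)] : IsIso f := by
  let t : Matrix (Fin X.n) (Fin Y.n) ℂ := LinearMap.toMatrix' (inv (F.functor.map f)).hom.hom
  have ht : vecHom t = inv (F.functor.map f) := by
    refine FGModuleCat.hom_ext ?_
    exact Matrix.toLin'_toMatrix' (inv (F.functor.map f)).hom.hom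
  refine hF.isIso_of_inverse f (t := t) (vecHom_injective ?_) (vecHom_injective ?_)
  · rw [← vecHom_comp, ht, vecHom_one]
    exact IsIso.hom_inv_id (F.functor.map f)
  · rw [← vecHom_comp, ht, vecHom_one]
    exact IsIso.inv_hom_id (F.functor.map f)

end MatRule.IsExact

/-- The coimage-image comparison is an isomorphism as `ω₀` preserves kernels and cokernels and
reflects isomorphisms. -/
instance (f : X ⟶ Y) : IsIso (Abelian.coimageImageComparison f) := by
  have := (isExact_rule0 (p := p)).additive
  have h1 : ∀ {X Y : Conn p} (f : X ⟶ Y), PreservesLimit (parallelPair f 0) (omega0 p) :=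
    isExact_rule0.preservesKernel
  have h2 : ∀ {X Y : Conn p} (f : X ⟶ Y), PreservesColimit (parallelPair f 0) (omega0 p) :=
    isExact_rule0.preservesCokernel
  have : IsIso ((omega0 p).map (Abelian.coimageImageComparison f)) :=
    IsIso.of_isIso_fac_right (Abelian.PreservesCoimage.hom_coimageImageComparison
      (omega0 p) f).symm
  exact isExact_rule0.reflectsIsos _

instance : Abelian (Conn p) := Abelian.ofCoimageImageComparisonIsIso

lemma MatRule.IsExact.isFibreFunctor {F : MatRule p} (hF : F.IsExact) :
    IsFibreFunctor ℂ F.functor where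
  additive := hF.additive
  linear := hF.linear
  faithful := hF.faithful
  leftExact :=
    have := hF.additive
    have : ∀ {X Y : Conn p} (f : X ⟶ Y), PreservesLimit (parallelPair f 0) F.functor :=
      hF.preservesKernel
    Functor.preservesFiniteLimits_of_preservesKernels _
  rightExact :=
    have := hF.additive
    have : ∀ {X Y : Conn p} (f : X ⟶ Y), PreservesColimit (parallelPair f 0) F.functor :=
      hF.preservesCokernel
    Functor.preservesFiniteColimits_of_preservesCokernels _

end Conn

/-! ### The tensor structure -/

section Matrices

variable {R : Type} [CommRing R] {a b c d n : ℕ}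

lemma kron_add_left (A A' : Matrix (Fin a) (Fin b) R) (B : Matrix (Fin c) (Fin d) R) :
    kron (A + A') B = kron A B + kron A' B := by
  ext i j
  simp [kron_apply, add_mul]

lemma kron_add_right (A : Matrix (Fin a) (Fin b) R) (B B' : Matrix (Fin c) (Fin d) R) :
    kron A (B + B') = kron A B + kron A B' := by
  ext i j
  simp [kron_apply, mul_add]

lemma kron_smul_left {K : Type} [CommRing K] [Algebra K R] (r : K) (A : Matrix (Fin a) (Fin b) R)
    (B : Matrix (Fin c) (Fin d) R) : kron (r • A) B = r • kron A B := by
  ext i j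
  simp [kron_apply]

lemma kron_smul_right {K : Type} [CommRing K] [Algebra K R] (r : K) (A : Matrix (Fin a) (Fin b) R)
    (B : Matrix (Fin c) (Fin d) R) : kron A (r • B) = r • kron A B := by
  ext i j
  simp [kron_apply]

/-- The vector `∑ e_i ⊗ e_i`. -/
def coevMat (n : ℕ) : Matrix (Fin (n * n)) (Fin 1) ℤ := fun k _ =>
  if (finProdFinEquiv.symm k).1 = (finProdFinEquiv.symm k).2 then 1 else 0

lemma kron_dualGL_mul_coevMat (A : GL (Fin n) R) :
    castMat R (coevMat n) = kron A.val (dualGL A).val * castMat R (coevMat n) := by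
  have h : A.val * A⁻¹.val = 1 := A.mul_inv
  ext k l
  have h' := congrFun (congrFun h (finProdFinEquiv.symm k).1) (finProdFinEquiv.symm k).2
  rw [Matrix.mul_apply, Matrix.one_apply] at h'
  rw [Matrix.mul_apply, ← finProdFinEquiv.sum_comp, Fintype.sum_prod_type]
  simpa [castMat, coevMat, kron_apply, dualGL] using h'.symm

lemma evMat_mul_kron_dualGL (A : GL (Fin n) R) :
    castMat R (coevMat n)ᵀ * kron (dualGL A).val A.val = castMat R (coevMat n)ᵀ := by
  have h : A⁻¹.val * A.val = 1 := A.inv_mul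
  ext k l
  have h' := congrFun (congrFun h (finProdFinEquiv.symm l).1) (finProdFinEquiv.symm l).2
  rw [Matrix.mul_apply, Matrix.one_apply] at h'
  rw [Matrix.mul_apply, ← finProdFinEquiv.sum_comp, Fintype.sum_prod_type]
  simpa [castMat, coevMat, kron_apply, dualGL] using h'

/-- The triangle identities hold over `ℤ`, hence over all the rings that occur. -/
lemma coevMat_triangle (n : ℕ) :
    kron (coevMat n)ᵀ (1 : Matrix (Fin n) (Fin n) ℤ) * permMat ℤ (assocPerm n n n).symm *
      kron (1 : Matrix (Fin n) (Fin n) ℤ) (coevMat n) =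
        permMat ℤ (leftPerm n).symm * permMat ℤ (rightPerm n) := by
  ext i j
  obtain ⟨⟨i', i⟩, rfl⟩ := finProdFinEquiv.surjective i
  obtain ⟨⟨j, j'⟩, rfl⟩ := finProdFinEquiv.surjective j
  obtain rfl := Subsingleton.elim i' 0
  obtain rfl := Subsingleton.elim j' 0
  rw [permMat_mul, Matrix.mul_apply, ← finProdFinEquiv.sum_comp, Fintype.sum_prod_type]
  simp_rw [← finProdFinEquiv.sum_comp, Fintype.sum_prod_type, mul_permMat_apply]
  simp [kron_apply, coevMat, assocPerm, permMat, leftPerm, rightPerm, Matrix.one_apply]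
  exact if_congr eq_comm rfl rfl

lemma coevMat_triangle' (n : ℕ) :
    kron (1 : Matrix (Fin n) (Fin n) ℤ) (coevMat n)ᵀ * permMat ℤ (assocPerm n n n) *
      kron (coevMat n) (1 : Matrix (Fin n) (Fin n) ℤ) =
        permMat ℤ (rightPerm n).symm * permMat ℤ (leftPerm n) := by
  ext i j
  obtain ⟨⟨i, i'⟩, rfl⟩ := finProdFinEquiv.surjective i
  obtain ⟨⟨j', j⟩, rfl⟩ := finProdFinEquiv.surjective j
  obtain rfl := Subsingleton.elim i' 0
  obtain rfl := Subsingleton.elim j' 0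
  rw [permMat_mul, Matrix.mul_apply, ← finProdFinEquiv.sum_comp, Fintype.sum_prod_type]
  simp_rw [← finProdFinEquiv.sum_comp, Fintype.sum_prod_type, mul_permMat_apply]
  simp [kron_apply, coevMat, assocPerm, permMat, leftPerm, rightPerm, Matrix.one_apply]

end Matrices

namespace Conn

variable {p : ℕ} [p.AtLeastTwo] {X Y Z : Conn p}

instance : MonoidalPreadditive (Conn p) where
  whiskerLeft_zero {X Y Z} := by
    have h : ∀ {R : Type} [CommRing R], kron (1 : Matrix (Fin X.n) (Fin X.n) R)
        (0 : Matrix (Fin Z.n) (Fin Y.n) R) = 0 := by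
      intro R _; ext i j; simp [kron_apply]
    exact hom_ext h h h
  zero_whiskerRight {X Y Z} := by
    have h : ∀ {R : Type} [CommRing R], kron (0 : Matrix (Fin Z.n) (Fin Y.n) R)
        (1 : Matrix (Fin X.n) (Fin X.n) R) = 0 := by
      intro R _; ext i j; simp [kron_apply]
    exact hom_ext h h h
  whiskerLeft_add _ _ :=
    hom_ext (kron_add_right _ _ _) (kron_add_right _ _ _) (kron_add_right _ _ _)
  add_whiskerRight _ _ :=
    hom_ext (kron_add_left _ _ _) (kron_add_left _ _ _) (kron_add_left _ _ _)

instance : MonoidalLinear ℂ (Conn p) where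
  whiskerLeft_smul _ _ _ _ _ :=
    hom_ext (kron_smul_right _ _ _) (kron_smul_right _ _ _) (kron_smul_right _ _ _)
  smul_whiskerRight _ _ _ _ _ :=
    hom_ext (kron_smul_left _ _ _) (kron_smul_left _ _ _) (kron_smul_left _ _ _)

/-- `X` and its dual are in duality. -/
instance exactPairing (X : Conn p) : ExactPairing X (dual X) where
  coevaluation' := ofInt (X := unit) (Y := tensor X (dual X)) (coevMat X.n)
    ((Matrix.mul_one _).trans (kron_dualGL_mul_coevMat _))
    ((Matrix.mul_one _).trans (kron_dualGL_mul_coevMat _))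
    ((Matrix.mul_one _).trans (kron_dualGL_mul_coevMat _))
    ((Matrix.mul_one _).trans (kron_dualGL_mul_coevMat _))
    ((Matrix.mul_one _).trans (kron_dualGL_mul_coevMat _))
  evaluation' := ofInt (X := tensor (dual X) X) (Y := unit) (coevMat X.n)ᵀ
    ((evMat_mul_kron_dualGL _).trans (Matrix.one_mul _).symm)
    ((evMat_mul_kron_dualGL _).trans (Matrix.one_mul _).symm)
    ((evMat_mul_kron_dualGL _).trans (Matrix.one_mul _).symm)
    ((evMat_mul_kron_dualGL _).trans (Matrix.one_mul _).symm)
    ((evMat_mul_kron_dualGL _).trans (Matrix.one_mul _).symm)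
  coevaluation_evaluation' := by
    have key : ∀ (R : Type) [CommRing R], kron (castMat R (coevMat X.n)ᵀ)
        (1 : Matrix (Fin X.n) (Fin X.n) R) *
        permMat R (assocPerm X.n X.n X.n).symm * kron (1 : Matrix (Fin X.n) (Fin X.n) R)
          (castMat R (coevMat X.n)) =
        permMat R (leftPerm X.n).symm * permMat R (rightPerm X.n) := by
      intro R _
      have := congrArg (castMat R) (coevMat_triangle X.n)
      simpa only [castMat, Matrix.map_mul, kron_map, permMat_map,
        Matrix.map_one _ (map_zero _) (map_one _)] using this
    exact hom_ext (key ℂ) (key _) (key ℂ)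
  evaluation_coevaluation' := by
    have key : ∀ (R : Type) [CommRing R], kron (1 : Matrix (Fin X.n) (Fin X.n) R)
        (castMat R (coevMat X.n)ᵀ) *
        permMat R (assocPerm X.n X.n X.n) * kron (castMat R (coevMat X.n))
          (1 : Matrix (Fin X.n) (Fin X.n) R) =
        permMat R (rightPerm X.n).symm * permMat R (leftPerm X.n) := by
      intro R _
      have := congrArg (castMat R) (coevMat_triangle' X.n)
      simpa only [castMat, Matrix.map_mul, kron_map, permMat_map,
        Matrix.map_one _ (map_zero _) (map_one _)] using this
    exact hom_ext (key ℂ) (key _) (key ℂ)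

/-- In a symmetric monoidal category it is enough to have a right dual of each object. -/
lemma _root_.CategoryTheory.nonempty_rigidCategory {C : Type*} [Category C] [MonoidalCategory C]
    [SymmetricCategory C] (h : ∀ X : C, ∃ Y : C, Nonempty (ExactPairing X Y)) :
    Nonempty (RigidCategory C) := by
  choose d hd using h
  let _ : RightRigidCategory C :=
    { rightDual := fun X => { rightDual := d X, exact := (hd X).some } }
  exact ⟨BraidedCategory.rigidCategoryOfRightRigidCategory⟩

/-- `End(𝟙) = ℂ`: a Laurent polynomial that is invariant under `logT ↦ p * logT` is constant, and
its value determines the other two entries of the endomorphism. -/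
lemma bijective_smul_id_unit : Function.Bijective fun c : ℂ => c • 𝟙 (𝟙_ (Conn p)) := by
  have h1 : ∀ c : ℂ, Hom.S0 (c • 𝟙 (𝟙_ (Conn p))) (0 : Fin 1) (0 : Fin 1) = c := by
    intro c
    change (c • (1 : Matrix (Fin 1) (Fin 1) ℂ)) 0 0 = c
    simp
  refine ⟨fun c c' h => by rw [← h1 c, ← h1 c']; exact congrFun (congrFun (congrArg Hom.S0 h) _) _,
    fun f => ?_⟩
  let S0 : Matrix (Fin 1) (Fin 1) ℂ := Hom.S0 f
  let S1 : Matrix (Fin 1) (Fin 1) ℂ[T;T⁻¹] := Hom.S1 f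
  let SInf : Matrix (Fin 1) (Fin 1) ℂ := Hom.SInf f
  have e1 : S1.map (laurentPhi p) = S1 := by
    have : S1.map (laurentPhi p) * (1 : Matrix (Fin 1) (Fin 1) ℂ).map LaurentPolynomial.C =
        (1 : Matrix (Fin 1) (Fin 1) ℂ).map LaurentPolynomial.C * S1 := Hom.comm1 f
    simpa using this
  have e0 : S1.map (laurentHom Sigma0) = S0.map (constHom Sigma0) := by
    have : S1.map (laurentHom Sigma0) * 1 = 1 * S0.map (constHom Sigma0) := Hom.conn0 f
    simpa using this
  have e2 : S1.map (laurentHom SigmaInf) = SInf.map (constHom SigmaInf) := by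
    have : S1.map (laurentHom SigmaInf) * 1 = 1 * SInf.map (constHom SigmaInf) := Hom.connInf f
    simpa using this
  have hc : S1 0 0 = LaurentPolynomial.C ((S1 0 0).coeff 0) := by
    have h : laurentPhi p (S1 0 0) = S1 0 0 := congrFun (congrFun e1 0) 0
    ext k
    rw [← LaurentPolynomial.single_eq_C, AddMonoidAlgebra.coeff_single, Finsupp.single_apply]
    split_ifs with hk
    · rw [← hk]
    · have hk' := coeff_laurentPhi (p := p) (S1 0 0) k
      rw [h] at hk'
      by_contra hne
      have hpk : (p : ℂ) ^ k = 1 := mul_right_cancel₀ hne (hk'.symm.trans (one_mul _).symm)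
      have hpk' : (p : ℝ) ^ k = 1 := by
        have := congrArg (‖·‖) hpk
        rwa [norm_zpow, Complex.norm_natCast, norm_one] at this
      have h2 := Nat.AtLeastTwo.prop (n := p)
      exact hk ((zpow_eq_one_iff_right₀ (Nat.cast_nonneg p)
        (by exact_mod_cast (by omega : p ≠ 1))).1 hpk').symm
  have h0 : S0 0 0 = (S1 0 0).coeff 0 := by
    refine (constHom Sigma0).injective ?_
    have := congrFun (congrFun e0 0) 0
    rw [Matrix.map_apply, Matrix.map_apply, hc, laurentHom_C] at this
    exact this.symm
  have h2 : SInf 0 0 = (S1 0 0).coeff 0 := by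
    refine (constHom SigmaInf).injective ?_
    have := congrFun (congrFun e2 0) 0
    rw [Matrix.map_apply, Matrix.map_apply, hc, laurentHom_C] at this
    exact this.symm
  have ext1 : ∀ {R : Type} (A B : Matrix (Fin 1) (Fin 1) R), A 0 0 = B 0 0 → A = B := by
    intro R A B h
    ext i j
    rwa [Subsingleton.elim i 0, Subsingleton.elim j 0]
  refine ⟨(S1 0 0).coeff 0, hom_ext (ext1 _ S0 ?_) (ext1 _ S1 ?_) (ext1 _ SInf ?_)⟩
  · rw [h0]
    change ((S1 0 0).coeff 0 • (1 : Matrix (Fin 1) (Fin 1) ℂ)) 0 0 = _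
    simp
  · refine Eq.trans ?_ hc.symm
    change ((S1 0 0).coeff 0 • (1 : Matrix (Fin 1) (Fin 1) ℂ[T;T⁻¹])) 0 0 = _
    simp [LaurentPolynomial.smul_eq_C_mul]
  · rw [h2]
    change ((S1 0 0).coeff 0 • (1 : Matrix (Fin 1) (Fin 1) ℂ)) 0 0 = _
    simp

/-- `𝓒` is a neutral Tannakian category. -/
lemma isNeutralTannakian : IsNeutralTannakian ℂ (Conn p) where
  abelian := ⟨inferInstance, rfl⟩
  tensorAdditive := inferInstance
  tensorLinear := inferInstance
  rigid := nonempty_rigidCategory fun X => ⟨dual X, ⟨inferInstance⟩⟩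
  endUnit := bijective_smul_id_unit
  exists_fibreFunctor := ⟨omega0 p, inferInstance, isExact_rule0.isFibreFunctor⟩

end Conn

/-! ### The subcategories -/

section Singular

variable {V : Set UnivCover} {k m n : ℕ}

/-- A trivialization of a subobject that is a direct summand as a module over the Laurent
polynomials has no new singularities: the only pole of a Laurent polynomial in the logarithm is
the point `(1, 0)`. -/
lemma singularLocus_subset_of_leftInverse (hV : oneT ∉ V)
    {i₁ : Matrix (Fin n) (Fin k) ℂ[T;T⁻¹]} {j₁ : Matrix (Fin k) (Fin n) ℂ[T;T⁻¹]}
    {i₀ : Matrix (Fin n) (Fin k) ℂ} {j₀ : Matrix (Fin k) (Fin n) ℂ} (h₁ : j₁ * i₁ = 1)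
    (h₀ : j₀ * i₀ = 1) {M' : GL (Fin k) (MeroT V)} {M : GL (Fin n) (MeroT V)}
    (h : i₁.map (laurentHom V) * M'.val = M.val * i₀.map (constHom V)) :
    singularLocus M' ⊆ singularLocus M := by
  intro x hx
  rw [mem_singularLocus] at hx ⊢
  refine ⟨hx.1, fun hM => hx.2 ?_⟩
  have hx0 : logT x ≠ 0 := fun h0 => hV (logT_eq_zero.1 h0 ▸ hx.1)
  have hl : ∀ {a b : ℕ} (S : Matrix (Fin a) (Fin b) ℂ[T;T⁻¹]) (i j),
      RegularAt (S.map (laurentHom V) i j) (logT x) := fun S i j => regularAt_laurentHom _ hx0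
  have hc : ∀ {a b : ℕ} (S : Matrix (Fin a) (Fin b) ℂ) (i j),
      RegularAt (S.map (constHom V) i j) (logT x) := fun S i j => regularAt_constHom _ _
  have h₁' : j₁.map (laurentHom V) * i₁.map (laurentHom V) = 1 := by
    rw [← Matrix.map_mul, h₁]
    simp
  have h₀' : j₀.map (constHom V) * i₀.map (constHom V) = 1 := by
    rw [← Matrix.map_mul, h₀]
    simp
  have e : M'.val = j₁.map (laurentHom V) * (M.val * i₀.map (constHom V)) := by
    rw [← h, ← Matrix.mul_assoc, h₁', Matrix.one_mul]
  have e' : M'⁻¹.val = j₀.map (constHom V) * (M⁻¹.val * i₁.map (laurentHom V)) := by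
    rw [← IsSplitKernel.inv_intertwines h, ← Matrix.mul_assoc, h₀', Matrix.one_mul]
  rw [mem_regularGL, e, e']
  exact ⟨regularAt_matrix_mul (hl _) (regularAt_matrix_mul hM.1 (hc _)),
    regularAt_matrix_mul (hc _) (regularAt_matrix_mul hM.2 (hl _))⟩

lemma singularLocus_dualGL (M : GL (Fin n) (MeroT V)) :
    singularLocus (dualGL M) ⊆ singularLocus M := by
  intro x hx
  rw [mem_singularLocus] at hx ⊢
  exact ⟨hx.1, fun hM => hx.2 ⟨fun i j => hM.2 j i, fun i j => hM.1 j i⟩⟩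

lemma singularLocus_blockDiagGL (A : GL (Fin m) (MeroT V)) (B : GL (Fin n) (MeroT V)) :
    singularLocus (blockDiagGL A B) ⊆ singularLocus A ∪ singularLocus B := by
  intro x hx
  simp only [Set.mem_union, mem_singularLocus] at hx ⊢
  by_contra! hc
  have hA := hc.1 hx.1
  have hB := hc.2 hx.1
  have hs : ∀ {a b : ℕ} (S : Matrix (Fin a) (Fin b) ℤ) (i j),
      RegularAt (castMat (MeroT V) S i j) (logT x) := fun S i j =>
    intCast_mem (regularSubring (coord V) (logT x)) (S i j)
  have key : ∀ {A : Matrix (Fin m) (Fin m) (MeroT V)} {B : Matrix (Fin n) (Fin n) (MeroT V)},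
      (∀ i j, RegularAt (A i j) (logT x)) → (∀ i j, RegularAt (B i j) (logT x)) →
      ∀ i j, RegularAt (blockDiag A B i j) (logT x) := fun hA hB i j =>
    (regularAt_matrix_mul (regularAt_matrix_mul (hs _) hA) (hs _) i j).add
      (regularAt_matrix_mul (regularAt_matrix_mul (hs _) hB) (hs _) i j)
  exact hx.2 ⟨key hA.1 hB.1, key hA.2 hB.2⟩

end Singular

namespace Conn

variable {p : ℕ} [p.AtLeastTwo] {K X Y Z : Conn p} {E0 EInf : Set ℂ}

/-- `𝓒_{E₀, E_∞}` contains the source of each morphism that has a left inverse, even if only as a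
triple of matrices. -/
lemma singProp_of_leftInverse (ι : K ⟶ X) {j₀ j₂ : Matrix (Fin K.n) (Fin X.n) ℂ}
    {j₁ : Matrix (Fin K.n) (Fin X.n) ℂ[T;T⁻¹]} (h₀ : j₀ * Hom.S0 ι = 1) (h₁ : j₁ * Hom.S1 ι = 1)
    (h₂ : j₂ * Hom.SInf ι = 1) (hX : singProp p E0 EInf X) : singProp p E0 EInf K := by
  have hS0 : oneT ∉ Sigma0 := (norm_one (α := ℂ)).not_lt
  have hSInf : oneT ∉ SigmaInf := (norm_one (α := ℂ)).not_gt
  exact ⟨(singularLocus_subset_of_leftInverse hS0 h₁ h₀ (Hom.conn0 ι)).trans hX.1,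
    (singularLocus_subset_of_leftInverse hSInf h₁ h₂ (Hom.connInf ι)).trans hX.2⟩

lemma IsSplitKernelHom.singProp {f : X ⟶ Y} {ι : K ⟶ X} (h : IsSplitKernelHom f ι)
    (hX : singProp p E0 EInf X) : singProp p E0 EInf K := by
  obtain ⟨⟨_, _, h₀⟩, ⟨_, _, h₁⟩, ⟨_, _, h₂⟩⟩ := h
  exact singProp_of_leftInverse ι h₀.left_inv h₁.left_inv h₂.left_inv hX

lemma singProp_dual (hX : singProp p E0 EInf X) : singProp p E0 EInf (dual X) :=
  ⟨(singularLocus_dualGL _).trans hX.1, (singularLocus_dualGL _).trans hX.2⟩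

instance : (singProp p E0 EInf).IsClosedUnderIsomorphisms where
  of_iso e hX := singProp_of_leftInverse e.inv (congrArg Hom.S0 e.inv_hom_id)
    (congrArg Hom.S1 e.inv_hom_id) (congrArg Hom.SInf e.inv_hom_id) hX

instance : (singProp p E0 EInf).IsClosedUnderKernels where
  kernels_le := by
    rintro _ ⟨f, k, hk, hf⟩
    obtain ⟨K, ι, h⟩ := exists_isSplitKernelHom f
    exact ObjectProperty.prop_of_iso _ (h.isLimit.conePointUniqueUpToIso hk) (h.singProp hf.1)

instance : (singProp p E0 EInf).IsClosedUnderCokernels where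
  cokernels_le := by
    rintro _ ⟨f, k, hk, hf⟩
    obtain ⟨K, ι, h⟩ := exists_isSplitKernelHom (dualHom f)
    exact ObjectProperty.prop_of_iso _ (h.isColimit.coconePointUniqueUpToIso hk)
      (singProp_dual (h.singProp (singProp_dual hf.2)))

instance : (singProp p E0 EInf).ContainsZero where
  exists_zero := ⟨zeroObj p, isZero_zeroObj,
    (singularLocus_one Sigma0 0).subset.trans (Set.empty_subset _),
    (singularLocus_one SigmaInf 0).subset.trans (Set.empty_subset _)⟩

lemma singProp_sum (hX : singProp p E0 EInf X) (hY : singProp p E0 EInf Y) :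
    singProp p E0 EInf (sum X Y) :=
  ⟨(singularLocus_blockDiagGL _ _).trans (Set.union_subset hX.1 hY.1),
    (singularLocus_blockDiagGL _ _).trans (Set.union_subset hX.2 hY.2)⟩

instance : (singProp p E0 EInf).IsClosedUnderBinaryProducts where
  limitsOfShape_le := by
    rintro Z ⟨h⟩
    have hs := (isBinaryBilimitOfTotal _ (sumBicone_total (h.diag.obj ⟨.left⟩)
      (h.diag.obj ⟨.right⟩))).isLimit
    exact ObjectProperty.prop_of_iso _
      (IsLimit.conePointsIsoOfNatIso hs h.isLimit (diagramIsoPair h.diag).symm)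
      (singProp_sum (h.prop_diag_obj _) (h.prop_diag_obj _))

instance : (singProp p E0 EInf).IsClosedUnderFiniteProducts :=
  ObjectProperty.IsClosedUnderFiniteProducts.mk'

lemma MatRule.IsExact.isFibreFunctor_ι_comp {F : MatRule p} (hF : F.IsExact)
    [((singProp p E0 EInf).ι ⋙ F.functor).Braided] :
    IsFibreFunctor ℂ ((singProp p E0 EInf).ι ⋙ F.functor) where
  additive :=
    have := hF.additive
    inferInstance
  linear :=
    have := hF.additive
    have := hF.linear
    inferInstance
  faithful :=
    have := hF.faithful
    inferInstance
  leftExact :=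
    have := hF.isFibreFunctor.leftExact
    have : ∀ {X Y : SubConn p E0 EInf} (f : X ⟶ Y),
      PreservesLimit (parallelPair f 0) (singProp p E0 EInf).ι :=
        fun f => (singProp p E0 EInf).preservesKernels_ι f
    have := Functor.preservesFiniteLimits_of_preservesKernels (singProp p E0 EInf).ι
    comp_preservesFiniteLimits _ _
  rightExact :=
    have := hF.isFibreFunctor.rightExact
    have : ∀ {X Y : SubConn p E0 EInf} (f : X ⟶ Y),
      PreservesColimit (parallelPair f 0) (singProp p E0 EInf).ι :=
        fun f => (singProp p E0 EInf).preservesCokernels_ι f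
    have := Functor.preservesFiniteColimits_of_preservesCokernels (singProp p E0 EInf).ι
    comp_preservesFiniteColimits _ _

/-- `𝓒_{E₀, E_∞}` is a neutral Tannakian category. -/
lemma isNeutralTannakian_subConn (E0 EInf : Set ℂ) :
    IsNeutralTannakian ℂ (SubConn p E0 EInf) where
  abelian := ⟨inferInstance, rfl⟩
  tensorAdditive := inferInstance
  tensorLinear := inferInstance
  rigid := nonempty_rigidCategory fun X => ⟨⟨dual X.obj, singProp_dual X.property⟩,
    ⟨have : ExactPairing ((singProp p E0 EInf).ι.obj X)
        ((singProp p E0 EInf).ι.obj ⟨dual X.obj, singProp_dual X.property⟩) := exactPairing X.obj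
    ExactPairing.ofFullyFaithful (singProp p E0 EInf).ι _ _⟩⟩
  endUnit := by
    have h := bijective_smul_id_unit (p := p)
    refine ⟨fun c c' hc => h.1 (congrArg (fun f => f.hom) hc), fun f => ?_⟩
    obtain ⟨c, hc⟩ := h.2 f.hom
    exact ⟨c, ObjectProperty.hom_ext _ hc⟩
  exists_fibreFunctor := ⟨(singProp p E0 EInf).ι ⋙ omega0 p, inferInstance,
    isExact_rule0.isFibreFunctor_ι_comp⟩

end Conn

/-! ### Finiteness of the singularities -/

lemma inv_mem_powOrbit {p : ℕ} {E : Set ℂ} {z : ℂ} (hz : z ∈ powOrbit p E) :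
    z⁻¹ ∈ powOrbit p E⁻¹ := by
  obtain ⟨k, ⟨e, he, rfl⟩ | h⟩ := hz
  · exact ⟨k, Or.inl ⟨e⁻¹, Set.inv_mem_inv.2 he, (inv_pow _ _).symm⟩⟩
  · exact ⟨k, Or.inr (by rw [inv_pow]; exact Set.inv_mem_inv.2 h)⟩

/-- The dynamics of the singular points under `u ↦ p u` on the left half plane. Here `Bm`, `B1`,
`Bd` and `Ba` stand for the singular points of `M₀`, of `W₁`, of `W₀ ∘ exp` and of
`φ(W₁) A₁ W₁⁻¹`. For a point `u` of `Bm`, the points `u / p ^ n` are in `Bm` and tend to `0`, so one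
of them, `v`, is in `Bd`. The points `exp (p ^ n * v)` tend to `0`, so there is a last one before
`p ^ n * v` leaves `Bd`. It is near `0` or in the image of `Ba`, where, up to periods, there are
finitely many points. -/
lemma exists_finite_powOrbit {p : ℕ} (hp : 2 ≤ p) {Bm B1 Bd Ba : Set ℂ}
    (hm : ∀ u : ℂ, u.re < 0 → p * u ∈ Bm → u ∈ Bm)
    (h1 : ∀ u : ℂ, u.re < 0 → u ∈ Bm → u ∈ B1 ∨ u ∈ Bd)
    (ha : ∀ u : ℂ, u.re < 0 → u ∈ Bd → p * u ∈ Bd ∨ u ∈ Ba)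
    (hd : ∀ u v : ℂ, Complex.exp u = Complex.exp v → u ∈ Bd → v ∈ Bd)
    (f1 : ∀ K, IsCompact K → (K ∩ B1).Finite) (fa : ∀ K, IsCompact K → (K ∩ Ba).Finite)
    (fd : ∀ r < 0, (Complex.exp '' {u | u ∈ Bd ∧ u.re ≤ r}).Finite) :
    ∃ E : Set ℂ, E.Finite ∧ E ⊆ Complex.exp '' {u | u.re < 0} ∧
      ∀ u ∈ Bm, u.re < 0 → Complex.exp u ∈ powOrbit p E := by
  have hp0 : (p : ℂ) ≠ 0 := by exact_mod_cast (by omega : p ≠ 0)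
  have hp1 : (1 : ℝ) < p := by exact_mod_cast hp
  -- a fundamental domain of `exp` in a vertical strip
  set K : Set ℂ := Set.Icc (-1) 0 ×ℂ Set.Icc 0 (2 * Real.pi) with hK
  have hKc : IsCompact K := isCompact_Icc.reProdIm isCompact_Icc
  refine ⟨Complex.exp '' ((K ∩ Ba) ∩ {u | u.re < 0}) ∪ Complex.exp '' {u | u ∈ Bd ∧ u.re ≤ -1},
    (((fa K hKc).subset Set.inter_subset_left).image _).union (fd _ (by norm_num)), ?_, ?_⟩
  · refine Set.union_subset (Set.image_mono Set.inter_subset_right) (Set.image_mono fun u hu => ?_)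
    exact hu.2.trans_lt (by norm_num)
  intro u hu hur
  have hre : ∀ n : ℕ, (u / (p : ℂ) ^ n).re = u.re / (p : ℝ) ^ n := by
    intro n
    rw [← Complex.ofReal_natCast, ← Complex.ofReal_pow, Complex.div_ofReal_re]
  have hre0 : ∀ n : ℕ, (u / (p : ℂ) ^ n).re < 0 := fun n => by
    rw [hre]
    exact div_neg_of_neg_of_pos hur (by positivity)
  have hbm : ∀ n : ℕ, u / (p : ℂ) ^ n ∈ Bm := by
    intro n
    induction n with
    | zero => simpa using hu
    | succ n ih =>
      refine hm _ (hre0 _) ?_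
      convert ih using 1
      field_simp
      ring
  -- the points `u / p ^ n` accumulate at `0` only, so one of them is not in `B1`
  obtain ⟨N, hN⟩ : ∃ N : ℕ, u / (p : ℂ) ^ N ∈ Bd := by
    by_contra! hne
    refine Set.infinite_of_injective_forall_mem (f := fun n : ℕ => u / (p : ℂ) ^ n) ?_ (fun n => ?_)
      (f1 (Metric.closedBall 0 ‖u‖) (isCompact_closedBall _ _))
    · intro m n hmn
      have h := congrArg Complex.re hmn
      simp only [hre] at h
      simp only [div_eq_mul_inv] at h
      exact pow_right_injective₀ (by linarith) hp1.ne'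
        (inv_injective (mul_left_cancel₀ hur.ne h))
    · refine ⟨?_, (h1 _ (hre0 n) (hbm n)).resolve_right (hne n)⟩
      rw [mem_closedBall_zero_iff, norm_div, norm_pow, Complex.norm_natCast]
      exact div_le_self (norm_nonneg _) (one_le_pow₀ hp1.le)
  set v := u / (p : ℂ) ^ N with hv
  have hvr : v.re < 0 := hre0 N
  have hvre : ∀ n : ℕ, ((p : ℂ) ^ n * v).re = (p : ℝ) ^ n * v.re := by
    intro n
    rw [← Complex.ofReal_natCast, ← Complex.ofReal_pow, Complex.re_ofReal_mul]
  have hvre0 : ∀ n : ℕ, ((p : ℂ) ^ n * v).re < 0 := fun n => by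
    rw [hvre]
    exact mul_neg_of_pos_of_neg (by positivity) hvr
  -- the points `exp (p ^ n * v)` accumulate at `0` only, so one of them is not singular
  have hex : ∃ n : ℕ, (p : ℂ) ^ n * v ∉ Bd := by
    by_contra! hne
    refine Set.infinite_of_injective_forall_mem
      (f := fun n : ℕ => Complex.exp ((p : ℂ) ^ n * v)) ?_ (fun n => ?_) (fd v.re hvr)
    · intro m n hmn
      have h := congrArg (fun z => Real.log ‖z‖) hmn
      simp only [Complex.norm_exp, Real.log_exp, hvre] at h
      exact pow_right_injective₀ (by linarith) hp1.ne' (mul_right_cancel₀ hvr.ne h)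
    · refine ⟨_, ⟨hne n, ?_⟩, rfl⟩
      rw [hvre]
      nlinarith [one_le_pow₀ hp1.le (n := n)]
  classical
  obtain ⟨n, hn⟩ : ∃ n, Nat.find hex = n + 1 := by
    refine Nat.exists_eq_succ_of_ne_zero fun h => ?_
    have := Nat.find_spec hex
    rw [h] at this
    simp [hN] at this
  have hx : (p : ℂ) ^ n * v ∈ Bd := not_not.1 (Nat.find_min hex (by omega : n < Nat.find hex))
  have hx' : p * ((p : ℂ) ^ n * v) ∉ Bd := by
    have := Nat.find_spec hex
    rwa [hn, pow_succ', mul_assoc] at this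
  set x := (p : ℂ) ^ n * v with hxdef
  have hxr : x.re < 0 := hvre0 n
  have hxE : Complex.exp x ∈ Complex.exp '' ((K ∩ Ba) ∩ {u | u.re < 0}) ∪
      Complex.exp '' {u | u ∈ Bd ∧ u.re ≤ -1} := by
    by_cases hr : x.re ≤ -1
    · exact Or.inr ⟨x, ⟨hx, hr⟩, rfl⟩
    refine Or.inl ?_
    -- translate `x` by a multiple of `2 π i` into the fundamental domain
    obtain ⟨j, hj⟩ : ∃ j : ℤ, x.im + j * (2 * Real.pi) ∈ Set.Ico 0 (2 * Real.pi) := by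
      obtain ⟨j, hj, -⟩ := existsUnique_add_zsmul_mem_Ico Real.two_pi_pos x.im 0
      exact ⟨j, by simpa using hj⟩
    set y : ℂ := x + j * (2 * Real.pi * Complex.I) with hy
    have hey : Complex.exp x = Complex.exp y := by
      rw [hy, Complex.exp_add, Complex.exp_int_mul_two_pi_mul_I, mul_one]
    have hyr : y.re = x.re := by simp [hy]
    have hyi : y.im = x.im + j * (2 * Real.pi) := by simp [hy]
    have hpy : Complex.exp (p * y) = Complex.exp (p * x) := by
      rw [Complex.exp_nat_mul, Complex.exp_nat_mul, hey]
    have hya : y ∈ Ba := by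
      refine (ha y (hyr ▸ hxr) (hd x y hey hx)).resolve_left fun h => hx' ?_
      exact hd _ _ hpy h
    refine ⟨y, ⟨⟨?_, hya⟩, hyr.trans_lt hxr⟩, hey.symm⟩
    rw [hK, Complex.mem_reProdIm, hyr, hyi]
    exact ⟨⟨by linarith, hxr.le⟩, hj.1, hj.2.le⟩
  have hux : (p : ℂ) ^ n * u = (p : ℂ) ^ N * x := by
    rw [hxdef, hv]
    field_simp
  rcases le_total n N with hnN | hnN
  · obtain ⟨k, rfl⟩ := Nat.exists_eq_add_of_le hnN
    refine ⟨k, Or.inl ⟨_, hxE, ?_⟩⟩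
    rw [← Complex.exp_nat_mul]
    congr 1
    refine mul_left_cancel₀ (pow_ne_zero n hp0) ?_
    rw [hux]
    push_cast
    ring
  · obtain ⟨k, rfl⟩ := Nat.exists_eq_add_of_le hnN
    refine ⟨k, Or.inr ?_⟩
    convert hxE using 1
    rw [← Complex.exp_nat_mul]
    congr 1
    refine mul_left_cancel₀ (pow_ne_zero N hp0) ?_
    rw [← hux]
    push_cast
    ring

section Trivialization

variable {p : ℕ} [p.AtLeastTwo] {V : Set UnivCover} {n : ℕ}

/-- Singular points of the data of an object on `Σ₀` or `Σ_∞`, in the notation for `Σ₀`: regularity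
of `M₀` at `u` implies regularity at `p * u`, by the functional equation; `M₀ = W₁⁻¹ (W₀ ∘ exp)`;
and `w = W₀ ∘ exp` satisfies the functional equation `φ(w) A₀ w⁻¹ = φ(W₁) A₁ W₁⁻¹`, whose right
hand side is meromorphic on the whole universal cover. -/
lemma regularGL_of_trivialization (hp : Set.MapsTo (powT p) V V) (hV : IsOpen (coord V))
    {D : Set ℂ} (hD : IsOpen D) (H : IsPullbackMap Complex.exp (coord V) D) {A₀ A₁ : GL (Fin n) ℂ}
    {M : GL (Fin n) (MeroT V)} {W₁ : GL (Fin n) (MeroT Set.univ)} {W : GL (Fin n) (Mero D)}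
    (hφ : GeneralLinearGroup.map (pullback (isPullbackMap_powT p hp)) M =
      GeneralLinearGroup.map (constHom V) A₁ * M * (GeneralLinearGroup.map (constHom V) A₀)⁻¹)
    (hW : GeneralLinearGroup.map (resHom V) W₁ * M = GeneralLinearGroup.map (pullback H) W)
    {u : ℂ} (hu : u ∈ coord V) :
    (M ∈ regularGL (coord V) n u → M ∈ regularGL (coord V) n (p * u)) ∧
    (W₁ ∈ regularGL (coord Set.univ) n u → W ∈ regularGL D n (Complex.exp u) →
      M ∈ regularGL (coord V) n u) ∧
    (GeneralLinearGroup.map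
        (pullback (isPullbackMap_powT p (Set.mapsTo_univ (powT p) Set.univ))) W₁ *
        GeneralLinearGroup.map (constHom Set.univ) A₁ * W₁⁻¹ ∈ regularGL (coord Set.univ) n u →
      W ∈ regularGL D n (Complex.exp (p * u)) → W ∈ regularGL D n (Complex.exp u)) := by
  have hpu : (p : ℂ) * u ∈ coord V := (isPullbackMap_powT p hp).mapsTo hu
  have hres : ∀ {B : GL (Fin n) (MeroT Set.univ)}, B ∈ regularGL (coord Set.univ) n u →
      GeneralLinearGroup.map (resHom V) B ∈ regularGL (coord V) n u := fun hB =>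
    (map_pullback_mem_regularGL _ hV isOpen_univ hu).2 hB
  have hc : ∀ A : GL (Fin n) ℂ, GeneralLinearGroup.map (constHom V) A ∈ regularGL (coord V) n u :=
    fun A => map_constHom_mem_regularGL A u
  have hexp := map_pullback_mem_regularGL (n := n) H hV hD (M := W) hu
  refine ⟨fun hM => ?_, fun h1 hd => ?_, fun ha hd => ?_⟩
  · refine (map_pullback_mem_regularGL (isPullbackMap_powT p hp) hV hV hu).1 ?_
    rw [hφ]
    exact mul_mem (mul_mem (hc _) hM) (inv_mem (hc _))
  · rw [← hexp, ← hW] at hd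
    exact (Subgroup.mul_mem_cancel_left _ (hres h1)).1 hd
  · -- on `V`, the matrix `φ(W₁) A₁ W₁⁻¹` equals `φ(w) A₀ w⁻¹`, where `w` is the pullback of `W`
    rw [← hexp]
    set φ := pullback (isPullbackMap_powT p hp)
    have hcomm : GeneralLinearGroup.map (resHom V) (GeneralLinearGroup.map
        (pullback (isPullbackMap_powT p (Set.mapsTo_univ (powT p) Set.univ))) W₁) =
        GeneralLinearGroup.map φ (GeneralLinearGroup.map (resHom V) W₁) := by
      refine Units.ext (Matrix.ext fun i j => ?_)
      simp only [val_glMap, Matrix.map_apply]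
      obtain ⟨g, hg, h⟩ := (W₁.val i j).exists_mk
      rw [← h]
      rfl
    have hA := hres ha
    have hw : GeneralLinearGroup.map φ (GeneralLinearGroup.map (pullback H) W) ∈
        regularGL (coord V) n u :=
      (map_pullback_mem_regularGL _ hV hV hu).2 ((map_pullback_mem_regularGL H hV hD hpu).2 hd)
    have hconst : GeneralLinearGroup.map (resHom V)
        (GeneralLinearGroup.map (constHom Set.univ) A₁) =
      GeneralLinearGroup.map (constHom V) A₁ := rfl
    rw [map_mul, map_mul, map_inv, hcomm, hconst] at hA
    have hW' : GeneralLinearGroup.map (resHom V) W₁ =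
        GeneralLinearGroup.map (pullback H) W * M⁻¹ :=
      eq_mul_inv_of_mul_eq hW
    rw [hW', map_mul, map_inv, hφ] at hA
    set w := GeneralLinearGroup.map (pullback H) W
    have e : GeneralLinearGroup.map φ w *
        (GeneralLinearGroup.map (constHom V) A₁ * M *
          (GeneralLinearGroup.map (constHom V) A₀)⁻¹)⁻¹ *
        GeneralLinearGroup.map (constHom V) A₁ * (w * M⁻¹)⁻¹ =
        GeneralLinearGroup.map φ w * GeneralLinearGroup.map (constHom V) A₀ * w⁻¹ := by
      group
    rw [e] at hA
    exact inv_mem_iff.1 ((Subgroup.mul_mem_cancel_left _ (mul_mem hw (hc A₀))).1 hA)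

end Trivialization

namespace Conn

variable {p : ℕ} [p.AtLeastTwo]

lemma exists_finite_singularLocus_M0 (X : Conn p) : ∃ E : Set ℂ, E.Finite ∧
    E ⊆ {z | 0 < ‖z‖ ∧ ‖z‖ < 1} ∧ singularLocus X.M0 ⊆ tildeSet p E := by
  obtain ⟨W₁, W₀, -, hW, -⟩ := X.exists_W
  have key := fun {u : ℂ} (hu : u.re < 0) => regularGL_of_trivialization (mapsTo_powT_Sigma0 p)
    isOpen_coord_Sigma0 isOpen_disk isPullbackMap_exp0 X.phi_M0 hW (mem_coord_Sigma0.2 hu)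
  set A := GeneralLinearGroup.map
    (pullback (isPullbackMap_powT p (Set.mapsTo_univ (powT p) Set.univ))) W₁ *
      GeneralLinearGroup.map (constHom Set.univ) X.A1 * W₁⁻¹
  obtain ⟨E, hE, hE', h⟩ := exists_finite_powOrbit (Nat.AtLeastTwo.prop (n := p))
    (Bm := {u | X.M0 ∉ regularGL (coord Sigma0) X.n u})
    (B1 := {u | W₁ ∉ regularGL (coord Set.univ) X.n u})
    (Bd := {u | W₀ ∉ regularGL disk X.n (Complex.exp u)})
    (Ba := {u | A ∉ regularGL (coord Set.univ) X.n u})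
    (fun u hu h h' => h ((key hu).1 h'))
    (fun u hu h => by
      by_contra! hc
      exact h ((key hu).2.1 (not_not.1 hc.1) (not_not.1 hc.2)))
    (fun u hu h => by
      by_contra! hc
      exact h ((key hu).2.2 (not_not.1 hc.2) (not_not.1 hc.1)))
    (fun u v huv h => by rwa [Set.mem_ofPred_eq, ← huv])
    (fun K hK => finite_notMem_regularGL hK (Set.subset_univ K) W₁)
    (fun K hK => finite_notMem_regularGL hK (Set.subset_univ K) A)
    (fun r hr => by
      have hr' : Real.exp r < 1 := Real.exp_lt_one_iff.2 hr
      refine (finite_notMem_regularGL (isCompact_closedBall (0 : ℂ) (Real.exp r))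
        (fun z hz => (mem_closedBall_zero_iff.1 hz).trans_lt hr') W₀).subset ?_
      rintro _ ⟨u, ⟨hu, hur⟩, rfl⟩
      refine ⟨?_, hu⟩
      rw [mem_closedBall_zero_iff, Complex.norm_exp]
      exact Real.exp_le_exp.2 hur)
  refine ⟨E, hE, fun z hz => ?_, fun x hx => ?_⟩
  · obtain ⟨u, hu, rfl⟩ := hE' hz
    exact ⟨norm_pos_iff.2 (Complex.exp_ne_zero u), by
      rw [Complex.norm_exp]
      exact Real.exp_lt_one_iff.2 hu⟩
  · rw [mem_singularLocus] at hx
    have hx0 : logT x ∈ coord Sigma0 := by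
      change logT.symm (logT x) ∈ Sigma0
      rw [logT.symm_apply_apply]
      exact hx.1
    have := h _ hx.2 (mem_coord_Sigma0.1 hx0)
    rwa [← proj_eq_exp_logT] at this

lemma exists_finite_singularLocus_MInf (X : Conn p) : ∃ E : Set ℂ, E.Finite ∧
    E ⊆ {z | 1 < ‖z‖} ∧ singularLocus X.MInf ⊆ tildeSet p E := by
  obtain ⟨W₁, -, W₂, -, hW⟩ := X.exists_W
  have hW' : GeneralLinearGroup.map (resHom SigmaInf) W₁ * X.MInf = GeneralLinearGroup.map
    (pullback isPullbackMap_expInf) (GeneralLinearGroup.map MeroExt.toMero W₂) := hW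
  -- the coordinate `-u` takes the right half plane to the left half plane
  have key := fun {u : ℂ} (hu : u.re < 0) => regularGL_of_trivialization (mapsTo_powT_SigmaInf p)
    isOpen_coord_SigmaInf isOpen_extDisk isPullbackMap_expInf X.phi_MInf hW'
    (u := -u) (mem_coord_SigmaInf.2 (by simpa using hu))
  simp only [mul_neg] at key
  set A := GeneralLinearGroup.map
    (pullback (isPullbackMap_powT p (Set.mapsTo_univ (powT p) Set.univ))) W₁ *
      GeneralLinearGroup.map (constHom Set.univ) X.A1 * W₁⁻¹
  have hfin : ∀ (B : GL (Fin X.n) (MeroT Set.univ)) (K : Set ℂ), IsCompact K →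
      (K ∩ {u | B ∉ regularGL (coord Set.univ) X.n (-u)}).Finite := by
    intro B K hK
    refine ((finite_notMem_regularGL hK.neg (Set.subset_univ (-K)) B).neg).subset ?_
    rintro u ⟨hu, hu'⟩
    exact ⟨by simpa using hu, hu'⟩
  obtain ⟨E, hE, hE', h⟩ := exists_finite_powOrbit (Nat.AtLeastTwo.prop (n := p))
    (Bm := {u | X.MInf ∉ regularGL (coord SigmaInf) X.n (-u)})
    (B1 := {u | W₁ ∉ regularGL (coord Set.univ) X.n (-u)})
    (Bd := {u | GeneralLinearGroup.map MeroExt.toMero W₂ ∉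
      regularGL extDisk X.n (Complex.exp (-u))})
    (Ba := {u | A ∉ regularGL (coord Set.univ) X.n (-u)})
    (fun u hu h h' => h ((key hu).1 h'))
    (fun u hu h => by
      by_contra! hc
      exact h ((key hu).2.1 (not_not.1 hc.1) (not_not.1 hc.2)))
    (fun u hu h => by
      by_contra! hc
      exact h ((key hu).2.2 (not_not.1 hc.2) (not_not.1 hc.1)))
    (fun u v huv h => by rwa [Set.mem_ofPred_eq, Complex.exp_neg, ← huv, ← Complex.exp_neg])
    (hfin W₁) (hfin A)
    (fun r hr => by
      have hr' : 1 < Real.exp (-r) := Real.one_lt_exp_iff.2 (by linarith)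
      refine ((finite_notMem_regularGL_ext hr' W₂).inv).subset ?_
      rintro _ ⟨u, ⟨hu, hur⟩, rfl⟩
      rw [Set.mem_inv, ← Complex.exp_neg]
      refine ⟨?_, hu⟩
      rw [Complex.norm_exp, Complex.neg_re]
      exact Real.exp_le_exp.2 (neg_le_neg hur))
  refine ⟨E⁻¹, hE.inv, fun z hz => ?_, fun x hx => ?_⟩
  · obtain ⟨u, hu, huz⟩ := hE' hz
    rw [Set.mem_ofPred_eq, ← inv_inv z, ← huz, ← Complex.exp_neg, Complex.norm_exp,
      Real.one_lt_exp_iff, Complex.neg_re]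
    exact neg_pos.2 hu
  · rw [mem_singularLocus] at hx
    have hx0 : logT x ∈ coord SigmaInf := by
      change logT.symm (logT x) ∈ SigmaInf
      rw [logT.symm_apply_apply]
      exact hx.1
    have := inv_mem_powOrbit (h (-logT x) (by rw [Set.mem_ofPred_eq, neg_neg]; exact hx.2)
      (by simpa using mem_coord_SigmaInf.1 hx0))
    rwa [← Complex.exp_neg, neg_neg, ← proj_eq_exp_logT] at this

end Conn

end Mahler

end

theorem mainTheorem7 (p : ℕ) [p.AtLeastTwo] :
    (IsNeutralTannakian ℂ (Conn p) ∧
      IsFibreFunctor ℂ (omega0 p) ∧ IsFibreFunctor ℂ (omegaInf p) ∧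
      ∀ (a : UnivCover) (ha : a ≠ oneT), IsFibreFunctor ℂ (omega1 p a ha)) ∧
    (∀ E0 EInf : Set ℂ, E0.Finite → EInf.Finite →
      E0 ⊆ {z | 0 < ‖z‖ ∧ ‖z‖ < 1} → EInf ⊆ {z | 1 < ‖z‖} →
      HasKernels (Conn.SubConn p E0 EInf) ∧
      IsNeutralTannakian ℂ (Conn.SubConn p E0 EInf) ∧
      IsFibreFunctor ℂ ((Conn.singProp p E0 EInf).ι ⋙ omega0 p) ∧
      IsFibreFunctor ℂ ((Conn.singProp p E0 EInf).ι ⋙ omegaInf p) ∧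
      ∀ (a : UnivCover) (ha : a ≠ oneT),
        IsFibreFunctor ℂ ((Conn.singProp p E0 EInf).ι ⋙ omega1 p a ha)) ∧
    (∀ X : Conn p, ∃ E0 EInf : Set ℂ, E0.Finite ∧ EInf.Finite ∧
      E0 ⊆ {z | 0 < ‖z‖ ∧ ‖z‖ < 1} ∧ EInf ⊆ {z | 1 < ‖z‖} ∧
      Conn.singProp p E0 EInf X) := by
  refine ⟨⟨Conn.isNeutralTannakian, Conn.isExact_rule0.isFibreFunctor,
    Conn.isExact_ruleInf.isFibreFunctor, fun a ha => (Conn.isExact_rule1 a ha).isFibreFunctor⟩,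
    fun E0 EInf _ _ _ _ => ⟨inferInstance, Conn.isNeutralTannakian_subConn E0 EInf,
      Conn.isExact_rule0.isFibreFunctor_ι_comp, Conn.isExact_ruleInf.isFibreFunctor_ι_comp,
      fun a ha => (Conn.isExact_rule1 a ha).isFibreFunctor_ι_comp⟩, fun X => ?_⟩
  obtain ⟨E0, h0, h0', h0''⟩ := X.exists_finite_singularLocus_M0
  obtain ⟨EInf, hInf, hInf', hInf''⟩ := X.exists_finite_singularLocus_MInf
  exact ⟨E0, EInf, h0, hInf, h0', hInf', h0'', hInf''⟩
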